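/- **Setting.** Let $1<\lambda\le\Lambda<\infty$, $n\ge 1$, $s\in(0,1)$. A function $g$ is called *admissible* (for $\lambda,\Lambda$) if $g:[0,\infty)\to[0,\infty)$ is right continuous, $g(0)=0$, $g(t)>0$ for $t>0$, $g$ is nondecreasing and convex on $(0,\infty)$, $\lim_{t\to\infty}g(t)=\infty$, $g$ is (locally) absolutely continuous, and $\lambda\le \frac{t g'(t)}{g(t)}\le\Lambda$ for a.e. $t>0$; $g$ is extended to $\mathbb R$ as an odd function, and $G(t)=\int_0^{|t|}g(\tau)\,d\tau$. Put $p^-=\lambda+1$, $p^+=\Lambda+1$, and write $B_R$ for the open ball of $\mathbb R^n$ with centre $0$ and radius $R$. Put $$D_su(x,y)=\frac{u(x)-u(y)}{|x-y|^s},\qquad d\mu=\frac{dx\,dy}{|x-y|^n}.$$ * For an open set $U\subset\mathbb R^n$, $\|u\|_{s,G,U}=\inf\{k>0:\int_U G(u/k)\,dx\le1\}+\inf\{k>0:\iint_{U\times U}G(D_su/k)\,d\mu\le 1\}$, with $\inf\emptyset=\infty$. * For $\Omega$ bounded, $\widetilde W^{s,G}(\Omega)$ is the set of measurable $u:\mathbb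 R^n\to\mathbb R$ such that $\int_A G(u)\,dx<\infty$ for every compact $A\subset\mathbb R^n$, and, for some open $U\supset\overline\Omega$, $\|u\|_{s,G,U}+\int_{\mathbb R^n}g\!\left(\frac{|u(x)|}{(1+|x|)^s}\right)\frac{dx}{(1+|x|)^{n+s}}<\infty$. * $W^{s,G}_0(\Omega)$ is the set of measurable $\varphi:\mathbb R^n\to\mathbb R$ with $\int_{\mathbb R^n} G(\varphi)\,dx<\infty$, $\iint_{\mathbb R^n\times\mathbb R^n}G(D_s\varphi)\,d\mu<\infty$ and $\varphi=0$ a.e. outside $\Omega$. * For $u\in\widetilde W^{s,G}(\Omega)$ and $K\ge0$, "$|(-\Delta_g)^su|\le K$ weakly in $\Omega$" means that for every $\varphi\in W_0^{s,G}(\Omega)$ with $\varphi\ge0$ a.e. in $\Omega$, $$-K\int_\Omega\varphi\,dx\ \le\ \iint_{\mathbb R^n\times\mathbb R^n} g\big(D_su\big)\,D_s\varphi\,d\mu\ \le\ K\int_\Omega\varphi\,dx.$$ * $\mathrm{Tail}_p(u;R)=\Big(R^{sp}\int_{\mathbb R^n\setminus B_R}\frac{|u(y)|^{p-1}}{|y|^{n+sp}}\,dy\Big)^{\frac1{p-1}}$.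 * $\operatorname{osc}_{B_r}u=\operatorname{ess\,sup}_{B_r}u-\operatorname{ess\,inf}_{B_r}u$. **Theorem 3.4 (oscillation decay).** For all $1<\lambda\le\Lambda$ there is $\beta=\beta(\lambda,\Lambda)>0$ such that for all $n\ge1$ and $s\in(0,1)$ there are constants $\alpha\in(0,1)$ and $C>0$, depending only on $n,s,\lambda,\Lambda$, with the following property. Let $g$ be admissible, $R_0\in(0,1)$, $K\ge0$, and let $u\in\widetilde W^{s,G}(B_{R_0})\cap L^\infty(B_{R_0})$ satisfy $|(-\Delta_g)^su|\le K$ weakly in $B_{R_0}$ and $\mathrm{Tail}_{p^+}(u;R_0)<\infty$. Then for all $r\in(0,R_0)$ $$\operatorname*{osc}_{B_r}u\ \le\ C\left(R_0^{s-\alpha}g^{-1}(K)+R_0^{-s}Q(u;R_0)\right)r^\alpha,$$ where $g^{-1}$ is the inverse of $g:[0,\infty)\to[0,\infty)$ and $$Q(u;R_0)=\left(\|u\|_{L^\infty(B_{R_0})}+\mathrm{Tail}_{p^+}(u;R_0)+\mathrm{Tail}_{p^-}(u;R_0)\right)^\beta .$$ -/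

import Mathlib

open MeasureTheory Set Filter Topology
open scoped ENNReal

noncomputable section

namespace OrliczOsc

/-- The structural assumptions on `g`, the derivative of the Young function. The function `g`,
given on `[0, ∞)`, is extended to `ℝ` as an odd function. -/
structure IsAdmissible (lam Lam : ℝ) (g : ℝ → ℝ) : Prop where
  odd : ∀ t, g (-t) = -g t
  pos : ∀ t, 0 < t → 0 < g t
  mono : MonotoneOn g (Ioi 0)
  tendsto_atTop : Tendsto g atTop atTop
  right_cont : ∀ t, 0 ≤ t → ContinuousWithinAt g (Ici t) t
  abs_cont : ∀ T, 0 < T → AbsolutelyContinuousOnInterval g 0 T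
  one_lt : 1 < lam
  growth : ∀ᵐ t ∂(volume.restrict (Ioi (0 : ℝ))),
    lam ≤ t * deriv g t / g t ∧ t * deriv g t / g t ≤ Lam
  convex : ConvexOn ℝ (Ioi 0) g

/-- The Young function `G(t) = ∫₀ᵗ g`, extended evenly to `ℝ`. -/
def young (g : ℝ → ℝ) (t : ℝ) : ℝ := ∫ τ in (0 : ℝ)..|t|, g τ

/-- The inverse of `g : [0, ∞) → [0, ∞)`, which is a bijection for admissible `g`. -/
def gInv (g : ℝ → ℝ) (y : ℝ) : ℝ := Function.invFunOn g (Ici 0) y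

/-- `ℝⁿ` with the Euclidean norm. -/
abbrev Rn (n : ℕ) : Type := EuclideanSpace ℝ (Fin n)

variable {n : ℕ}

/-- The Hölder quotient `D_s u (x, y) = (u x - u y) / |x - y|^s`. -/
def holderQuot (s : ℝ) (u : Rn n → ℝ) (p : Rn n × Rn n) : ℝ :=
  (u p.1 - u p.2) / ‖p.1 - p.2‖ ^ s

/-- The measure `dμ = dx dy / |x - y|^n` on `ℝⁿ × ℝⁿ`. -/
def muMeasure (n : ℕ) : Measure (Rn n × Rn n) :=
  ((volume : Measure (Rn n)).prod volume).withDensity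
    fun p => ENNReal.ofReal (1 / ‖p.1 - p.2‖ ^ n)

/-- The Orlicz modular `∫ G(f) dν`. -/
def modular {X : Type*} [MeasurableSpace X] (g : ℝ → ℝ) (f : X → ℝ) (ν : Measure X) : ℝ≥0∞ :=
  ∫⁻ x, ENNReal.ofReal (young g (f x)) ∂ν

/-- The Luxemburg functional `inf {k > 0 : ∫ G(f / k) dν ≤ 1}`, with `inf ∅ = ∞`. -/
def luxemburg {X : Type*} [MeasurableSpace X] (g : ℝ → ℝ) (f : X → ℝ) (ν : Measure X) : ℝ≥0∞ :=
  ⨅ (k : ℝ) (_ : 0 < k) (_ : modular g (fun x => f x / k) ν ≤ 1), ENNReal.ofReal k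

/-- The norm `‖u‖_{s,G,U} = ‖u‖_{G,U} + [u]_{s,G,U}`. -/
def sobNorm (g : ℝ → ℝ) (s : ℝ) (U : Set (Rn n)) (u : Rn n → ℝ) : ℝ≥0∞ :=
  luxemburg g u (volume.restrict U) +
    luxemburg g (holderQuot s u) ((muMeasure n).restrict (U ×ˢ U))

/-- `u ∈ W^{s,G}(ℝⁿ)`. -/
def MemW (g : ℝ → ℝ) (s : ℝ) (u : Rn n → ℝ) : Prop :=
  AEMeasurable u volume ∧ modular g u volume < ∞ ∧ modular g (holderQuot s u) (muMeasure n) < ∞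

/-- `u ∈ W₀^{s,G}(Ω)`: `u ∈ W^{s,G}(ℝⁿ)` and `u = 0` a.e. outside `Ω`. -/
def MemW0 (g : ℝ → ℝ) (s : ℝ) (Ω : Set (Rn n)) (u : Rn n → ℝ) : Prop :=
  MemW g s u ∧ ∀ᵐ x, x ∉ Ω → u x = 0

/-- `u ∈ L^G_loc(ℝⁿ)`. -/
def MemLGloc (g : ℝ → ℝ) (u : Rn n → ℝ) : Prop :=
  AEMeasurable u volume ∧
    ∀ A : Set (Rn n), IsCompact A → modular g u (volume.restrict A) < ∞

/-- `u` belongs to the space `W̃^{s,G}(Ω)`, for `Ω` bounded. -/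
def MemWtilde (g : ℝ → ℝ) (s : ℝ) (Ω : Set (Rn n)) (u : Rn n → ℝ) : Prop :=
  MemLGloc g u ∧
  ∃ U : Set (Rn n), IsOpen U ∧ IsCompact (closure Ω) ∧ closure Ω ⊆ U ∧
    sobNorm g s U u +
      ∫⁻ x, ENNReal.ofReal (g (|u x| / (1 + ‖x‖) ^ s) / (1 + ‖x‖) ^ (n + s)) < ∞

/-- The form `∬ g(D_s u) D_s φ dμ`. For `u ∈ W̃^{s,G}(Ω)` and `φ ∈ W₀^{s,G}(Ω)` the integrand
is integrable. -/
def energyForm (g : ℝ → ℝ) (s : ℝ) (u φ : Rn n → ℝ) : ℝ :=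
  ∫ p, g (holderQuot s u p) * holderQuot s φ p ∂(muMeasure n)

/-- `(-Δ_g)^s u ≤ f` weakly in `Ω`, for `u ∈ W̃^{s,G}(Ω)` and a function `f` for which
`φ ↦ ∫_Ω f φ` is well defined on `W₀^{s,G}(Ω)` (such as a constant, if `Ω` is bounded). -/
def IsWeakSubsol (g : ℝ → ℝ) (s : ℝ) (Ω : Set (Rn n)) (u f : Rn n → ℝ) : Prop :=
  ∀ φ : Rn n → ℝ, MemW0 g s Ω φ → (∀ᵐ x ∂(volume.restrict Ω), 0 ≤ φ x) →
    energyForm g s u φ ≤ ∫ x in Ω, f x * φ x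

/-- `(-Δ_g)^s u ≥ f` weakly in `Ω`: `(-Δ_g)^s (-u) ≤ -f` weakly in `Ω`. -/
def IsWeakSupersol (g : ℝ → ℝ) (s : ℝ) (Ω : Set (Rn n)) (u f : Rn n → ℝ) : Prop :=
  IsWeakSubsol g s Ω (fun x => -u x) (fun x => -f x)

/-- `|(-Δ_g)^s u| ≤ K` weakly in `Ω`. -/
def WeaklyBounded (g : ℝ → ℝ) (s : ℝ) (Ω : Set (Rn n)) (u : Rn n → ℝ) (K : ℝ) : Prop :=
  IsWeakSubsol g s Ω u (fun _ => K) ∧ IsWeakSupersol g s Ω u (fun _ => -K)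

/-- The nonlocal tail `Tail_p(u; R)`, centred at the origin. -/
def tail (s p : ℝ) (u : Rn n → ℝ) (R : ℝ) : ℝ≥0∞ :=
  (ENNReal.ofReal (R ^ (s * p)) *
    ∫⁻ y in (Metric.ball (0 : Rn n) R)ᶜ,
      ENNReal.ofReal (|u y| ^ (p - 1) / ‖y‖ ^ (n + s * p))) ^ (1 / (p - 1))

/-- The oscillation (essential supremum minus essential infimum) over the ball `B_r`. -/
def osc (u : Rn n → ℝ) (r : ℝ) : ℝ :=
  essSup u (volume.restrict (Metric.ball 0 r)) - essInf u (volume.restrict (Metric.ball 0 r))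

/-- `Q(u; R) = (‖u‖_{L^∞(B_R)} + Tail_{p⁺}(u; R) + Tail_{p⁻}(u; R))^β`, where
`p⁻ = lam + 1` and `p⁺ = Lam + 1`. -/
def Q (s lam Lam β : ℝ) (u : Rn n → ℝ) (R : ℝ) : ℝ :=
  ((eLpNorm u ∞ (volume.restrict (Metric.ball 0 R))).toReal +
    (tail s (Lam + 1) u R).toReal + (tail s (lam + 1) u R).toReal) ^ β

end OrliczOsc

end

/-!
# Oscillation decay for the fractional `g`-Laplacian

The proof is a nonlocal barrier argument; it uses no Sobolev inequality and no iteration over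
level sets. Of `g` it needs that it is odd, monotone and convex on `[0, ∞)`, and that it satisfies
the doubling inequality `g (b * t) ≤ b ^ Lam * g t` for `b ≥ 1`. The exponent `β = 1` is the only
possible one, since the estimate is homogeneous.

The heart is a growth lemma (`exists_hasGrowth`). Let `w ≥ 0` in `B_ρ` satisfy `(-Δ_g)^s w ≥ -K`
weakly, let the negative part of `w` have a small tail, and let `w ≥ H` on half of the annulus
`B_ρ \ B_{ρ/2}`. Then `w ≥ θ * H` in `B_{ρ/4}`. To see this, test the inequality with the excess
`φ = (ψ - w)₊` of the low barrier `ψ = ε * H * (1/4 - |x|²/ρ²)₊` over `w`. Inside `B_ρ`, the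
monotonicity of `g` gives `g (D_s w) D_s φ ≤ g (D_s ψ) D_s φ`. Where `φ > 0`, `w` is far below its
values on the annulus, and these long-range interactions contribute to the form at most `-c * g (H
/ ρ ^ s) * ρ ^ (-s) * ∫ φ`. All the other contributions are bounded by a small multiple of `g (H /
ρ ^ s) * ρ ^ (-s) * ∫ φ`: that of the exterior of `B_ρ` by hypothesis, and the form of the barrier
by `integral_energyDensity_bump_le`. Hence `∫ φ = 0`.

For the form of the barrier one translates in `∫ g ((ψ x - ψ (x + h)) / |h| ^ s) (φ x - φ (x + h))
dx`, so that the difference falls on `g (D_s ψ)`. Only an upper bound is needed, so it suffices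
that `ψ` is semiconvex and Lipschitz; the convexity of `g` turns this into an integrable function
of `h` (`barrier_increment_le`), for all `s` in `(0, 1)`.

The oscillation is then reduced by a fixed factor from `B_ρ` to `B_{ρ/4}`, by applying the growth
lemma to `u - m` or to `m + h - u`, where `[m, m + h]` contains the values of `u` in `B_ρ`: one of
them is at least `h / 2` on half of the annulus. The iteration (`IsControlled.exists_trapped`)
also keeps track of the growth of `u` outside `B_ρ`, whose contribution to the tail is small if
`α` is. The tail outside `B_{R₀}` is controlled by `Tail_{p⁺}` alone (`tail_controls`), so
`Tail_{p⁻}` enters only through its nonnegativity.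
-/

namespace OrliczOsc

/-! ### Properties of `g` -/

section Young

variable {lam Lam : ℝ} {g : ℝ → ℝ}

namespace IsAdmissible

lemma zero (hg : IsAdmissible lam Lam g) : g 0 = 0 := by
  have := hg.odd 0
  simp only [neg_zero] at this
  linarith

lemma nonneg (hg : IsAdmissible lam Lam g) {t : ℝ} (ht : 0 ≤ t) : 0 ≤ g t := by
  rcases ht.eq_or_lt with rfl | h
  · exact hg.zero.ge
  · exact (hg.pos t h).le

lemma monotone (hg : IsAdmissible lam Lam g) : Monotone g := by
  have h0 : ∀ a b, 0 ≤ a → a ≤ b → g a ≤ g b := by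
    intro a b ha hab
    rcases ha.eq_or_lt with rfl | ha
    · rw [hg.zero]
      exact hg.nonneg hab
    · exact hg.mono ha (ha.trans_le hab) hab
  intro a b hab
  rcases le_total 0 a with ha | ha
  · exact h0 a b ha hab
  · rcases le_total 0 b with hb | hb
    · have h1 := hg.odd a
      have h2 := hg.nonneg (t := -a) (by linarith)
      have h3 := hg.nonneg hb
      linarith
    · have h1 := hg.odd a
      have h2 := hg.odd b
      have h3 := h0 (-b) (-a) (by linarith) (by linarith)
      linarith

lemma continuousOn_Ici (hg : IsAdmissible lam Lam g) : ContinuousOn g (Ici 0) := by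
  intro t ht
  have ht' : (0 : ℝ) ≤ t := ht
  have h1 := (hg.abs_cont (t + 1) (by linarith)).continuousOn
  rw [uIcc_of_le (by linarith)] at h1
  have h2 := h1 t ⟨ht', by linarith⟩
  refine h2.mono_of_mem_nhdsWithin ?_
  rw [← Ici_inter_Iic]
  exact inter_mem self_mem_nhdsWithin (mem_nhdsWithin_of_mem_nhds (Iic_mem_nhds (by linarith)))

lemma continuous (hg : IsAdmissible lam Lam g) : Continuous g := by
  have h1 : ContinuousOn g (Iic 0) := by
    have : g = fun t => -g (-t) := by
      ext t
      rw [hg.odd]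
      ring
    rw [this]
    refine (hg.continuousOn_Ici.comp continuous_neg.continuousOn ?_).neg
    intro x hx
    simpa using hx
  have h2 := hg.continuousOn_Ici.union_of_isClosed h1 isClosed_Ici isClosed_Iic
  rw [Ici_union_Iic] at h2
  exact continuousOn_univ.mp h2

lemma abs_apply (hg : IsAdmissible lam Lam g) (t : ℝ) : |g t| = g |t| := by
  rcases le_total 0 t with ht | ht
  · rw [abs_of_nonneg ht, abs_of_nonneg (hg.nonneg ht)]
  · have h := hg.nonneg (t := -t) (by linarith)
    rw [abs_of_nonpos ht, ← abs_neg, ← hg.odd, abs_of_nonneg h]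

/-- The convexity inequality on the closed half-line, the endpoint `0` being reached by
continuity. -/
lemma convexOn_Ici (hg : IsAdmissible lam Lam g) : ConvexOn ℝ (Ici 0) g := by
  have h := hg.continuousOn_Ici
  refine ⟨convex_Ici 0, ?_⟩
  intro x hx y hy a b ha hb hab
  have hx' : (0 : ℝ) ≤ x := hx
  have hy' : (0 : ℝ) ≤ y := hy
  -- Shift both points by `e > 0` and let `e → 0`.
  have key : ∀ e : ℝ, 0 < e → g (a • x + b • y + e) ≤ a • g (x + e) + b • g (y + e) := by
    intro e he
    have hxe : x + e ∈ Ioi (0 : ℝ) := by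
      rw [mem_Ioi]
      linarith
    have hye : y + e ∈ Ioi (0 : ℝ) := by
      rw [mem_Ioi]
      linarith
    have := hg.convex.2 hxe hye ha hb hab
    convert! this using 2
    simp only [smul_eq_mul]
    linear_combination (-e) * hab
  have hl : Tendsto (fun e => g (a • x + b • y + e)) (𝓝[>] 0) (𝓝 (g (a • x + b • y))) := by
    have : ContinuousAt (fun e => g (a • x + b • y + e)) 0 :=
      (hg.continuous.comp (by fun_prop)).continuousAt
    simpa using this.tendsto.mono_left nhdsWithin_le_nhds
  have hr : Tendsto (fun e => a • g (x + e) + b • g (y + e)) (𝓝[>] 0)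
      (𝓝 (a • g x + b • g y)) := by
    have : ContinuousAt (fun e => a • g (x + e) + b • g (y + e)) 0 := by
      have h1 : Continuous fun e => g (x + e) := hg.continuous.comp (by fun_prop)
      have h2 : Continuous fun e => g (y + e) := hg.continuous.comp (by fun_prop)
      exact ((h1.const_smul a).add (h2.const_smul b)).continuousAt
    simpa using this.tendsto.mono_left nhdsWithin_le_nhds
  refine le_of_tendsto_of_tendsto hl hr ?_
  filter_upwards [self_mem_nhdsWithin] with e he
  exact key e he

lemma apply_mul_le (hg : IsAdmissible lam Lam g) {z t : ℝ} (hz : 0 ≤ z) (hz1 : z ≤ 1)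
    (ht : 0 ≤ t) : g (z * t) ≤ z * g t := by
  have h0 : (0 : ℝ) ∈ Ici (0 : ℝ) := self_mem_Ici
  have := hg.convexOn_Ici.2 (show t ∈ Ici (0 : ℝ) from ht) h0 hz (sub_nonneg.mpr hz1) (by ring)
  simpa [hg.zero] using this

lemma le_apply_mul (hg : IsAdmissible lam Lam g) {z t : ℝ} (hz : 1 ≤ z) (ht : 0 ≤ t) :
    z * g t ≤ g (z * t) := by
  have h0 : 0 < z := by linarith
  have := hg.apply_mul_le (z := z⁻¹) (t := z * t) (by positivity) (inv_le_one_of_one_le₀ hz)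
    (by positivity)
  rw [inv_mul_cancel_left₀ h0.ne'] at this
  rwa [le_inv_mul_iff₀ h0] at this

lemma Lam_pos (hg : IsAdmissible lam Lam g) : 0 < Lam := by
  have h := hg.growth
  have : (volume.restrict (Ioi (0 : ℝ))) ≠ 0 := by
    rw [Ne, Measure.restrict_eq_zero]
    simp
  have : (ae (volume.restrict (Ioi (0 : ℝ)))).NeBot := ae_neBot.mpr this
  obtain ⟨t, h1, h2⟩ := h.exists
  have := hg.one_lt
  linarith

/-- The doubling inequality: `t ↦ t ^ (-Lam) * g t` is absolutely continuous away from `0`, with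
nonpositive derivative. -/
lemma apply_mul_le_rpow (hg : IsAdmissible lam Lam g) {b t : ℝ} (hb : 1 ≤ b) (ht : 0 ≤ t) :
    g (b * t) ≤ b ^ Lam * g t := by
  rcases ht.eq_or_lt with rfl | ht
  · simp [hg.zero]
  have hbt : t ≤ b * t := le_mul_of_one_le_left ht.le hb
  have hbt0 : 0 < b * t := by positivity
  have h1 : AbsolutelyContinuousOnInterval g t (b * t) := by
    refine (hg.abs_cont (b * t) hbt0).mono ?_
    rw [uIcc_of_le hbt, uIcc_of_le hbt0.le]
    exact Icc_subset_Icc_left ht.le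
  have h2 : AbsolutelyContinuousOnInterval (fun x : ℝ => x ^ (-Lam)) t (b * t) := by
    apply ContDiffOn.absolutelyContinuousOnInterval
    intro x hx
    rw [uIcc_of_le hbt] at hx
    exact (Real.contDiffAt_rpow_const_of_ne (by linarith [hx.1])).contDiffWithinAt
  have h3 := h1.integral_deriv_mul_eq_sub h2
  have h4 : ∫ x in t..(b * t), deriv g x * x ^ (-Lam) + g x * deriv (fun x : ℝ => x ^ (-Lam)) x
      ≤ 0 := by
    rw [intervalIntegral.integral_of_le hbt]
    refine integral_nonpos_of_ae ?_
    have hsub : Ioc t (b * t) ⊆ Ioi 0 := fun x hx => ht.trans hx.1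
    filter_upwards [ae_restrict_of_ae_restrict_of_subset hsub hg.growth,
      ae_restrict_mem measurableSet_Ioc] with x hx hx2
    have hx0 : 0 < x := ht.trans hx2.1
    have hgx := hg.pos x hx0
    have h5 := hx.2
    rw [div_le_iff₀ hgx] at h5
    have h6 : deriv (fun x : ℝ => x ^ (-Lam)) x = -Lam * x ^ (-Lam - 1) := by
      rw [Real.deriv_rpow_const]
    have h7 : x ^ (-Lam) = x * x ^ (-Lam - 1) := by
      rw [Real.rpow_sub_one hx0.ne']
      field_simp
    have h8 : 0 < x ^ (-Lam - 1) := Real.rpow_pos_of_pos hx0 _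
    simp only [Pi.zero_apply]
    rw [h6, h7]
    nlinarith
  rw [h3, Real.mul_rpow (by linarith) ht.le, Real.rpow_neg (by linarith), Real.rpow_neg ht.le] at h4
  have h5 : 0 < b ^ Lam := Real.rpow_pos_of_pos (by linarith) _
  have h6 : 0 < t ^ Lam := Real.rpow_pos_of_pos ht _
  have h7 : g (b * t) * ((b ^ Lam)⁻¹ * (t ^ Lam)⁻¹) ≤ g t * (t ^ Lam)⁻¹ := by linarith
  rw [← mul_assoc] at h7
  have h8 := le_of_mul_le_mul_right h7 (by positivity)
  rwa [mul_inv_le_iff₀ h5, mul_comm (g t)] at h8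

lemma apply_add_le (hg : IsAdmissible lam Lam g) {a b : ℝ} (ha : 0 ≤ a) (hb : 0 ≤ b) :
    g (a + b) ≤ g (2 * a) + g (2 * b) := by
  have h1 := hg.nonneg (t := 2 * a) (by linarith)
  have h2 := hg.nonneg (t := 2 * b) (by linarith)
  rcases le_total a b with h | h
  · have := hg.monotone (show a + b ≤ 2 * b by linarith)
    linarith
  · have := hg.monotone (show a + b ≤ 2 * a by linarith)
    linarith

/-- A Lipschitz bound for `g` on `[-m, m]`: by convexity the slopes are at most the slope of the
chord from `m` to `2 * m`. -/
lemma sub_le (hg : IsAdmissible lam Lam g) {a b m : ℝ} (hm : 0 < m) (ha : |a| ≤ m) (hb : |b| ≤ m)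
    (hba : b ≤ a) : g a - g b ≤ 2 * (g (2 * m) / m) * (a - b) := by
  have hpos : ∀ x y : ℝ, 0 ≤ x → x ≤ y → y ≤ m → g y - g x ≤ g (2 * m) / m * (y - x) := by
    intro x y hx hxy hym
    rcases hxy.eq_or_lt with rfl | hxy
    · simp
    have h1 := hg.convexOn_Ici.slope_mono_adjacent (x := x) (y := y) (z := 2 * m) hx
      (by simp; linarith) hxy (by linarith)
    have h2 : (g (2 * m) - g y) / (2 * m - y) ≤ g (2 * m) / m := by
      have := hg.nonneg (t := y) (by linarith)
      gcongr
      · exact hg.nonneg (by linarith)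
      · linarith
      · linarith
    have h3 := h1.trans h2
    rwa [div_le_iff₀ (by linarith)] at h3
  have hS : 0 ≤ g (2 * m) / m := div_nonneg (hg.nonneg (by linarith)) hm.le
  rw [abs_le] at ha hb
  rcases le_total 0 b with h0b | h0b
  · have := hpos b a h0b hba ha.2
    nlinarith
  rcases le_total a 0 with h0a | h0a
  · have := hpos (-a) (-b) (by linarith) (by linarith) (by linarith)
    rw [hg.odd, hg.odd] at this
    nlinarith
  · have h1 := hpos 0 a le_rfl h0a ha.2
    have h2 := hpos 0 (-b) le_rfl (by linarith) (by linarith)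
    rw [hg.zero] at h1 h2
    rw [hg.odd] at h2
    nlinarith

lemma apply_mul_self_nonneg (hg : IsAdmissible lam Lam g) (t : ℝ) : 0 ≤ g t * t := by
  rcases le_total 0 t with h | h
  · exact mul_nonneg (hg.nonneg h) h
  · have := hg.monotone h
    rw [hg.zero] at this
    exact mul_nonneg_of_nonpos_of_nonpos this h

lemma apply_mul_self_abs (hg : IsAdmissible lam Lam g) (t : ℝ) : g |t| * |t| = g t * t := by
  rw [← hg.abs_apply, ← abs_mul, abs_of_nonneg (hg.apply_mul_self_nonneg t)]

lemma apply_mul_self_mono (hg : IsAdmissible lam Lam g) {a b : ℝ} (h : |a| ≤ |b|) :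
    g a * a ≤ g b * b := by
  rw [← hg.apply_mul_self_abs a, ← hg.apply_mul_self_abs b]
  exact mul_le_mul (hg.monotone h) h (abs_nonneg a) (hg.nonneg (abs_nonneg b))

lemma abs_apply_mul_le (hg : IsAdmissible lam Lam g) (a b : ℝ) :
    |g a * b| ≤ g a * a + g b * b := by
  have h1 := hg.apply_mul_self_nonneg a
  have h2 := hg.apply_mul_self_nonneg b
  rw [abs_mul, hg.abs_apply]
  rcases le_total |a| |b| with h | h
  · have h3 := mul_le_mul_of_nonneg_right (hg.monotone h) (abs_nonneg b)
    rw [hg.apply_mul_self_abs] at h3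
    linarith
  · have h3 := mul_le_mul_of_nonneg_left h (hg.nonneg (abs_nonneg a))
    rw [hg.apply_mul_self_abs] at h3
    linarith

lemma apply_mul_self_mul_le (hg : IsAdmissible lam Lam g) {b : ℝ} (hb : 1 ≤ b) (t : ℝ) :
    g (b * t) * (b * t) ≤ b ^ (Lam + 1) * (g t * t) := by
  have hb0 : 0 < b := by linarith
  have h := hg.apply_mul_le_rpow hb (abs_nonneg t)
  rw [← hg.apply_mul_self_abs, ← hg.apply_mul_self_abs t, abs_mul, abs_of_pos hb0,
    Real.rpow_add_one hb0.ne']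
  calc g (b * |t|) * (b * |t|) ≤ (b ^ Lam * g |t|) * (b * |t|) := by gcongr
    _ = _ := by ring

lemma apply_mul_self_add_le (hg : IsAdmissible lam Lam g) (a b : ℝ) :
    g (a + b) * (a + b) ≤ 2 ^ (Lam + 1) * (g a * a + g b * b) := by
  have h1 := hg.apply_mul_self_nonneg a
  have h2 := hg.apply_mul_self_nonneg b
  have h3 : (0 : ℝ) < 2 ^ (Lam + 1) := by positivity
  rw [mul_add]
  rcases le_total |a| |b| with h | h
  · have h4 : |a + b| ≤ |2 * b| := by
      rw [abs_mul, abs_two]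
      linarith [abs_add_le a b]
    have h5 := hg.apply_mul_self_mono h4
    have h6 := hg.apply_mul_self_mul_le one_le_two b
    nlinarith
  · have h4 : |a + b| ≤ |2 * a| := by
      rw [abs_mul, abs_two]
      linarith [abs_add_le a b]
    have h5 := hg.apply_mul_self_mono h4
    have h6 := hg.apply_mul_self_mul_le one_le_two a
    nlinarith

lemma young_le (hg : IsAdmissible lam Lam g) (t : ℝ) : young g t ≤ g t * t := by
  have h : young g t ≤ ∫ _ in (0 : ℝ)..|t|, g |t| := by
    refine intervalIntegral.integral_mono_on (abs_nonneg t)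
      (hg.continuous.intervalIntegrable _ _) (by simp) ?_
    intro x hx
    exact hg.monotone hx.2
  rw [intervalIntegral.integral_const, sub_zero, smul_eq_mul, mul_comm,
    hg.apply_mul_self_abs] at h
  exact h

lemma le_young (hg : IsAdmissible lam Lam g) (t : ℝ) : g t * t ≤ 2 ^ (Lam + 1) * young g t := by
  have h1 : ∫ _ in (|t| / 2)..|t|, g (|t| / 2) ≤ ∫ x in (|t| / 2)..|t|, g x := by
    refine intervalIntegral.integral_mono_on (by linarith [abs_nonneg t]) (by simp)
      (hg.continuous.intervalIntegrable _ _) ?_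
    intro x hx
    exact hg.monotone hx.1
  have h2 : 0 ≤ ∫ x in (0 : ℝ)..(|t| / 2), g x := by
    refine intervalIntegral.integral_nonneg (by linarith [abs_nonneg t]) ?_
    intro x hx
    exact hg.nonneg hx.1
  have h3 : young g t = (∫ x in (0 : ℝ)..(|t| / 2), g x) + ∫ x in (|t| / 2)..|t|, g x :=
    (intervalIntegral.integral_add_adjacent_intervals (hg.continuous.intervalIntegrable _ _)
      (hg.continuous.intervalIntegrable _ _)).symm
  rw [intervalIntegral.integral_const, smul_eq_mul] at h1
  have h4 := hg.apply_mul_self_mul_le one_le_two (|t| / 2)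
  rw [mul_div_cancel₀ _ two_ne_zero, hg.apply_mul_self_abs] at h4
  refine h4.trans ?_
  have h5 : (0 : ℝ) < 2 ^ (Lam + 1) := by positivity
  have : g (|t| / 2) * (|t| / 2) ≤ young g t := by
    rw [h3]
    linarith
  gcongr

lemma young_nonneg (hg : IsAdmissible lam Lam g) (t : ℝ) : 0 ≤ young g t :=
  intervalIntegral.integral_nonneg (abs_nonneg t) fun _ hx => hg.nonneg hx.1

lemma gInv_mem (hg : IsAdmissible lam Lam g) {K : ℝ} (hK : 0 ≤ K) :
    0 ≤ gInv g K ∧ g (gInv g K) = K := by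
  have hex : ∃ a ∈ Ici (0 : ℝ), g a = K := by
    obtain ⟨T, hT, hT0⟩ := ((hg.tendsto_atTop.eventually_ge_atTop K).and
      (eventually_ge_atTop 0)).exists
    have h := intermediate_value_Icc hT0 hg.continuous.continuousOn
    rw [hg.zero] at h
    obtain ⟨a, ha, hga⟩ := h ⟨hK, hT⟩
    exact ⟨a, ha.1, hga⟩
  exact ⟨Function.invFunOn_mem hex, Function.invFunOn_eq hex⟩

end IsAdmissible

end Young

/-! ### Integrals of powers of the norm -/

section Radial

variable {n : ℕ}

/-- The surface measure of the unit sphere of `ℝⁿ`. -/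
noncomputable def sphereArea (n : ℕ) : ℝ := n * volume.real (Metric.ball (0 : Rn n) 1)

lemma ballVolume_pos (n : ℕ) : 0 < volume.real (Metric.ball (0 : Rn n) 1) :=
  ENNReal.toReal_pos (Metric.measure_ball_pos _ _ one_pos).ne' measure_ball_lt_top.ne

lemma sphereArea_pos (hn : 1 ≤ n) : 0 < sphereArea n :=
  mul_pos (by exact_mod_cast hn) (ballVolume_pos n)

lemma pow_pred_mul_rpow (hn : 1 ≤ n) {y : ℝ} (hy : 0 < y) (b : ℝ) :
    y ^ (n - 1) * y ^ (b - n) = y ^ (b - 1) := by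
  rw [← Real.rpow_natCast, ← Real.rpow_add hy]
  congr 1
  push_cast [Nat.cast_sub hn]
  ring

/-- The function `y ↦ |y| ^ (b - n)` is integrable on a radial set if and only if `y ^ (b - 1)` is
integrable on the corresponding set of radii. -/
lemma integrableOn_norm_rpow_iff (hn : 1 ≤ n) (b : ℝ) {A : Set ℝ} (hA : MeasurableSet A) :
    IntegrableOn (fun y : Rn n => ‖y‖ ^ (b - n)) {y | ‖y‖ ∈ A} ↔
      IntegrableOn (fun y : ℝ => y ^ (b - 1)) (A ∩ Ioi 0) := by
  have : Nonempty (Fin n) := ⟨⟨0, hn⟩⟩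
  have hAm : MeasurableSet {y : Rn n | ‖y‖ ∈ A} := measurable_norm hA
  have h := integrable_fun_norm_addHaar (volume : Measure (Rn n))
    (f := A.indicator fun y : ℝ => y ^ (b - n))
  have e1 : (fun y : Rn n => A.indicator (fun y : ℝ => y ^ (b - n)) ‖y‖) =
      {y : Rn n | ‖y‖ ∈ A}.indicator fun y => ‖y‖ ^ (b - n) := by
    ext y
    rfl
  rw [e1, integrable_indicator_iff hAm] at h
  rw [h, ← integrable_indicator_iff (hA.inter measurableSet_Ioi), inter_comm,
    ← indicator_indicator, integrable_indicator_iff measurableSet_Ioi]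
  refine integrableOn_congr_fun ?_ measurableSet_Ioi
  intro y hy
  simp only [indicator, finrank_euclideanSpace, Fintype.card_fin, smul_eq_mul]
  split_ifs
  · exact pow_pred_mul_rpow hn hy b
  · simp

lemma setIntegral_norm_rpow (hn : 1 ≤ n) (b : ℝ) {A : Set ℝ} (hA : MeasurableSet A) :
    ∫ y in {y : Rn n | ‖y‖ ∈ A}, ‖y‖ ^ (b - n) =
      sphereArea n * ∫ y in A ∩ Ioi 0, y ^ (b - 1) := by
  have : Nonempty (Fin n) := ⟨⟨0, hn⟩⟩
  have hAm : MeasurableSet {y : Rn n | ‖y‖ ∈ A} := measurable_norm hA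
  have h := integral_fun_norm_addHaar (volume : Measure (Rn n))
    (A.indicator fun y : ℝ => y ^ (b - n))
  have e1 : (fun y : Rn n => A.indicator (fun y : ℝ => y ^ (b - n)) ‖y‖) =
      {y : Rn n | ‖y‖ ∈ A}.indicator fun y => ‖y‖ ^ (b - n) := by
    ext y
    rfl
  rw [e1, integral_indicator hAm] at h
  rw [h, inter_comm, ← setIntegral_indicator hA]
  simp only [finrank_euclideanSpace, Fintype.card_fin, smul_eq_mul, nsmul_eq_mul, sphereArea]
  rw [mul_assoc]
  congr 2
  refine setIntegral_congr_fun measurableSet_Ioi ?_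
  intro y hy
  simp only [indicator]
  split_ifs
  · exact pow_pred_mul_rpow hn hy b
  · simp

lemma setOf_norm_mem_Ici (ρ : ℝ) : {y : Rn n | ‖y‖ ∈ Ici ρ} = (Metric.ball 0 ρ)ᶜ := by
  ext y
  simp

lemma setOf_norm_mem_Iio (ρ : ℝ) : {y : Rn n | ‖y‖ ∈ Iio ρ} = Metric.ball 0 ρ := by
  ext y
  simp

lemma integrableOn_compl_ball (hn : 1 ≤ n) {s ρ : ℝ} (hs : 0 < s) (hρ : 0 < ρ) :
    IntegrableOn (fun y : Rn n => ‖y‖ ^ (-s - n)) (Metric.ball 0 ρ)ᶜ := by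
  rw [← setOf_norm_mem_Ici, integrableOn_norm_rpow_iff hn _ measurableSet_Ici,
    inter_eq_self_of_subset_left (Ici_subset_Ioi.mpr hρ), integrableOn_Ici_iff_integrableOn_Ioi]
  exact integrableOn_Ioi_rpow_of_lt (by linarith) hρ

lemma setIntegral_compl_ball (hn : 1 ≤ n) {s ρ : ℝ} (hs : 0 < s) (hρ : 0 < ρ) :
    ∫ y in (Metric.ball (0 : Rn n) ρ)ᶜ, ‖y‖ ^ (-s - n) = sphereArea n / s * ρ ^ (-s) := by
  rw [← setOf_norm_mem_Ici, setIntegral_norm_rpow hn _ measurableSet_Ici,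
    inter_eq_self_of_subset_left (Ici_subset_Ioi.mpr hρ), integral_Ici_eq_integral_Ioi,
    integral_Ioi_rpow_of_lt (by linarith) hρ]
  rw [show -s - 1 + 1 = -s by ring]
  field_simp

lemma integrableOn_ball (hn : 1 ≤ n) {a ρ : ℝ} (ha : 0 < a) (hρ : 0 < ρ) :
    IntegrableOn (fun y : Rn n => ‖y‖ ^ (a - n)) (Metric.ball 0 ρ) := by
  rw [← setOf_norm_mem_Iio, integrableOn_norm_rpow_iff hn _ measurableSet_Iio, inter_comm,
    Ioi_inter_Iio]
  exact (intervalIntegral.integrableOn_Ioo_rpow_iff hρ).mpr (by linarith)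

lemma setIntegral_ball (hn : 1 ≤ n) {a ρ : ℝ} (ha : 0 < a) (hρ : 0 < ρ) :
    ∫ y in (Metric.ball (0 : Rn n) ρ), ‖y‖ ^ (a - n) = sphereArea n / a * ρ ^ a := by
  rw [← setOf_norm_mem_Iio, setIntegral_norm_rpow hn _ measurableSet_Iio, inter_comm,
    Ioi_inter_Iio, ← integral_Ioc_eq_integral_Ioo, ← intervalIntegral.integral_of_le hρ.le,
    integral_rpow (Or.inl (by linarith))]
  rw [sub_add_cancel, Real.zero_rpow ha.ne']
  field_simp
  ring

/-- The annulus `B_ρ \ B_{ρ/2}` has at least half the measure of the ball `B_ρ`. -/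
lemma annulus_volume_ge (hn : 1 ≤ n) {ρ : ℝ} (hρ : 0 < ρ) :
    ρ ^ n * volume.real (Metric.ball (0 : Rn n) 1) / 2 ≤
      volume.real (Metric.ball (0 : Rn n) ρ \ Metric.ball 0 (ρ / 2)) := by
  have : Nonempty (Fin n) := ⟨⟨0, hn⟩⟩
  have hb : ∀ r : ℝ, 0 < r → volume.real (Metric.ball (0 : Rn n) r) =
      r ^ n * volume.real (Metric.ball (0 : Rn n) 1) := by
    intro r hr
    have := Measure.addHaar_ball (volume : Measure (Rn n)) 0 hr.le
    rw [measureReal_def, this, ENNReal.toReal_mul, ENNReal.toReal_ofReal (by positivity),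
      finrank_euclideanSpace, Fintype.card_fin, measureReal_def]
  rw [measureReal_sdiff (Metric.ball_subset_ball (by linarith)) measurableSet_ball
    measure_ball_lt_top.ne, hb ρ hρ, hb (ρ / 2) (by linarith)]
  have h1 := ballVolume_pos n
  have h2 : (ρ / 2) ^ n ≤ ρ ^ n / 2 := by
    rw [div_pow]
    gcongr
    calc (2 : ℝ) = 2 ^ 1 := by norm_num
      _ ≤ 2 ^ n := pow_le_pow_right₀ one_le_two hn
  nlinarith

end Radial

/-! ### The energy density -/

section Energy

variable {n : ℕ} {lam Lam s : ℝ} {g : ℝ → ℝ}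

/-- Lebesgue measure on `ℝⁿ × ℝⁿ`. -/
noncomputable abbrev pairVolume (n : ℕ) : Measure (Rn n × Rn n) :=
  (volume : Measure (Rn n)).prod volume

/-- The density of the form `∬ g(D_s w) D_s φ dμ` with respect to Lebesgue measure. -/
noncomputable def energyDensity (g : ℝ → ℝ) (s : ℝ) (w φ : Rn n → ℝ) (p : Rn n × Rn n) : ℝ :=
  g (holderQuot s w p) * holderQuot s φ p * (1 / ‖p.1 - p.2‖ ^ n)

lemma measurable_muDensity :
    Measurable fun p : Rn n × Rn n => ENNReal.ofReal (1 / ‖p.1 - p.2‖ ^ n) := by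
  fun_prop

lemma muMeasure_absolutelyContinuous : muMeasure n ≪ pairVolume n :=
  withDensity_absolutelyContinuous _ _

lemma energyForm_eq (w φ : Rn n → ℝ) :
    energyForm g s w φ = ∫ p, energyDensity g s w φ p ∂pairVolume n := by
  unfold energyForm muMeasure
  rw [integral_withDensity_eq_integral_toReal_smul measurable_muDensity (by simp)]
  congr 1
  ext p
  rw [ENNReal.toReal_ofReal (by positivity), energyDensity, smul_eq_mul, mul_comm]

lemma ae_fst {p : Rn n → Prop} (h : ∀ᵐ x, p x) : ∀ᵐ z ∂pairVolume n, p z.1 :=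
  Measure.quasiMeasurePreserving_fst.ae h

lemma ae_snd {p : Rn n → Prop} (h : ∀ᵐ x, p x) : ∀ᵐ z ∂pairVolume n, p z.2 :=
  Measure.quasiMeasurePreserving_snd.ae h

lemma holderQuot_congr_ae {u v : Rn n → ℝ} (h : u =ᵐ[volume] v) :
    holderQuot s u =ᵐ[pairVolume n] holderQuot s v := by
  filter_upwards [ae_fst h, ae_snd h] with p h1 h2
  simp only [holderQuot, h1, h2]

lemma energyDensity_congr_ae {u v : Rn n → ℝ} (h : u =ᵐ[volume] v) :
    energyDensity g s u u =ᵐ[pairVolume n] energyDensity g s v v := by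
  filter_upwards [holderQuot_congr_ae (s := s) h] with p hp
  simp only [energyDensity, hp]

lemma energyForm_congr_ae {u v : Rn n → ℝ} (h : u =ᵐ[volume] v) (φ : Rn n → ℝ) :
    energyForm g s u φ = energyForm g s v φ := by
  refine integral_congr_ae ?_
  filter_upwards [muMeasure_absolutelyContinuous.ae_le (holderQuot_congr_ae (s := s) h)] with p hp
  rw [hp]

lemma measurable_holderQuot {u : Rn n → ℝ} (hu : Measurable u) : Measurable (holderQuot s u) := by
  unfold holderQuot
  fun_prop

lemma aemeasurable_holderQuot {u : Rn n → ℝ} (hu : AEMeasurable u) :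
    AEMeasurable (holderQuot s u) (pairVolume n) :=
  (measurable_holderQuot hu.measurable_mk).aemeasurable.congr
    (holderQuot_congr_ae hu.ae_eq_mk).symm

lemma aemeasurable_energyDensity (hg : IsAdmissible lam Lam g) {w φ : Rn n → ℝ}
    (hw : AEMeasurable w) (hφ : AEMeasurable φ) :
    AEMeasurable (energyDensity g s w φ) (pairVolume n) := by
  have h1 := hg.continuous.measurable.comp_aemeasurable (aemeasurable_holderQuot (s := s) hw)
  have h2 := aemeasurable_holderQuot (s := s) hφ
  have h3 : AEMeasurable (fun p : Rn n × Rn n => 1 / ‖p.1 - p.2‖ ^ n) (pairVolume n) := by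
    fun_prop
  exact (h1.mul h2).mul h3

lemma holderQuot_swap (u : Rn n → ℝ) (x y : Rn n) :
    holderQuot s u (x, y) = -holderQuot s u (y, x) := by
  simp only [holderQuot, norm_sub_rev x y]
  ring

lemma energyDensity_swap (hg : IsAdmissible lam Lam g) (w φ : Rn n → ℝ) (x y : Rn n) :
    energyDensity g s w φ (x, y) = energyDensity g s w φ (y, x) := by
  simp only [energyDensity]
  rw [holderQuot_swap w, holderQuot_swap φ, hg.odd, norm_sub_rev]
  ring

lemma energyDensity_self_nonneg (hg : IsAdmissible lam Lam g) (w : Rn n → ℝ) (p : Rn n × Rn n) :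
    0 ≤ energyDensity g s w w p :=
  mul_nonneg (hg.apply_mul_self_nonneg _) (by positivity)

lemma abs_energyDensity_le (hg : IsAdmissible lam Lam g) (w φ : Rn n → ℝ) (p : Rn n × Rn n) :
    |energyDensity g s w φ p| ≤ energyDensity g s w w p + energyDensity g s φ φ p := by
  unfold energyDensity
  rw [abs_mul, abs_of_nonneg (by positivity : 0 ≤ 1 / ‖p.1 - p.2‖ ^ n), ← add_mul]
  exact mul_le_mul_of_nonneg_right (hg.abs_apply_mul_le _ _) (by positivity)

/-- A bound for the interaction of a point of `B_{ρ/2}` with the points `y ∉ B_ρ` at which a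
function has the size `c y`. -/
noncomputable def farKernel (g : ℝ → ℝ) (s ρ : ℝ) (c : Rn n → ℝ) : Rn n → ℝ :=
  (Metric.ball 0 ρ)ᶜ.indicator fun y => 2 ^ (n + 1) * (g (2 * c y / ‖y‖ ^ s) * ‖y‖ ^ (-s - n))

lemma farKernel_nonneg (hg : IsAdmissible lam Lam g) {ρ : ℝ} {c : Rn n → ℝ} (hc : ∀ y, 0 ≤ c y)
    (y : Rn n) : 0 ≤ farKernel g s ρ c y := by
  refine indicator_nonneg (fun y _ => ?_) y
  have := hg.nonneg (t := 2 * c y / ‖y‖ ^ s) (by have := hc y; positivity)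
  positivity

lemma norm_le_two_mul_norm_sub {ρ : ℝ} {x y : Rn n} (hx : x ∈ Metric.ball (0 : Rn n) (ρ / 2))
    (hy : y ∈ (Metric.ball (0 : Rn n) ρ)ᶜ) : ‖y‖ ≤ 2 * ‖x - y‖ := by
  simp only [mem_compl_iff, Metric.mem_ball, dist_zero_right, not_lt] at hx hy
  have h := norm_sub_norm_le y x
  rw [norm_sub_rev] at h
  linarith

lemma apply_div_le_farKernel (hg : IsAdmissible lam Lam g) (hs : 0 < s) (hs1 : s < 1) {ρ : ℝ}
    (hρ : 0 < ρ) {c : Rn n → ℝ} {x y : Rn n} (hx : x ∈ Metric.ball (0 : Rn n) (ρ / 2))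
    (hy : y ∈ (Metric.ball (0 : Rn n) ρ)ᶜ) (hc : 0 ≤ c y) {a : ℝ} (ha : 0 ≤ a) :
    g (c y / ‖x - y‖ ^ s) * (a / ‖x - y‖ ^ s) * (1 / ‖x - y‖ ^ n) ≤ a * farKernel g s ρ c y := by
  have h := norm_le_two_mul_norm_sub hx hy
  have hy' : ρ ≤ ‖y‖ := by simpa using hy
  have hy0 : 0 < ‖y‖ := hρ.trans_le hy'
  have hd : 0 < ‖x - y‖ := by linarith
  have hds : ‖y‖ ^ s ≤ 2 * ‖x - y‖ ^ s := by
    calc ‖y‖ ^ s ≤ (2 * ‖x - y‖) ^ s := by gcongr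
      _ = 2 ^ s * ‖x - y‖ ^ s := Real.mul_rpow (by norm_num) hd.le
      _ ≤ 2 ^ (1 : ℝ) * ‖x - y‖ ^ s := by gcongr; norm_num
      _ = _ := by rw [Real.rpow_one]
  have hdn : ‖y‖ ^ n ≤ 2 ^ n * ‖x - y‖ ^ n := by
    rw [← mul_pow]
    gcongr
  have hys : 0 < ‖y‖ ^ s := by positivity
  have hdsp : 0 < ‖x - y‖ ^ s := by positivity
  have h1 : c y / ‖x - y‖ ^ s ≤ 2 * c y / ‖y‖ ^ s := by
    rw [div_le_div_iff₀ hdsp hys]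
    nlinarith
  have h2 : 1 / ‖x - y‖ ^ s ≤ 2 / ‖y‖ ^ s := by
    rw [div_le_div_iff₀ hdsp hys]
    linarith
  have h3 : 1 / ‖x - y‖ ^ n ≤ 2 ^ n / ‖y‖ ^ n := by
    rw [div_le_div_iff₀ (by positivity) (by positivity)]
    linarith
  have h4 : ‖y‖ ^ (-s - n) = 1 / ‖y‖ ^ s * (1 / ‖y‖ ^ n) := by
    rw [Real.rpow_sub hy0, Real.rpow_neg hy0.le, Real.rpow_natCast]
    field_simp
  rw [farKernel, indicator_of_mem hy, h4]
  have hg1 := hg.monotone h1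
  have hg0 := hg.nonneg (t := c y / ‖x - y‖ ^ s) (by positivity)
  have hg2 := hg0.trans hg1
  calc g (c y / ‖x - y‖ ^ s) * (a / ‖x - y‖ ^ s) * (1 / ‖x - y‖ ^ n)
      = a * (g (c y / ‖x - y‖ ^ s) * (1 / ‖x - y‖ ^ s) * (1 / ‖x - y‖ ^ n)) := by ring
    _ ≤ a * (g (2 * c y / ‖y‖ ^ s) * (2 / ‖y‖ ^ s) * (2 ^ n / ‖y‖ ^ n)) := by gcongr
    _ = _ := by ring

lemma integrable_farKernel_iff {ρ : ℝ} {c : Rn n → ℝ} :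
    Integrable (farKernel g s ρ c) ↔
      IntegrableOn (fun y => g (2 * c y / ‖y‖ ^ s) * ‖y‖ ^ (-s - n)) (Metric.ball 0 ρ)ᶜ := by
  rw [farKernel, integrable_indicator_iff measurableSet_ball.compl, IntegrableOn, IntegrableOn,
    integrable_const_mul_iff (IsUnit.mk0 _ (by positivity))]

lemma integrableOn_apply_const (hg : IsAdmissible lam Lam g) (hn : 1 ≤ n) (hs : 0 < s) {ρ : ℝ}
    (hρ : 0 < ρ) {N : ℝ} (hN : 0 ≤ N) :
    IntegrableOn (fun y : Rn n => g (N / ‖y‖ ^ s) * ‖y‖ ^ (-s - n)) (Metric.ball 0 ρ)ᶜ := by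
  refine ((integrableOn_compl_ball hn hs hρ).const_mul (g (N / ρ ^ s))).mono' ?_ ?_
  · have := hg.continuous.measurable
    exact Measurable.aestronglyMeasurable (by fun_prop)
  · filter_upwards [ae_restrict_mem measurableSet_ball.compl] with y hy
    have hy' : ρ ≤ ‖y‖ := by simpa using hy
    have hy0 : 0 < ‖y‖ := hρ.trans_le hy'
    have h0 := hg.nonneg (t := N / ‖y‖ ^ s) (by positivity)
    rw [Real.norm_eq_abs, abs_of_nonneg (by positivity)]
    gcongr
    exact hg.monotone (by gcongr)

/-- An integrability criterion on `ℝⁿ × ℝⁿ`: a bound on `B × B`, and a bound by products. -/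
lemma integrable_of_abs_le {F E : Rn n × Rn n → ℝ} {B : Set (Rn n)} (hB : MeasurableSet B)
    {φ k : Rn n → ℝ} (hF : AEMeasurable F (pairVolume n))
    (hE : IntegrableOn E (B ×ˢ B) (pairVolume n)) (hφ : Integrable φ) (hk : Integrable k)
    (h : ∀ᵐ p ∂pairVolume n, |F p| ≤ (B ×ˢ B).indicator E p + (φ p.1 * k p.2 + k p.1 * φ p.2)) :
    Integrable F (pairVolume n) :=
  ((hE.integrable_indicator (hB.prod hB)).add ((hφ.mul_prod hk).add (hk.mul_prod hφ))).mono'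
    hF.aestronglyMeasurable h

/-- The splitting of `ℝⁿ × ℝⁿ` used throughout: inside `B_ρ × B_ρ`, and the interactions of
`B_{ρ/2}` with the exterior of `B_ρ`. -/
lemma energyDensity_le_split (hg : IsAdmissible lam Lam g) (hs : 0 < s) (hs1 : s < 1) {ρ : ℝ}
    (hρ : 0 < ρ) {w φ c : Rn n → ℝ} (hφ0 : ∀ x, 0 ≤ φ x)
    (hφ : ∀ x ∉ Metric.ball (0 : Rn n) (ρ / 2), φ x = 0)
    (hc : ∀ y, 0 ≤ c y)
    (hw : ∀ x ∈ Metric.ball (0 : Rn n) (ρ / 2), ∀ y ∈ (Metric.ball (0 : Rn n) ρ)ᶜ,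
      φ x ≠ 0 → |w x - w y| ≤ c y) (p : Rn n × Rn n) :
    |energyDensity g s w φ p| ≤
      (Metric.ball 0 ρ ×ˢ Metric.ball 0 ρ).indicator (fun p => |energyDensity g s w φ p|) p +
        (φ p.1 * farKernel g s ρ c p.2 + farKernel g s ρ c p.1 * φ p.2) := by
  have hk := farKernel_nonneg (s := s) (ρ := ρ) hg hc
  have hsub : Metric.ball (0 : Rn n) (ρ / 2) ⊆ Metric.ball 0 ρ :=
    Metric.ball_subset_ball (by linarith)
  have cross : ∀ x ∈ Metric.ball (0 : Rn n) ρ, ∀ y ∉ Metric.ball (0 : Rn n) ρ,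
      |energyDensity g s w φ (x, y)| ≤ φ x * farKernel g s ρ c y := by
    intro x hx y hy
    have hφy : φ y = 0 := hφ y fun h => hy (hsub h)
    by_cases hφx : φ x = 0
    · simp [energyDensity, holderQuot, hφx, hφy]
    have hx2 : x ∈ Metric.ball (0 : Rn n) (ρ / 2) := by
      by_contra hcon
      exact hφx (hφ x hcon)
    have h1 := apply_div_le_farKernel hg hs hs1 hρ hx2 hy (hc y) (hφ0 x)
    refine le_trans ?_ h1
    have hφx0 := hφ0 x
    simp only [energyDensity, holderQuot, hφy, sub_zero]
    rw [abs_mul, abs_mul, hg.abs_apply, abs_div,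
      abs_of_nonneg (by positivity : 0 ≤ ‖x - y‖ ^ s),
      abs_of_nonneg (by positivity : 0 ≤ φ x / ‖x - y‖ ^ s),
      abs_of_nonneg (by positivity : 0 ≤ 1 / ‖x - y‖ ^ n)]
    have h2 := hw x hx2 y hy hφx
    gcongr
    exact hg.monotone (by gcongr)
  obtain ⟨x, y⟩ := p
  have nn : 0 ≤ φ x * farKernel g s ρ c y + farKernel g s ρ c x * φ y :=
    add_nonneg (mul_nonneg (hφ0 x) (hk y)) (mul_nonneg (hk x) (hφ0 y))
  by_cases hx : x ∈ Metric.ball (0 : Rn n) ρ <;> by_cases hy : y ∈ Metric.ball (0 : Rn n) ρ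
  · rw [indicator_of_mem (mk_mem_prod hx hy)]
    exact le_add_of_nonneg_right nn
  · rw [indicator_of_notMem (fun h => hy h.2), zero_add]
    have := mul_nonneg (hk x) (hφ0 y)
    linarith [cross x hx y hy]
  · rw [indicator_of_notMem (fun h => hx h.1), zero_add, energyDensity_swap hg]
    have := mul_nonneg (hφ0 x) (hk y)
    linarith [cross y hy x hx, mul_comm (φ y) (farKernel g s ρ c x)]
  · have hφx : φ x = 0 := hφ x fun h => hx (hsub h)
    have hφy : φ y = 0 := hφ y fun h => hy (hsub h)
    rw [indicator_of_notMem (fun h => hx h.1), zero_add]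
    simp [energyDensity, holderQuot, hφx, hφy]

/-- A bounded function supported in `B_{ρ/2}` whose energy in `B_ρ` is finite has finite energy in
the whole space. -/
lemma integrable_energyDensity_self (hg : IsAdmissible lam Lam g) (hn : 1 ≤ n) (hs : 0 < s)
    (hs1 : s < 1) {ρ : ℝ} (hρ : 0 < ρ) {φ : Rn n → ℝ} {N : ℝ} (hφm : Measurable φ)
    (hφ0 : ∀ x, 0 ≤ φ x) (hφN : ∀ x, φ x ≤ N)
    (hφ : ∀ x ∉ Metric.ball (0 : Rn n) (ρ / 2), φ x = 0) (hφi : Integrable φ)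
    (hE : IntegrableOn (energyDensity g s φ φ) (Metric.ball 0 ρ ×ˢ Metric.ball 0 ρ)
      (pairVolume n)) :
    Integrable (energyDensity g s φ φ) (pairVolume n) := by
  have hN : 0 ≤ N := (hφ0 0).trans (hφN 0)
  have hk : Integrable (farKernel g s ρ fun _ : Rn n => N) :=
    integrable_farKernel_iff.mpr (integrableOn_apply_const hg hn hs hρ (by linarith))
  refine integrable_of_abs_le measurableSet_ball
    (aemeasurable_energyDensity hg hφm.aemeasurable hφm.aemeasurable) hE.abs hφi hk ?_
  refine Eventually.of_forall fun p => ?_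
  refine energyDensity_le_split hg hs hs1 hρ hφ0 hφ (fun _ => hN) ?_ p
  intro x _ y _ _
  rw [abs_le]
  constructor <;> linarith [hφ0 x, hφ0 y, hφN x, hφN y]

/-- The form `∬ g(D_s w) D_s φ dμ` converges absolutely if `w` is bounded and of finite energy in
`B_ρ` and has a finite tail, and `φ` is of finite energy and supported in `B_{ρ/2}`. -/
lemma integrable_energyDensity (hg : IsAdmissible lam Lam g) (hs : 0 < s)
    (hs1 : s < 1) {ρ : ℝ} (hρ : 0 < ρ) {w φ : Rn n → ℝ} {N : ℝ} (hwm : Measurable w)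
    (hφm : Measurable φ) (hφ0 : ∀ x, 0 ≤ φ x)
    (hφ : ∀ x ∉ Metric.ball (0 : Rn n) (ρ / 2), φ x = 0) (hφi : Integrable φ)
    (hE : IntegrableOn (energyDensity g s φ φ) (Metric.ball 0 ρ ×ˢ Metric.ball 0 ρ)
      (pairVolume n))
    (hN : 0 ≤ N) (hwN : ∀ x ∈ Metric.ball (0 : Rn n) ρ, |w x| ≤ N)
    (hEw : IntegrableOn (energyDensity g s w w) (Metric.ball 0 ρ ×ˢ Metric.ball 0 ρ)
      (pairVolume n))
    (hk : Integrable (farKernel g s ρ fun y => N + |w y|)) :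
    Integrable (energyDensity g s w φ) (pairVolume n) := by
  have hm := aemeasurable_energyDensity (s := s) hg hwm.aemeasurable hφm.aemeasurable
  have hE2 : IntegrableOn (energyDensity g s w φ) (Metric.ball 0 ρ ×ˢ Metric.ball 0 ρ)
      (pairVolume n) :=
    (hEw.add hE).mono' hm.restrict.aestronglyMeasurable
      (Eventually.of_forall fun p => abs_energyDensity_le hg w φ p)
  refine integrable_of_abs_le measurableSet_ball hm hE2.abs hφi hk ?_
  refine Eventually.of_forall fun p => ?_
  refine energyDensity_le_split hg hs hs1 hρ hφ0 hφ (fun y => by positivity) ?_ p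
  intro x hx y _ _
  have h1 := hwN x (Metric.ball_subset_ball (by linarith) hx)
  have h2 := abs_sub (w x) (w y)
  linarith

lemma memW0_of_integrable (hg : IsAdmissible lam Lam g) {φ : Rn n → ℝ} {N : ℝ}
    {Ω : Set (Rn n)} (hΩ : MeasurableSet Ω) (hΩv : volume Ω < ∞) (hφm : Measurable φ)
    (hφ0 : ∀ x, 0 ≤ φ x) (hφN : ∀ x, φ x ≤ N) (hφ : ∀ x ∉ Ω, φ x = 0)
    (hE : Integrable (energyDensity g s φ φ) (pairVolume n)) : MemW0 g s Ω φ := by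
  refine ⟨⟨hφm.aemeasurable, ?_, ?_⟩, Eventually.of_forall hφ⟩
  · have hle : modular g φ volume ≤ ∫⁻ x in Ω, ENNReal.ofReal (g N * N) := by
      rw [← lintegral_indicator hΩ]
      refine lintegral_mono fun x => ?_
      by_cases hx : x ∈ Ω
      · rw [indicator_of_mem hx]
        refine ENNReal.ofReal_le_ofReal ((hg.young_le _).trans (hg.apply_mul_self_mono ?_))
        rw [abs_of_nonneg (hφ0 x)]
        exact (hφN x).trans (le_abs_self N)
      · rw [indicator_of_notMem hx, hφ x hx]
        simp [young]
    refine hle.trans_lt ?_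
    rw [setLIntegral_const]
    exact ENNReal.mul_lt_top ENNReal.ofReal_lt_top hΩv
  · have hle : modular g (holderQuot s φ) (muMeasure n) ≤
        ∫⁻ p, ENNReal.ofReal (energyDensity g s φ φ p) ∂pairVolume n := by
      unfold modular muMeasure
      refine (lintegral_withDensity_le_lintegral_mul _ measurable_muDensity _).trans ?_
      refine lintegral_mono fun p => ?_
      simp only [Pi.mul_apply]
      rw [← ENNReal.ofReal_mul (by positivity), energyDensity, mul_comm]
      refine ENNReal.ofReal_le_ofReal ?_
      exact mul_le_mul_of_nonneg_right (hg.young_le _) (by positivity)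
    exact hle.trans_lt hE.lintegral_lt_top

end Energy

/-! ### The barrier -/

section Barrier

variable {n : ℕ} {lam Lam s : ℝ} {g : ℝ → ℝ}

/-- The bump `(1/4 - |x|²/ρ²)₊`. It is supported in `B_{ρ/2}`, Lipschitz and semiconvex, which is
all the smoothness that an upper bound for its fractional `g`-Laplacian requires. -/
noncomputable def bump (ρ : ℝ) (x : Rn n) : ℝ := max (1 / 4 - ‖x‖ ^ 2 / ρ ^ 2) 0

lemma bump_nonneg (ρ : ℝ) (x : Rn n) : 0 ≤ bump ρ x := le_max_right _ _

lemma le_bump (ρ : ℝ) (x : Rn n) : 1 / 4 - ‖x‖ ^ 2 / ρ ^ 2 ≤ bump ρ x := le_max_left _ _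

lemma bump_le (ρ : ℝ) (x : Rn n) : bump ρ x ≤ 1 / 4 := by
  refine max_le ?_ (by norm_num)
  have : 0 ≤ ‖x‖ ^ 2 / ρ ^ 2 := by positivity
  linarith

lemma bump_eq_zero {ρ : ℝ} (hρ : 0 < ρ) {x : Rn n} (hx : x ∉ Metric.ball (0 : Rn n) (ρ / 2)) :
    bump ρ x = 0 := by
  refine max_eq_right ?_
  simp only [Metric.mem_ball, dist_zero_right, not_lt] at hx
  rw [sub_nonpos, div_le_div_iff₀ (by norm_num) (by positivity)]
  nlinarith

lemma le_bump_of_mem {ρ : ℝ} (hρ : 0 < ρ) {x : Rn n} (hx : x ∈ Metric.ball (0 : Rn n) (ρ / 4)) :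
    3 / 16 ≤ bump ρ x := by
  refine le_trans ?_ (le_bump ρ x)
  simp only [Metric.mem_ball, dist_zero_right] at hx
  have : ‖x‖ ^ 2 / ρ ^ 2 ≤ 1 / 16 := by
    rw [div_le_div_iff₀ (by positivity) (by norm_num)]
    nlinarith [norm_nonneg x]
  linarith

lemma measurable_bump (ρ : ℝ) : Measurable (bump ρ : Rn n → ℝ) := by
  unfold bump
  fun_prop

lemma bump_sub_le {ρ : ℝ} (hρ : 0 < ρ) (x y : Rn n) : bump ρ x - bump ρ y ≤ ‖x - y‖ / ρ := by
  have hxy : ‖y‖ - ‖x‖ ≤ ‖x - y‖ := by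
    rw [norm_sub_rev]
    exact norm_sub_norm_le y x
  set a := ‖x‖ / ρ with ha
  set b := ‖y‖ / ρ with hb
  have ha0 : 0 ≤ a := by positivity
  have hb0 : 0 ≤ b := by positivity
  have hd0 : 0 ≤ ‖x - y‖ / ρ := by positivity
  have hab : b - a ≤ ‖x - y‖ / ρ := by
    rw [ha, hb, ← sub_div]
    gcongr
  have e1 : bump ρ x = max (1 / 4 - a ^ 2) 0 := by rw [bump, ha, div_pow]
  have e2 : bump ρ y = max (1 / 4 - b ^ 2) 0 := by rw [bump, hb, div_pow]
  rw [e1, e2]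
  rcases le_total (1 / 4 - a ^ 2) 0 with h | h
  · rw [max_eq_right h]
    linarith [le_max_right (1 / 4 - b ^ 2) 0]
  rw [max_eq_left h]
  have ha2 : a ≤ 1 / 2 := by nlinarith
  rcases le_total b a with hba | hba
  · have := le_max_left (1 / 4 - b ^ 2) 0
    nlinarith
  rcases le_total b (1 / 2) with hb2 | hb2
  · have := le_max_left (1 / 4 - b ^ 2) 0
    nlinarith
  · have := le_max_right (1 / 4 - b ^ 2) 0
    nlinarith

lemma abs_bump_sub_le {ρ : ℝ} (hρ : 0 < ρ) (x y : Rn n) :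
    |bump ρ x - bump ρ y| ≤ ‖x - y‖ / ρ := by
  rw [abs_sub_le_iff]
  refine ⟨bump_sub_le hρ x y, ?_⟩
  rw [norm_sub_rev]
  exact bump_sub_le hρ y x

lemma bump_second_difference_le (ρ : ℝ) (x h : Rn n) :
    2 * bump ρ x - bump ρ (x + h) - bump ρ (x - h) ≤ 2 * ‖h‖ ^ 2 / ρ ^ 2 := by
  have h1 := le_bump ρ (x + h)
  have h2 := le_bump ρ (x - h)
  have h3 := bump_nonneg ρ (x + h)
  have h4 := bump_nonneg ρ (x - h)
  have h5 : 0 ≤ 2 * ‖h‖ ^ 2 / ρ ^ 2 := by positivity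
  rcases le_total (1 / 4 - ‖x‖ ^ 2 / ρ ^ 2) 0 with hx | hx
  · have : bump ρ x = 0 := max_eq_right hx
    linarith
  · have e1 : bump ρ x = 1 / 4 - ‖x‖ ^ 2 / ρ ^ 2 := max_eq_left hx
    have e2 : ‖x + h‖ ^ 2 / ρ ^ 2 + ‖x - h‖ ^ 2 / ρ ^ 2 =
        2 * (‖x‖ ^ 2 / ρ ^ 2) + 2 * ‖h‖ ^ 2 / ρ ^ 2 := by
      have := parallelogram_law_with_norm ℝ x h
      rw [← add_div, show ‖x + h‖ ^ 2 + ‖x - h‖ ^ 2 = 2 * (‖x‖ ^ 2 + ‖h‖ ^ 2) by linarith]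
      ring
    linarith

lemma norm_rpow_one_sub {x : Rn n} (hx : x ≠ 0) : ‖x‖ / ‖x‖ ^ s = ‖x‖ ^ (1 - s) := by
  rw [Real.rpow_sub (norm_pos_iff.mpr hx), Real.rpow_one]

lemma abs_holderQuot_le {f : Rn n → ℝ} {L : ℝ} (hL : ∀ x y, |f x - f y| ≤ L * ‖x - y‖)
    {p : Rn n × Rn n} (hp : p.1 - p.2 ≠ 0) :
    |holderQuot s f p| ≤ L * ‖p.1 - p.2‖ ^ (1 - s) := by
  rw [holderQuot, abs_div, abs_of_nonneg (by positivity : 0 ≤ ‖p.1 - p.2‖ ^ s),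
    ← norm_rpow_one_sub hp, mul_div_assoc']
  gcongr
  exact hL _ _

/-- Lipschitz functions have locally finite energy. -/
lemma integrableOn_energyDensity_of_lipschitz (hg : IsAdmissible lam Lam g) (hn : 1 ≤ n)
    (hs1 : s < 1) {ρ : ℝ} (hρ : 0 < ρ) {f : Rn n → ℝ} {L : ℝ} (hL0 : 0 ≤ L)
    (hfm : Measurable f) (hL : ∀ x y, |f x - f y| ≤ L * ‖x - y‖) :
    IntegrableOn (energyDensity g s f f) (Metric.ball 0 ρ ×ˢ Metric.ball 0 ρ) (pairVolume n) := by
  have hs1' : 0 < 1 - s := by linarith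
  set C := g (L * (2 * ρ) ^ (1 - s)) * L with hC
  have hC0 : 0 ≤ C := mul_nonneg (hg.nonneg (by positivity)) hL0
  set k : Rn n → ℝ := (Metric.ball 0 (2 * ρ)).indicator fun h => ‖h‖ ^ (1 - s - n) with hk
  have hki : Integrable k :=
    (integrableOn_ball hn hs1' (by linarith)).integrable_indicator measurableSet_ball
  set b : Rn n → ℝ := (Metric.ball 0 ρ).indicator fun _ => 1 with hb
  have hbi : Integrable b :=
    (integrableOn_const (by finiteness)).integrable_indicator measurableSet_ball
  have h1 : Integrable (fun z : Rn n × Rn n => b z.1 * k (-z.1 + z.2)) (pairVolume n) :=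
    (measurePreserving_prod_neg_add volume volume).integrable_comp_of_integrable
      (hbi.mul_prod hki)
  refine (h1.const_mul C).integrableOn.mono'
    (aemeasurable_energyDensity hg hfm.aemeasurable hfm.aemeasurable).restrict.aestronglyMeasurable
    ?_
  filter_upwards [ae_restrict_mem (measurableSet_ball.prod measurableSet_ball)] with p hp
  obtain ⟨x, y⟩ := p
  obtain ⟨hx, hy⟩ := hp
  simp only [Metric.mem_ball, dist_zero_right] at hx hy
  rw [Real.norm_eq_abs, abs_of_nonneg (energyDensity_self_nonneg hg f _)]
  have hd : ‖-x + y‖ = ‖x - y‖ := by rw [neg_add_eq_sub, norm_sub_rev]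
  have hd2 : ‖x - y‖ < 2 * ρ := by
    have := norm_sub_le x y
    linarith
  have e1 : b x = 1 := indicator_of_mem (by simpa using hx) _
  have e2 : k (-x + y) = ‖x - y‖ ^ (1 - s - n) := by
    rw [hk, indicator_of_mem (by simpa [hd] using hd2), hd]
  simp only [e1, e2, one_mul]
  rcases eq_or_ne (x - y) 0 with h0 | h0
  · have : holderQuot s f (x, y) = 0 := by
      rw [sub_eq_zero.mp h0]
      simp [holderQuot]
    rw [energyDensity, this]
    simp only [mul_zero, zero_mul]
    positivity
  have hdp := norm_pos_iff.mpr h0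
  have h2 := abs_holderQuot_le (s := s) (p := (x, y)) hL h0
  have h3 : |holderQuot s f (x, y)| ≤ L * (2 * ρ) ^ (1 - s) := by
    refine h2.trans ?_
    gcongr
  rw [energyDensity, ← hg.apply_mul_self_abs, Real.rpow_sub hdp, Real.rpow_natCast,
    div_eq_mul_one_div (‖x - y‖ ^ (1 - s)), hC]
  have h4 := hg.monotone h3
  have h5 := hg.nonneg (t := L * (2 * ρ) ^ (1 - s)) (by positivity)
  calc g |holderQuot s f (x, y)| * |holderQuot s f (x, y)| * (1 / ‖x - y‖ ^ n)
      ≤ g (L * (2 * ρ) ^ (1 - s)) * (L * ‖x - y‖ ^ (1 - s)) * (1 / ‖x - y‖ ^ n) := by gcongr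
    _ = _ := by ring

/-- The shape in `h` of an upper bound for the difference of `g (D_s ψ)` at `(x, x + h)` and at
`(x - h, x)`, times `|h| ^ (-s - n)`, where `ψ` is a multiple of `bump ρ`. -/
noncomputable def barrierKernel (s ρ : ℝ) (h : Rn n) : ℝ :=
  (Metric.ball 0 ρ).indicator (fun h => 8 * ρ ^ (s - 2) * ‖h‖ ^ (2 - 2 * s - n)) h +
    (Metric.ball 0 ρ)ᶜ.indicator (fun h => 2 * ‖h‖ ^ (-s - n)) h

lemma barrierKernel_nonneg {ρ : ℝ} (hρ : 0 < ρ) (h : Rn n) : 0 ≤ barrierKernel s ρ h :=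
  add_nonneg (indicator_nonneg (fun _ _ => by positivity) _)
    (indicator_nonneg (fun _ _ => by positivity) _)

lemma integrable_barrierKernel_near (hn : 1 ≤ n) (hs1 : s < 1) {ρ : ℝ} (hρ : 0 < ρ) :
    Integrable ((Metric.ball (0 : Rn n) ρ).indicator
      fun h => 8 * ρ ^ (s - 2) * ‖h‖ ^ (2 - 2 * s - n)) :=
  (integrable_indicator_iff measurableSet_ball).mpr
    ((integrableOn_ball hn (by linarith) hρ).const_mul _)

lemma integrable_barrierKernel_far (hn : 1 ≤ n) (hs : 0 < s) {ρ : ℝ} (hρ : 0 < ρ) :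
    Integrable ((Metric.ball (0 : Rn n) ρ)ᶜ.indicator fun h => 2 * ‖h‖ ^ (-s - n)) :=
  (integrable_indicator_iff measurableSet_ball.compl).mpr
    ((integrableOn_compl_ball hn hs hρ).const_mul _)

lemma integrable_barrierKernel (hn : 1 ≤ n) (hs : 0 < s) (hs1 : s < 1) {ρ : ℝ} (hρ : 0 < ρ) :
    Integrable (barrierKernel s ρ : Rn n → ℝ) :=
  (integrable_barrierKernel_near hn hs1 hρ).add (integrable_barrierKernel_far hn hs hρ)

lemma integral_barrierKernel (hn : 1 ≤ n) (hs : 0 < s) (hs1 : s < 1) {ρ : ℝ} (hρ : 0 < ρ) :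
    ∫ h, (barrierKernel s ρ : Rn n → ℝ) h = sphereArea n * (4 / (1 - s) + 2 / s) * ρ ^ (-s) := by
  have h1 : (1 - s) ≠ 0 := by linarith
  unfold barrierKernel
  rw [integral_add (integrable_barrierKernel_near hn hs1 hρ)
    (integrable_barrierKernel_far hn hs hρ), integral_indicator measurableSet_ball,
    integral_indicator measurableSet_ball.compl, integral_const_mul, integral_const_mul,
    setIntegral_ball hn (by linarith) hρ, setIntegral_compl_ball hn hs hρ]
  have h2 : ρ ^ (-s) = ρ ^ (s - 2) * ρ ^ (2 - 2 * s) := by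
    rw [← Real.rpow_add hρ]
    congr 1
    ring
  have h3 : (2 - 2 * s) ≠ 0 := by linarith
  have h4 : 8 * (sphereArea n / (2 - 2 * s)) = sphereArea n * (4 / (1 - s)) := by
    field_simp
    ring
  linear_combination (sphereArea n * (4 / (1 - s))) * (-h2) + ρ ^ (s - 2) * ρ ^ (2 - 2 * s) * h4

/-- The pointwise second-order estimate behind the bound of the fractional `g`-Laplacian of the
barrier. For small `h` the difference of the two arguments is controlled by semiconvexity and the
slope of `g` by the Lipschitz constant; this compensates the singularity of the kernel also when
`g (|h| ^ (1 - s))` alone would not. -/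
lemma barrier_increment_le (hg : IsAdmissible lam Lam g) (hs : 0 < s) (hs1 : s < 1) {ρ : ℝ}
    (hρ : 0 < ρ) {A H : ℝ} (hA : 0 < A) (hAH : 2 * A ≤ H) (x h : Rn n) :
    (g ((A * bump ρ x - A * bump ρ (x + h)) / ‖h‖ ^ s) -
        g ((A * bump ρ (x - h) - A * bump ρ x) / ‖h‖ ^ s)) * ‖h‖ ^ (-s - n) ≤
      A / H * g (H / ρ ^ s) * barrierKernel s ρ h := by
  have hH : 0 < H := by linarith
  set a := (A * bump ρ x - A * bump ρ (x + h)) / ‖h‖ ^ s with ha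
  set b := (A * bump ρ (x - h) - A * bump ρ x) / ‖h‖ ^ s with hb
  have hG : 0 ≤ g (H / ρ ^ s) := hg.nonneg (by positivity)
  have hK := barrierKernel_nonneg (s := s) hρ h
  have hR : 0 ≤ A / H * g (H / ρ ^ s) * barrierKernel s ρ h := by positivity
  rcases le_total a b with hab | hab
  · refine le_trans (mul_nonpos_of_nonpos_of_nonneg ?_ (by positivity)) hR
    linarith [hg.monotone hab]
  rcases eq_or_ne h 0 with rfl | h0
  · have : a = b := by simp [ha, hb]
    rw [this, sub_self, zero_mul]
    exact hR
  have hhp : 0 < ‖h‖ := norm_pos_iff.mpr h0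
  by_cases hmem : h ∈ Metric.ball (0 : Rn n) ρ
  · have hhρ : ‖h‖ < ρ := by simpa using hmem
    set m := A / ρ * ‖h‖ ^ (1 - s) with hm
    have hm0 : 0 < m := by positivity
    have hm' : m = A * ‖h‖ / ρ / ‖h‖ ^ s := by
      rw [hm, ← norm_rpow_one_sub h0]
      ring
    have ham : |a| ≤ m := by
      rw [ha, hm', abs_div, abs_of_pos (by positivity : 0 < ‖h‖ ^ s), ← mul_sub, abs_mul,
        abs_of_pos hA]
      have := abs_bump_sub_le hρ x (x + h)
      rw [sub_add_cancel_left, norm_neg] at this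
      calc A * |bump ρ x - bump ρ (x + h)| / ‖h‖ ^ s ≤ A * (‖h‖ / ρ) / ‖h‖ ^ s := by gcongr
        _ = _ := by ring
    have hbm : |b| ≤ m := by
      rw [hb, hm', abs_div, abs_of_pos (by positivity : 0 < ‖h‖ ^ s), ← mul_sub, abs_mul,
        abs_of_pos hA]
      have := abs_bump_sub_le hρ (x - h) x
      rw [sub_sub_cancel_left, norm_neg] at this
      calc A * |bump ρ (x - h) - bump ρ x| / ‖h‖ ^ s ≤ A * (‖h‖ / ρ) / ‖h‖ ^ s := by gcongr
        _ = _ := by ring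
    have hdiff : a - b ≤ 2 * m * (‖h‖ / ρ) := by
      have h1 := bump_second_difference_le ρ x h
      have h2 : a - b = A * (2 * bump ρ x - bump ρ (x + h) - bump ρ (x - h)) / ‖h‖ ^ s := by
        rw [ha, hb]
        ring
      rw [h2, hm']
      calc A * (2 * bump ρ x - bump ρ (x + h) - bump ρ (x - h)) / ‖h‖ ^ s
          ≤ A * (2 * ‖h‖ ^ 2 / ρ ^ 2) / ‖h‖ ^ s := by gcongr
        _ = _ := by
          field_simp
    have hsl := hg.sub_le hm0 ham hbm hab
    have hg2m : g (2 * m) ≤ 2 * A / H * (‖h‖ / ρ) ^ (1 - s) * g (H / ρ ^ s) := by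
      have hz : 2 * m = 2 * A / H * (‖h‖ / ρ) ^ (1 - s) * (H / ρ ^ s) := by
        rw [hm, Real.div_rpow hhp.le hρ.le, Real.rpow_sub hρ, Real.rpow_one]
        field_simp
      rw [hz]
      refine hg.apply_mul_le (by positivity) ?_ (by positivity)
      refine mul_le_one₀ ?_ (by positivity) ?_
      · rw [div_le_one hH]
        exact hAH
      · refine Real.rpow_le_one (by positivity) ?_ (by linarith)
        rw [div_le_one hρ]
        exact hhρ.le
    have hg2m0 : 0 ≤ g (2 * m) := hg.nonneg (by positivity)
    have h3 : g a - g b ≤ 8 * (A / H) * ((‖h‖ / ρ) ^ (1 - s) * (‖h‖ / ρ)) * g (H / ρ ^ s) := by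
      calc g a - g b ≤ 2 * (g (2 * m) / m) * (2 * m * (‖h‖ / ρ)) :=
            hsl.trans (by gcongr)
        _ = 4 * g (2 * m) * (‖h‖ / ρ) := by
            field_simp
            ring
        _ ≤ 4 * (2 * A / H * (‖h‖ / ρ) ^ (1 - s) * g (H / ρ ^ s)) * (‖h‖ / ρ) := by gcongr
        _ = _ := by ring
    have e : barrierKernel s ρ h = 8 * ((‖h‖ / ρ) ^ (1 - s) * (‖h‖ / ρ)) * ‖h‖ ^ (-s - n) := by
      rw [barrierKernel, indicator_of_mem hmem, indicator_of_notMem (notMem_compl_iff.mpr hmem),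
        add_zero, Real.div_rpow hhp.le hρ.le,
        show 2 - 2 * s - (n : ℝ) = (1 - s) + 1 + (-s - n) by ring, Real.rpow_add hhp,
        Real.rpow_add_one hhp.ne', show s - 2 = -((1 - s) + 1) by ring, Real.rpow_neg hρ.le,
        Real.rpow_add_one hρ.ne']
      field_simp
    rw [e]
    calc (g a - g b) * ‖h‖ ^ (-s - n)
        ≤ (8 * (A / H) * ((‖h‖ / ρ) ^ (1 - s) * (‖h‖ / ρ)) * g (H / ρ ^ s)) * ‖h‖ ^ (-s - n) := by
          gcongr
      _ = _ := by ring
  · have hhρ : ρ ≤ ‖h‖ := by simpa using hmem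
    have hgA : g (A / ρ ^ s) ≤ A / H * g (H / ρ ^ s) := by
      have hz : A / ρ ^ s = A / H * (H / ρ ^ s) := by
        field_simp
      rw [hz]
      refine hg.apply_mul_le (by positivity) ?_ (by positivity)
      rw [div_le_one hH]
      linarith
    have hq : A / ‖h‖ ^ s ≤ A / ρ ^ s := by gcongr
    have haA : a ≤ A / ρ ^ s := by
      refine le_trans ?_ hq
      rw [ha]
      gcongr
      nlinarith [bump_le ρ x, bump_nonneg ρ (x + h)]
    have hbA : -(A / ρ ^ s) ≤ b := by
      refine le_trans (neg_le_neg hq) ?_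
      rw [hb, ← neg_div]
      gcongr
      nlinarith [bump_le ρ x, bump_nonneg ρ (x - h)]
    have h1 := hg.monotone haA
    have h2 := hg.monotone hbA
    rw [hg.odd] at h2
    rw [barrierKernel, indicator_of_notMem hmem, indicator_of_mem (mem_compl hmem), zero_add]
    calc (g a - g b) * ‖h‖ ^ (-s - n) ≤ (2 * (A / H * g (H / ρ ^ s))) * ‖h‖ ^ (-s - n) := by
          gcongr
          linarith
      _ = _ := by ring

/-- The fractional `g`-Laplacian of the barrier `A * bump ρ` is bounded above, in the weak sense.
The translation `x ↦ x - h` in the integral over `x` moves the difference quotient from `φ` to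
`g (D_s ψ)`. -/
lemma integral_energyDensity_bump_le (hg : IsAdmissible lam Lam g) (hn : 1 ≤ n) (hs : 0 < s)
    (hs1 : s < 1) {ρ : ℝ} (hρ : 0 < ρ) {A H : ℝ} (hA : 0 < A) (hAH : 2 * A ≤ H) {φ : Rn n → ℝ}
    (hφ0 : ∀ x, 0 ≤ φ x) (hφi : Integrable φ)
    (hi : Integrable (energyDensity g s (fun x => A * bump ρ x) φ) (pairVolume n)) :
    ∫ p, energyDensity g s (fun x => A * bump ρ x) φ p ∂pairVolume n ≤
      sphereArea n * (4 / (1 - s) + 2 / s) * (A / H) * (g (H / ρ ^ s) * ρ ^ (-s)) *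
        ∫ x, φ x := by
  set ψ : Rn n → ℝ := fun x => A * bump ρ x with hψ
  have hmp := measurePreserving_prod_add (volume : Measure (Rn n)) (volume : Measure (Rn n))
  have hi2 : Integrable (fun z : Rn n × Rn n => energyDensity g s ψ φ (z.1, z.1 + z.2))
      (pairVolume n) := hmp.integrable_comp_of_integrable hi
  have e1 : ∫ p, energyDensity g s ψ φ p ∂pairVolume n =
      ∫ z, energyDensity g s ψ φ (z.1, z.1 + z.2) ∂pairVolume n :=
    (hmp.integral_comp (MeasurableEquiv.shearAddRight (Rn n)).measurableEmbedding _).symm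
  rw [e1, integral_prod_symm _ hi2]
  have hψc : Continuous ψ := by
    have : Continuous (bump ρ : Rn n → ℝ) := by
      unfold bump
      fun_prop
    exact continuous_const.mul this
  have inner : ∀ h : Rn n, ∫ x, energyDensity g s ψ φ (x, x + h) ≤
      (A / H * g (H / ρ ^ s) * barrierKernel s ρ h) * ∫ x, φ x := by
    intro h
    rcases eq_or_ne h 0 with rfl | h0
    · have hK := barrierKernel_nonneg (s := s) hρ (0 : Rn n)
      have hG : 0 ≤ g (H / ρ ^ s) := hg.nonneg (div_nonneg (by linarith) (by positivity))
      have : 0 ≤ ∫ x, φ x := integral_nonneg hφ0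
      have hH : 0 < H := by linarith
      simp only [energyDensity, holderQuot, add_zero, sub_self, zero_div, mul_zero, zero_mul,
        integral_zero]
      positivity
    have hhp : 0 < ‖h‖ := norm_pos_iff.mpr h0
    set c := ‖h‖ ^ (-s - n) with hc
    have hc' : c = 1 / ‖h‖ ^ s * (1 / ‖h‖ ^ n) := by
      rw [hc, Real.rpow_sub hhp, Real.rpow_neg hhp.le, Real.rpow_natCast]
      field_simp
    set Γ : Rn n → ℝ := fun x => g ((ψ x - ψ (x + h)) / ‖h‖ ^ s) * c with hΓ
    have hΓc : Continuous Γ := by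
      have := hg.continuous
      fun_prop
    have hψb : ∀ x, |ψ x| ≤ A := by
      intro x
      rw [abs_of_nonneg (mul_nonneg hA.le (bump_nonneg _ _))]
      nlinarith [bump_le ρ x]
    obtain ⟨M, hM⟩ : ∃ M, ∀ x, ‖Γ x‖ ≤ M := by
      refine ⟨g (2 * A / ‖h‖ ^ s) * c, fun x => ?_⟩
      have h1 : |(ψ x - ψ (x + h)) / ‖h‖ ^ s| ≤ 2 * A / ‖h‖ ^ s := by
        rw [abs_div, abs_of_nonneg (by positivity : 0 ≤ ‖h‖ ^ s)]
        gcongr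
        have := abs_sub (ψ x) (ψ (x + h))
        linarith [hψb x, hψb (x + h)]
      rw [hΓ, Real.norm_eq_abs, abs_mul, hg.abs_apply, abs_of_nonneg (by positivity : 0 ≤ c)]
      gcongr
      exact hg.monotone h1
    have hI : ∀ f : Rn n → ℝ, Integrable f → Integrable fun x => Γ x * f x := fun f hf =>
      hf.bdd_mul hΓc.aestronglyMeasurable (Eventually.of_forall hM)
    have hΓc' : Continuous fun x => Γ (x - h) := hΓc.comp (by fun_prop)
    have hI' : Integrable fun x => Γ (x - h) * φ x :=
      hφi.bdd_mul hΓc'.aestronglyMeasurable (Eventually.of_forall fun x => hM _)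
    have e2 : ∫ x, energyDensity g s ψ φ (x, x + h) = ∫ x, (Γ x - Γ (x - h)) * φ x := by
      have e3 : ∀ x, energyDensity g s ψ φ (x, x + h) = Γ x * φ x - Γ x * φ (x + h) := by
        intro x
        simp only [energyDensity, holderQuot, sub_add_cancel_left, norm_neg, hΓ, hc']
        ring
      have e4 : ∫ x, Γ x * φ (x + h) = ∫ x, Γ (x - h) * φ x := by
        rw [← integral_add_right_eq_self (fun x => Γ (x - h) * φ x) h]
        simp only [add_sub_cancel_right]
      simp only [e3]
      rw [integral_sub (hI φ hφi) (hI _ (hφi.comp_add_right h)), e4,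
        ← integral_sub (hI φ hφi) hI']
      simp only [sub_mul]
    rw [e2, ← integral_const_mul]
    refine integral_mono ?_ (hφi.const_mul _) ?_
    · simp only [sub_mul]
      exact (hI φ hφi).sub hI'
    · intro x
      refine mul_le_mul_of_nonneg_right ?_ (hφ0 x)
      have := barrier_increment_le hg hs hs1 hρ hA hAH x h
      simp only [hΓ, hψ, sub_add_cancel]
      rw [← sub_mul]
      exact this
  have hKi := integrable_barrierKernel (n := n) hn hs hs1 hρ
  calc ∫ h, ∫ x, energyDensity g s ψ φ (x, x + h)
      ≤ ∫ h, (A / H * g (H / ρ ^ s) * barrierKernel s ρ h) * ∫ x, φ x :=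
        integral_mono hi2.integral_prod_right ((hKi.const_mul _).mul_const _) inner
    _ = _ := by
        rw [integral_mul_const, integral_const_mul, integral_barrierKernel hn hs hs1 hρ]
        ring

end Barrier

/-! ### Comparison of a function with the barrier -/

section Growth

variable {n : ℕ} {lam Lam s : ℝ} {g : ℝ → ℝ}

lemma apply_far_le (hg : IsAdmissible lam Lam g) {N f d : ℝ} (hN : 0 ≤ N) (hf : 0 ≤ f)
    (hd : 0 ≤ d) : g (2 * (N + f) / d) ≤ g (4 * N / d) + 4 ^ Lam * g (f / d) := by
  have h1 := hg.apply_add_le (a := 2 * N / d) (b := 2 * f / d) (by positivity) (by positivity)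
  have h2 := hg.apply_mul_le_rpow (b := 4) (t := f / d) (by norm_num) (by positivity)
  rw [show 2 * (N + f) / d = 2 * N / d + 2 * f / d by ring]
  rw [show 2 * (2 * N / d) = 4 * N / d by ring, show 2 * (2 * f / d) = 4 * (f / d) by ring] at h1
  linarith

lemma integral_apply_const_le (hg : IsAdmissible lam Lam g) (hn : 1 ≤ n) (hs : 0 < s) {ρ : ℝ}
    (hρ : 0 < ρ) {N : ℝ} (hN : 0 ≤ N) :
    ∫ y in (Metric.ball (0 : Rn n) ρ)ᶜ, g (N / ‖y‖ ^ s) * ‖y‖ ^ (-s - n) ≤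
      g (N / ρ ^ s) * (sphereArea n / s * ρ ^ (-s)) := by
  rw [← setIntegral_compl_ball hn hs hρ, ← integral_const_mul]
  refine setIntegral_mono_on (integrableOn_apply_const hg hn hs hρ hN)
    ((integrableOn_compl_ball hn hs hρ).const_mul _) measurableSet_ball.compl ?_
  intro y hy
  have hy' : ρ ≤ ‖y‖ := by simpa using hy
  gcongr
  exact hg.monotone (by gcongr)

section FarKernel

variable {ρ N : ℝ} {f : Rn n → ℝ}

lemma integrable_farKernel (hg : IsAdmissible lam Lam g) (hn : 1 ≤ n) (hs : 0 < s) (hρ : 0 < ρ)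
    (hN : 0 ≤ N) (hfm : Measurable f) (hf0 : ∀ y, 0 ≤ f y)
    (hf : IntegrableOn (fun y => g (f y / ‖y‖ ^ s) * ‖y‖ ^ (-s - n)) (Metric.ball 0 ρ)ᶜ) :
    Integrable (farKernel g s ρ fun y => N + f y) := by
  rw [integrable_farKernel_iff]
  refine ((integrableOn_apply_const hg hn hs hρ (N := 4 * N) (by positivity)).add
    (hf.const_mul (4 ^ Lam))).mono' ?_ (Eventually.of_forall fun y => ?_)
  · have := hg.continuous.measurable
    exact Measurable.aestronglyMeasurable (by fun_prop)
  · have h0 := hf0 y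
    have h1 := hg.nonneg (t := 2 * (N + f y) / ‖y‖ ^ s) (by positivity)
    rw [Real.norm_eq_abs, abs_of_nonneg (by positivity)]
    have h2 := apply_far_le hg hN h0 (by positivity : 0 ≤ ‖y‖ ^ s)
    calc g (2 * (N + f y) / ‖y‖ ^ s) * ‖y‖ ^ (-s - n)
        ≤ (g (4 * N / ‖y‖ ^ s) + 4 ^ Lam * g (f y / ‖y‖ ^ s)) * ‖y‖ ^ (-s - n) := by gcongr
      _ = _ := by
        simp only [Pi.add_apply]
        ring

lemma integral_farKernel_le (hg : IsAdmissible lam Lam g) (hn : 1 ≤ n) (hs : 0 < s) (hρ : 0 < ρ)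
    (hN : 0 ≤ N) (hfm : Measurable f) (hf0 : ∀ y, 0 ≤ f y)
    (hf : IntegrableOn (fun y => g (f y / ‖y‖ ^ s) * ‖y‖ ^ (-s - n)) (Metric.ball 0 ρ)ᶜ) :
    ∫ y, farKernel g s ρ (fun y => N + f y) y ≤
      2 ^ (n + 1) * (g (4 * N / ρ ^ s) * (sphereArea n / s * ρ ^ (-s)) +
        4 ^ Lam * ∫ y in (Metric.ball 0 ρ)ᶜ, g (f y / ‖y‖ ^ s) * ‖y‖ ^ (-s - n)) := by
  have hi := integrable_farKernel hg hn hs hρ hN hfm hf0 hf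
  rw [integrable_farKernel_iff] at hi
  have hc := integrableOn_apply_const (n := n) hg hn hs hρ (N := 4 * N) (by positivity)
  rw [farKernel, integral_indicator measurableSet_ball.compl, integral_const_mul]
  gcongr
  refine le_trans ?_ (add_le_add_left (integral_apply_const_le hg hn hs hρ (by positivity)) _)
  rw [← integral_const_mul, ← integral_add hc (hf.const_mul _)]
  refine integral_mono hi (hc.add (hf.const_mul _)) fun y => ?_
  have h0 := hf0 y
  have h2 := apply_far_le hg hN h0 (by positivity : 0 ≤ ‖y‖ ^ s)
  calc g (2 * (N + f y) / ‖y‖ ^ s) * ‖y‖ ^ (-s - n)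
      ≤ (g (4 * N / ‖y‖ ^ s) + 4 ^ Lam * g (f y / ‖y‖ ^ s)) * ‖y‖ ^ (-s - n) := by gcongr
    _ = _ := by ring

end FarKernel

/-- The part of the annulus `B_ρ \ B_{ρ/2}` on which `w` is large. -/
def largeSet (w : Rn n → ℝ) (ρ H : ℝ) : Set (Rn n) :=
  {y | H ≤ w y} ∩ (Metric.ball 0 ρ \ Metric.ball 0 (ρ / 2))

/-- A lower bound for the interaction of a point of `B_{ρ/2}` at which `w ≤ H / 2` with a point of
`B_ρ` at which `w ≥ H`. -/
noncomputable def nearGain (n : ℕ) (g : ℝ → ℝ) (s ρ H : ℝ) : ℝ :=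
  g (H / 2 / (2 * ρ) ^ s) * (1 / (2 * ρ) ^ s) * (1 / (2 * ρ) ^ n)

/-- The excess of the barrier over `w` in `B_ρ`: the test function of the comparison argument. -/
noncomputable def excess (A ρ : ℝ) (w : Rn n → ℝ) : Rn n → ℝ :=
  (Metric.ball 0 ρ).indicator fun x => max (A * bump ρ x - w x) 0

section Excess

variable {A H N ρ : ℝ} {w : Rn n → ℝ}

lemma excess_nonneg (x : Rn n) : 0 ≤ excess A ρ w x :=
  indicator_nonneg (fun _ _ => le_max_right _ _) x

lemma measurable_excess (hw : Measurable w) : Measurable (excess A ρ w) :=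
  Measurable.indicator (((measurable_bump ρ).const_mul A).sub hw |>.max measurable_const)
    measurableSet_ball

lemma excess_le (hA : 0 < A) (hw0 : ∀ x ∈ Metric.ball (0 : Rn n) ρ, 0 ≤ w x) (x : Rn n) :
    excess A ρ w x ≤ A := by
  by_cases hx : x ∈ Metric.ball (0 : Rn n) ρ
  · rw [excess, indicator_of_mem hx]
    refine max_le ?_ hA.le
    nlinarith [bump_le ρ x, hw0 x hx]
  · rw [excess, indicator_of_notMem hx]
    exact hA.le

lemma excess_eq_zero (hρ : 0 < ρ) (hw0 : ∀ x ∈ Metric.ball (0 : Rn n) ρ, 0 ≤ w x)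
    {x : Rn n} (hx : x ∉ Metric.ball (0 : Rn n) (ρ / 2)) : excess A ρ w x = 0 := by
  by_cases hx' : x ∈ Metric.ball (0 : Rn n) ρ
  · rw [excess, indicator_of_mem hx', bump_eq_zero hρ hx]
    exact max_eq_right (by linarith [hw0 x hx'])
  · rw [excess, indicator_of_notMem hx']

lemma lt_of_excess_ne_zero {x : Rn n} (hx : x ∈ Metric.ball (0 : Rn n) ρ)
    (h : excess A ρ w x ≠ 0) : w x < A * bump ρ x := by
  rw [excess, indicator_of_mem hx] at h
  by_contra hcon
  exact h (max_eq_right (by linarith))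

lemma integrable_excess (hA : 0 < A) (hwm : Measurable w)
    (hw0 : ∀ x ∈ Metric.ball (0 : Rn n) ρ, 0 ≤ w x) : Integrable (excess A ρ w) := by
  have hc : Integrable ((Metric.ball (0 : Rn n) ρ).indicator fun _ => A) :=
    (integrable_indicator_iff measurableSet_ball).mpr (integrableOn_const (by finiteness))
  refine hc.mono' (measurable_excess hwm).aestronglyMeasurable (Eventually.of_forall fun x => ?_)
  rw [Real.norm_eq_abs, abs_of_nonneg (excess_nonneg x)]
  by_cases hx : x ∈ Metric.ball (0 : Rn n) ρ
  · rw [indicator_of_mem hx]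
    exact excess_le hA hw0 x
  · rw [indicator_of_notMem hx, excess, indicator_of_notMem hx]

lemma lipschitz_barrier (hA : 0 < A) (hρ : 0 < ρ) (x y : Rn n) :
    |A * bump ρ x - A * bump ρ y| ≤ A / ρ * ‖x - y‖ := by
  rw [← mul_sub, abs_mul, abs_of_pos hA, div_mul_eq_mul_div, mul_div_assoc]
  exact mul_le_mul_of_nonneg_left (abs_bump_sub_le hρ x y) hA.le

lemma integrableOn_energyDensity_barrier (hg : IsAdmissible lam Lam g) (hn : 1 ≤ n)
    (hs1 : s < 1) (hρ : 0 < ρ) (hA : 0 < A) :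
    IntegrableOn (energyDensity g s (fun x : Rn n => A * bump ρ x) fun x => A * bump ρ x)
      (Metric.ball 0 ρ ×ˢ Metric.ball 0 ρ) (pairVolume n) :=
  integrableOn_energyDensity_of_lipschitz hg hn hs1 hρ (by positivity)
    ((measurable_bump ρ).const_mul A) (lipschitz_barrier hA hρ)

lemma integrableOn_energyDensity_excess (hg : IsAdmissible lam Lam g) (hn : 1 ≤ n)
    (hs1 : s < 1) (hρ : 0 < ρ) (hA : 0 < A) (hwm : Measurable w)
    (hEw : IntegrableOn (energyDensity g s w w) (Metric.ball 0 ρ ×ˢ Metric.ball 0 ρ)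
      (pairVolume n)) :
    IntegrableOn (energyDensity g s (excess A ρ w) (excess A ρ w))
      (Metric.ball 0 ρ ×ˢ Metric.ball 0 ρ) (pairVolume n) := by
  have hm := (measurable_excess (A := A) (ρ := ρ) hwm).aemeasurable (μ := volume)
  refine (((integrableOn_energyDensity_barrier hg hn hs1 hρ hA).add hEw).const_mul
    (2 ^ (Lam + 1))).mono'
    (aemeasurable_energyDensity hg hm hm).restrict.aestronglyMeasurable ?_
  filter_upwards [ae_restrict_mem (measurableSet_ball.prod measurableSet_ball)] with p hp
  obtain ⟨x, y⟩ := p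
  obtain ⟨hx, hy⟩ := hp
  rw [Real.norm_eq_abs, abs_of_nonneg (energyDensity_self_nonneg hg _ _)]
  simp only [Pi.add_apply, energyDensity]
  have hq : |holderQuot s (excess A ρ w) (x, y)| ≤
      |(|holderQuot s (fun x => A * bump ρ x) (x, y)| + |holderQuot s w (x, y)|)| := by
    refine le_trans ?_ (le_abs_self _)
    simp only [holderQuot, abs_div]
    rw [← add_div]
    gcongr
    rw [excess, indicator_of_mem hx, indicator_of_mem hy]
    refine (abs_max_sub_max_le_abs _ _ _).trans ?_
    rw [show A * bump ρ x - w x - (A * bump ρ y - w y) =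
      (A * bump ρ x - A * bump ρ y) - (w x - w y) by ring]
    exact abs_sub _ _
  have h1 := hg.apply_mul_self_mono hq
  have h2 := hg.apply_mul_self_add_le |holderQuot s (fun x => A * bump ρ x) (x, y)|
    |holderQuot s w (x, y)|
  rw [hg.apply_mul_self_abs, hg.apply_mul_self_abs] at h2
  rw [← add_mul, ← mul_assoc]
  exact mul_le_mul_of_nonneg_right (h1.trans h2) (by positivity)

/-- The kernel that compares the energies of `w` and of the barrier: a gain from the points of the
annulus at which `w` is large, and a loss from outside the ball. -/
noncomputable def comparisonKernel (g : ℝ → ℝ) (s ρ A H : ℝ) (w : Rn n → ℝ) (y : Rn n) : ℝ :=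
  farKernel g s ρ (fun y => A + max (-w y) 0) y -
    (largeSet w ρ H).indicator (fun _ => nearGain n g s ρ H) y

/-- Inside the ball the comparison of the energies is the monotonicity of `g`. -/
lemma energyDensity_excess_le_of_mem (hg : IsAdmissible lam Lam g) {x y : Rn n}
    (hx : x ∈ Metric.ball (0 : Rn n) ρ) (hy : y ∈ Metric.ball (0 : Rn n) ρ) :
    energyDensity g s w (excess A ρ w) (x, y) ≤
      energyDensity g s (fun x => A * bump ρ x) (excess A ρ w) (x, y) := by
  have hd : 0 ≤ ‖x - y‖ ^ s := by positivity
  unfold energyDensity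
  refine mul_le_mul_of_nonneg_right ?_ (by positivity)
  have key : ∀ x ∈ Metric.ball (0 : Rn n) ρ, ∀ y ∈ Metric.ball (0 : Rn n) ρ,
      excess A ρ w y < excess A ρ w x → w x - w y ≤ A * bump ρ x - A * bump ρ y := by
    intro x hx y hy h
    rw [excess, indicator_of_mem hx, indicator_of_mem hy] at h
    have h1 := (le_max_right (A * bump ρ y - w y) 0).trans_lt h
    have h2 := (le_max_left (A * bump ρ y - w y) 0).trans_lt h
    rcases lt_max_iff.mp h1 with h3 | h3
    · rw [max_eq_left h3.le] at h2
      linarith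
    · exact absurd h3 (lt_irrefl _)
  simp only [holderQuot]
  rcases lt_trichotomy (excess A ρ w y) (excess A ρ w x) with h | h | h
  · refine mul_le_mul_of_nonneg_right (hg.monotone ?_) (div_nonneg (by linarith) hd)
    exact div_le_div_of_nonneg_right (key x hx y hy h) hd
  · rw [h]
    simp
  · refine mul_le_mul_of_nonpos_right (hg.monotone ?_)
      (div_nonpos_of_nonpos_of_nonneg (by linarith) hd)
    refine div_le_div_of_nonneg_right ?_ hd
    linarith [key y hy x hx h]

lemma comparisonKernel_of_notMem {y : Rn n} (hy : y ∉ Metric.ball (0 : Rn n) ρ) :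
    comparisonKernel g s ρ A H w y = farKernel g s ρ (fun y => A + max (-w y) 0) y := by
  rw [comparisonKernel, indicator_of_notMem (fun h => hy h.2.1), sub_zero]

lemma comparisonKernel_of_mem_largeSet {y : Rn n} (hy : y ∈ largeSet w ρ H) :
    comparisonKernel g s ρ A H w y = -nearGain n g s ρ H := by
  rw [comparisonKernel, indicator_of_mem hy, farKernel,
    indicator_of_notMem (notMem_compl_iff.mpr hy.2.1), zero_sub]

lemma comparisonKernel_of_mem {y : Rn n} (hy : y ∈ Metric.ball (0 : Rn n) ρ)
    (hy' : y ∉ largeSet w ρ H) : comparisonKernel g s ρ A H w y = 0 := by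
  rw [comparisonKernel, indicator_of_notMem hy', farKernel,
    indicator_of_notMem (notMem_compl_iff.mpr hy), sub_zero]

lemma energyDensity_excess_le_cross (hg : IsAdmissible lam Lam g) (hs : 0 < s) (hs1 : s < 1)
    (hρ : 0 < ρ) (hA : 0 < A) (hAH : 2 * A ≤ H)
    (hw0 : ∀ x ∈ Metric.ball (0 : Rn n) ρ, 0 ≤ w x) {x y : Rn n}
    (hx : x ∈ Metric.ball (0 : Rn n) ρ)
    (hy : y ∉ Metric.ball (0 : Rn n) ρ ∨ y ∈ largeSet w ρ H) :
    energyDensity g s w (excess A ρ w) (x, y) ≤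
      energyDensity g s (fun x => A * bump ρ x) (excess A ρ w) (x, y) +
        excess A ρ w x * comparisonKernel g s ρ A H w y := by
  have hy2 : y ∉ Metric.ball (0 : Rn n) (ρ / 2) := by
    rcases hy with hy | hy
    · exact fun h => hy (Metric.ball_subset_ball (by linarith) h)
    · exact hy.2.2
  have hφy : excess A ρ w y = 0 := excess_eq_zero hρ hw0 hy2
  have hψ0 : 0 ≤ energyDensity g s (fun x => A * bump ρ x) (excess A ρ w) (x, y) := by
    have h1 := bump_nonneg ρ x
    have h2 := excess_nonneg (A := A) (ρ := ρ) (w := w) x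
    simp only [energyDensity, holderQuot, hφy, bump_eq_zero hρ hy2, mul_zero, sub_zero]
    have := hg.nonneg (t := A * bump ρ x / ‖x - y‖ ^ s) (by positivity)
    positivity
  by_cases hφx : excess A ρ w x = 0
  · simp [energyDensity, holderQuot, hφx, hφy]
  have hx2 : x ∈ Metric.ball (0 : Rn n) (ρ / 2) := by
    by_contra hcon
    exact hφx (excess_eq_zero hρ hw0 hcon)
  have hlt := lt_of_excess_ne_zero hx hφx
  have hφ0 := excess_nonneg (A := A) (ρ := ρ) (w := w) x
  have hwx : w x ≤ A / 4 := by nlinarith [bump_le ρ x]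
  suffices h : energyDensity g s w (excess A ρ w) (x, y) ≤
      excess A ρ w x * comparisonKernel g s ρ A H w y by linarith
  rcases hy with hy | hy
  · rw [comparisonKernel_of_notMem hy]
    refine le_trans ?_ (apply_div_le_farKernel hg hs hs1 hρ hx2 hy (by positivity) hφ0)
    simp only [energyDensity, holderQuot, hφy, sub_zero]
    gcongr
    refine hg.monotone ?_
    gcongr
    linarith [le_max_left (-w y) 0]
  · rw [comparisonKernel_of_mem_largeSet hy]
    have hxy : x ≠ y := fun h => hφx (h ▸ hφy)
    have hd0 : 0 < ‖x - y‖ := norm_pos_iff.mpr (sub_ne_zero.mpr hxy)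
    have hd : ‖x - y‖ ≤ 2 * ρ := by
      have h1 : ‖x‖ < ρ := by simpa using hx
      have h2 : ‖y‖ < ρ := by simpa using hy.2.1
      linarith [norm_sub_le x y]
    have hyH : H ≤ w y := hy.1
    have h1 : g ((w x - w y) / ‖x - y‖ ^ s) ≤ -g (H / 2 / (2 * ρ) ^ s) := by
      rw [← hg.odd]
      refine hg.monotone ?_
      calc (w x - w y) / ‖x - y‖ ^ s ≤ -(H / 2) / ‖x - y‖ ^ s := by
            gcongr
            linarith
        _ = -(H / 2 / ‖x - y‖ ^ s) := by ring
        _ ≤ -(H / 2 / (2 * ρ) ^ s) := by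
            have : 0 ≤ H / 2 := by linarith
            gcongr
    have h0 : 0 ≤ g (H / 2 / (2 * ρ) ^ s) := hg.nonneg (div_nonneg (by linarith) (by positivity))
    simp only [energyDensity, holderQuot, hφy, sub_zero]
    calc g ((w x - w y) / ‖x - y‖ ^ s) * (excess A ρ w x / ‖x - y‖ ^ s) * (1 / ‖x - y‖ ^ n)
        ≤ -g (H / 2 / (2 * ρ) ^ s) * (excess A ρ w x / ‖x - y‖ ^ s) * (1 / ‖x - y‖ ^ n) := by
          gcongr
      _ = -(g (H / 2 / (2 * ρ) ^ s) * (excess A ρ w x / ‖x - y‖ ^ s) * (1 / ‖x - y‖ ^ n)) := by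
          ring
      _ ≤ -(g (H / 2 / (2 * ρ) ^ s) * (excess A ρ w x / (2 * ρ) ^ s) * (1 / (2 * ρ) ^ n)) := by
          gcongr
      _ = _ := by
          rw [nearGain]
          ring

/-- The energy of `w` against the excess is at most the energy of the barrier, corrected by the
interactions with the large set and with the exterior of the ball. -/
lemma energyDensity_excess_le (hg : IsAdmissible lam Lam g) (hs : 0 < s) (hs1 : s < 1)
    (hρ : 0 < ρ) (hA : 0 < A) (hAH : 2 * A ≤ H)
    (hw0 : ∀ x ∈ Metric.ball (0 : Rn n) ρ, 0 ≤ w x) (p : Rn n × Rn n) :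
    energyDensity g s w (excess A ρ w) p ≤
      energyDensity g s (fun x => A * bump ρ x) (excess A ρ w) p +
        (excess A ρ w p.1 * comparisonKernel g s ρ A H w p.2 +
          comparisonKernel g s ρ A H w p.1 * excess A ρ w p.2) := by
  obtain ⟨x, y⟩ := p
  have hzero : ∀ z, z ∉ Metric.ball (0 : Rn n) ρ ∨ z ∈ largeSet w ρ H → excess A ρ w z = 0 := by
    intro z hz
    refine excess_eq_zero hρ hw0 ?_
    rcases hz with hz | hz
    · exact fun h => hz (Metric.ball_subset_ball (by linarith) h)
    · exact hz.2.2
  by_cases hy : y ∉ Metric.ball (0 : Rn n) ρ ∨ y ∈ largeSet w ρ H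
  · by_cases hx : x ∈ Metric.ball (0 : Rn n) ρ
    · have := energyDensity_excess_le_cross hg hs hs1 hρ hA hAH hw0 hx hy
      simp only [hzero y hy, mul_zero, add_zero]
      exact this
    · simp [energyDensity, holderQuot, hzero y hy, hzero x (Or.inl hx)]
  by_cases hx : x ∉ Metric.ball (0 : Rn n) ρ ∨ x ∈ largeSet w ρ H
  · have hyB : y ∈ Metric.ball (0 : Rn n) ρ := by
      by_contra hcon
      exact hy (Or.inl hcon)
    have := energyDensity_excess_le_cross hg hs hs1 hρ hA hAH hw0 hyB hx
    simp only [hzero x hx, zero_mul, zero_add]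
    rw [energyDensity_swap hg w, energyDensity_swap hg (fun x => A * bump ρ x)]
    linarith [mul_comm (excess A ρ w y) (comparisonKernel g s ρ A H w x)]
  · rw [not_or, not_not] at hx hy
    simp only [comparisonKernel_of_mem hx.1 hx.2, comparisonKernel_of_mem hy.1 hy.2, mul_zero,
      zero_mul, add_zero]
    exact energyDensity_excess_le_of_mem hg hx.1 hy.1

lemma measurableSet_largeSet (hwm : Measurable w) : MeasurableSet (largeSet w ρ H) :=
  (measurableSet_le measurable_const hwm).inter (measurableSet_ball.diff measurableSet_ball)

lemma largeSet_subset : largeSet w ρ H ⊆ Metric.ball (0 : Rn n) ρ := fun _ hx => hx.2.1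

lemma negPart_le_abs (a : ℝ) : max (-a) 0 ≤ |a| := max_le (neg_le_abs a) (abs_nonneg a)

lemma integrableOn_apply_negPart (hg : IsAdmissible lam Lam g) (hwm : Measurable w)
    (hT : IntegrableOn (fun y => g (|w y| / ‖y‖ ^ s) * ‖y‖ ^ (-s - n)) (Metric.ball 0 ρ)ᶜ) :
    IntegrableOn (fun y => g (max (-w y) 0 / ‖y‖ ^ s) * ‖y‖ ^ (-s - n)) (Metric.ball 0 ρ)ᶜ := by
  refine hT.mono' ?_ (Eventually.of_forall fun y => ?_)
  · have := hg.continuous.measurable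
    exact Measurable.aestronglyMeasurable (by fun_prop)
  · have h1 := hg.nonneg (t := max (-w y) 0 / ‖y‖ ^ s) (by positivity)
    rw [Real.norm_eq_abs, abs_of_nonneg (by positivity)]
    gcongr
    refine hg.monotone ?_
    gcongr
    exact negPart_le_abs _

/-- The comparison of `w` with the barrier in integrated form. -/
lemma energyForm_excess_le (hg : IsAdmissible lam Lam g) (hn : 1 ≤ n) (hs : 0 < s) (hs1 : s < 1)
    (hρ : 0 < ρ) (hA : 0 < A) (hAH : 2 * A ≤ H) (hwm : Measurable w)
    (hw0 : ∀ x ∈ Metric.ball (0 : Rn n) ρ, 0 ≤ w x)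
    (hwN : ∀ x ∈ Metric.ball (0 : Rn n) ρ, w x ≤ N)
    (hEw : IntegrableOn (energyDensity g s w w) (Metric.ball 0 ρ ×ˢ Metric.ball 0 ρ)
      (pairVolume n))
    (hT : IntegrableOn (fun y => g (|w y| / ‖y‖ ^ s) * ‖y‖ ^ (-s - n)) (Metric.ball 0 ρ)ᶜ) :
    energyForm g s w (excess A ρ w) ≤
      (sphereArea n * (4 / (1 - s) + 2 / s) * (A / H) * (g (H / ρ ^ s) * ρ ^ (-s)) +
        2 * ((∫ y, farKernel g s ρ (fun y => A + max (-w y) 0) y) -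
          volume.real (largeSet w ρ H) * nearGain n g s ρ H)) * ∫ x, excess A ρ w x := by
  have hφm := measurable_excess (A := A) (ρ := ρ) hwm
  have hφi := integrable_excess hA hwm hw0
  have hEφ := integrableOn_energyDensity_excess hg hn hs1 hρ hA hwm hEw
  have hN0 : 0 ≤ N := by
    have h0 : (0 : Rn n) ∈ Metric.ball (0 : Rn n) ρ := Metric.mem_ball_self hρ
    exact (hw0 0 h0).trans (hwN 0 h0)
  have hφz : ∀ x ∉ Metric.ball (0 : Rn n) (ρ / 2), excess A ρ w x = 0 := fun x hx =>
    excess_eq_zero hρ hw0 hx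
  have hF : Integrable (energyDensity g s w (excess A ρ w)) (pairVolume n) :=
    integrable_energyDensity hg hs hs1 hρ hwm hφm excess_nonneg hφz hφi hEφ hN0
      (fun x hx => by rw [abs_of_nonneg (hw0 x hx)]; exact hwN x hx) hEw
      (integrable_farKernel hg hn hs hρ hN0 (by fun_prop) (fun _ => abs_nonneg _) hT)
  have hψm : Measurable fun x : Rn n => A * bump ρ x := (measurable_bump ρ).const_mul A
  have hψ0 : ∀ x : Rn n, 0 ≤ A * bump ρ x := fun x => mul_nonneg hA.le (bump_nonneg ρ x)
  have hψz : ∀ x ∉ Metric.ball (0 : Rn n) (ρ / 2), A * bump ρ x = 0 := fun x hx => by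
    rw [bump_eq_zero hρ hx, mul_zero]
  have hψN : ∀ x : Rn n, A * bump ρ x ≤ A := fun x => by nlinarith [bump_le ρ x]
  have hF1 : Integrable (energyDensity g s (fun x => A * bump ρ x) (excess A ρ w))
      (pairVolume n) := by
    refine integrable_energyDensity hg hs hs1 hρ hψm hφm excess_nonneg hφz hφi hEφ hA.le
      (fun x _ => by rw [abs_of_nonneg (hψ0 x)]; exact hψN x)
      (integrableOn_energyDensity_barrier hg hn hs1 hρ hA) ?_
    refine integrable_farKernel hg hn hs hρ hA.le (by fun_prop) (fun _ => abs_nonneg _) ?_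
    refine IntegrableOn.congr_fun (integrableOn_zero (ε' := ℝ)) ?_ measurableSet_ball.compl
    intro y hy
    have : A * bump ρ y = 0 := hψz y fun h => hy (Metric.ball_subset_ball (by linarith) h)
    simp [this, hg.zero]
  have hkf : Integrable (farKernel g s ρ fun y => A + max (-w y) 0) :=
    integrable_farKernel hg hn hs hρ hA.le (by fun_prop) (fun _ => le_max_right _ _)
      (integrableOn_apply_negPart hg hwm hT)
  have hkP : Integrable ((largeSet w ρ H).indicator fun _ => nearGain n g s ρ H) :=
    (integrable_indicator_iff (measurableSet_largeSet hwm)).mpr (integrableOn_const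
      ((measure_mono largeSet_subset).trans_lt measure_ball_lt_top).ne)
  have hk : Integrable (comparisonKernel g s ρ A H w) := hkf.sub hkP
  have hkint : ∫ y, comparisonKernel g s ρ A H w y =
      (∫ y, farKernel g s ρ (fun y => A + max (-w y) 0) y) -
          volume.real (largeSet w ρ H) * nearGain n g s ρ H := by
    unfold comparisonKernel
    rw [integral_sub hkf hkP, integral_indicator (measurableSet_largeSet hwm), setIntegral_const,
      smul_eq_mul]
  have hF2 := (hφi.mul_prod hk).add (hk.mul_prod hφi)
  rw [energyForm_eq]
  have h1 := integral_mono hF (hF1.add hF2)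
    (energyDensity_excess_le hg hs hs1 hρ hA hAH hw0)
  have h2 := integral_energyDensity_bump_le hg hn hs hs1 hρ hA hAH excess_nonneg hφi hF1
  have h3 : ∫ p, ((fun z : Rn n × Rn n => excess A ρ w z.1 * comparisonKernel g s ρ A H w z.2) +
      fun z : Rn n × Rn n => comparisonKernel g s ρ A H w z.1 * excess A ρ w z.2) p ∂pairVolume n =
      2 * (∫ y, comparisonKernel g s ρ A H w y) * ∫ x, excess A ρ w x := by
    simp only [Pi.add_apply]
    rw [integral_add (hφi.mul_prod hk) (hk.mul_prod hφi), integral_prod_mul, integral_prod_mul]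
    ring
  have h4 := integral_add hF1 hF2
  simp only [Pi.add_apply] at h1 h3 h4
  rw [h4, h3, hkint] at h1
  linarith

end Excess

end Growth

/-! ### The growth lemma -/

section GrowthLemma

variable {n : ℕ} {lam Lam s : ℝ} {g : ℝ → ℝ}

lemma nearGain_ge (hg : IsAdmissible lam Lam g) (hs1 : s < 1) {ρ H : ℝ}
    (hρ : 0 < ρ) (hH : 0 < H) :
    g (H / ρ ^ s) * ρ ^ (-s) / (4 ^ Lam * 2 ^ (n + 1) * ρ ^ n) ≤ nearGain n g s ρ H := by
  have hds : (2 * ρ) ^ s ≤ 2 * ρ ^ s := by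
    rw [Real.mul_rpow (by norm_num) hρ.le]
    gcongr
    calc (2 : ℝ) ^ s ≤ 2 ^ (1 : ℝ) := by gcongr; norm_num
      _ = 2 := Real.rpow_one 2
  have hρs : 0 < ρ ^ s := by positivity
  have h1 := hg.apply_mul_le_rpow (b := 4) (t := H / 2 / (2 * ρ) ^ s) (by norm_num) (by positivity)
  have h2 : g (H / ρ ^ s) ≤ g (4 * (H / 2 / (2 * ρ) ^ s)) := by
    refine hg.monotone ?_
    rw [show 4 * (H / 2 / (2 * ρ) ^ s) = 2 * H / (2 * ρ) ^ s by ring,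
      div_le_div_iff₀ hρs (by positivity)]
    nlinarith
  have h3 : g (H / ρ ^ s) / 4 ^ Lam ≤ g (H / 2 / (2 * ρ) ^ s) := by
    rw [div_le_iff₀ (by positivity)]
    linarith
  have h0 : 0 ≤ g (H / ρ ^ s) := hg.nonneg (by positivity)
  have h4 : 0 ≤ g (H / 2 / (2 * ρ) ^ s) := hg.nonneg (by positivity)
  rw [nearGain, Real.rpow_neg hρ.le]
  calc g (H / ρ ^ s) * (ρ ^ s)⁻¹ / (4 ^ Lam * 2 ^ (n + 1) * ρ ^ n)
      = g (H / ρ ^ s) / 4 ^ Lam * (1 / (2 * ρ ^ s)) * (1 / (2 * ρ) ^ n) := by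
        rw [mul_pow]
        field_simp
        ring
    _ ≤ _ := by gcongr

/-- If `w ≥ 0` in `B_ρ` and `w ≥ H` on a substantial part of `B_ρ \ B_{ρ/2}`, then the interaction
with that part would make the form negative at a nonzero excess. Hence a low barrier lies below `w`.
The constants enter through `hconst`: its right-hand side is the gain, its left-hand side
collects the losses, which are proportional to the height `ε` of the barrier and to `κ`. -/
lemma excess_ae_eq_zero (hg : IsAdmissible lam Lam g) (hn : 1 ≤ n) (hs : 0 < s) (hs1 : s < 1)
    {ε κ : ℝ} (hε : 0 < ε) (hε4 : ε ≤ 1 / 4)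
    (hconst : (sphereArea n * (4 / (1 - s) + 2 / s) + 2 ^ (n + 4) * (sphereArea n / s)) * ε +
      (2 ^ (n + 2) * 4 ^ Lam + 1) * κ <
        volume.real (Metric.ball (0 : Rn n) 1) / (4 ^ Lam * 2 ^ (n + 2)))
    {ρ H N K : ℝ} {w : Rn n → ℝ} (hρ : 0 < ρ) (hH : 0 < H) (hwm : Measurable w)
    (hw0 : ∀ x ∈ Metric.ball (0 : Rn n) ρ, 0 ≤ w x)
    (hwN : ∀ x ∈ Metric.ball (0 : Rn n) ρ, w x ≤ N)
    (hEw : IntegrableOn (energyDensity g s w w) (Metric.ball 0 ρ ×ˢ Metric.ball 0 ρ)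
      (pairVolume n))
    (hT : IntegrableOn (fun y => g (|w y| / ‖y‖ ^ s) * ‖y‖ ^ (-s - n)) (Metric.ball 0 ρ)ᶜ)
    (hP : ρ ^ n * volume.real (Metric.ball (0 : Rn n) 1) / 4 ≤ volume.real (largeSet w ρ H))
    (htail : ∫ y in (Metric.ball 0 ρ)ᶜ, g (max (-w y) 0 / ‖y‖ ^ s) * ‖y‖ ^ (-s - n) ≤
      κ * (g (H / ρ ^ s) * ρ ^ (-s)))
    (hK : K ≤ κ * (g (H / ρ ^ s) * ρ ^ (-s)))
    (hsuper : -(K * ∫ x, excess (ε * H) ρ w x) ≤ energyForm g s w (excess (ε * H) ρ w)) :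
    excess (ε * H) ρ w =ᵐ[volume] 0 := by
  have hω : 0 < sphereArea n := sphereArea_pos hn
  have hA : 0 < ε * H := by positivity
  have hAH : 2 * (ε * H) ≤ H := by nlinarith
  have hmain := energyForm_excess_le hg hn hs hs1 hρ hA hAH hwm hw0 hwN hEw hT
  have hfar := integral_farKernel_le hg hn hs hρ hA.le (f := fun y => max (-w y) 0) (by fun_prop)
    (fun _ => le_max_right _ _) (integrableOn_apply_negPart hg hwm hT)
  have hI0 : 0 ≤ ∫ x, excess (ε * H) ρ w x := integral_nonneg excess_nonneg
  have hng := nearGain_ge (n := n) hg hs1 hρ hH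
  have hΓ0 : 0 < g (H / ρ ^ s) * ρ ^ (-s) := mul_pos (hg.pos _ (by positivity)) (by positivity)
  have hconst_far : g (4 * (ε * H) / ρ ^ s) * (sphereArea n / s * ρ ^ (-s)) ≤
      4 * ε * (sphereArea n / s) * (g (H / ρ ^ s) * ρ ^ (-s)) := by
    have h4 : g (4 * (ε * H) / ρ ^ s) ≤ 4 * ε * g (H / ρ ^ s) := by
      rw [show 4 * (ε * H) / ρ ^ s = 4 * ε * (H / ρ ^ s) by ring]
      exact hg.apply_mul_le (by positivity) (by linarith) (by positivity)
    calc g (4 * (ε * H) / ρ ^ s) * (sphereArea n / s * ρ ^ (-s))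
        ≤ 4 * ε * g (H / ρ ^ s) * (sphereArea n / s * ρ ^ (-s)) := by gcongr
      _ = _ := by ring
  rw [mul_div_cancel_right₀ _ hH.ne'] at hmain
  suffices h : ∫ x, excess (ε * H) ρ w x ≤ 0 from
    (integral_eq_zero_iff_of_nonneg excess_nonneg (integrable_excess hA hwm hw0)).mp
      (le_antisymm h hI0)
  generalize (∫ x, excess (ε * H) ρ w x) = I at *
  generalize energyForm g s w (excess (ε * H) ρ w) = E at *
  generalize g (H / ρ ^ s) * ρ ^ (-s) = Γ at *
  generalize (∫ y, farKernel g s ρ (fun y => ε * H + max (-w y) 0) y) = F at *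
  generalize (∫ y in (Metric.ball 0 ρ)ᶜ, g (max (-w y) 0 / ‖y‖ ^ s) * ‖y‖ ^ (-s - n)) = T at *
  generalize volume.real (Metric.ball (0 : Rn n) 1) = v at *
  have hgain : v / (4 ^ Lam * 2 ^ (n + 2)) * Γ ≤
      2 * (volume.real (largeSet w ρ H) * nearGain n g s ρ H) := by
    have h1 : ρ ^ n * v / 4 * (Γ / (4 ^ Lam * 2 ^ (n + 1) * ρ ^ n)) ≤
        volume.real (largeSet w ρ H) * nearGain n g s ρ H :=
      mul_le_mul hP hng (by positivity) measureReal_nonneg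
    have h2 : v / (4 ^ Lam * 2 ^ (n + 2)) * Γ =
        2 * (ρ ^ n * v / 4 * (Γ / (4 ^ Lam * 2 ^ (n + 1) * ρ ^ n))) := by
      field_simp
      ring
    linarith
  generalize volume.real (largeSet w ρ H) * nearGain n g s ρ H = P at *
  have hF : F ≤ 2 ^ (n + 1) * (4 * ε * (sphereArea n / s) * Γ + 4 ^ Lam * (κ * Γ)) := by
    refine hfar.trans ?_
    gcongr
  by_contra! hI
  have h1 := (mul_lt_mul_iff_left₀ hΓ0).mpr hconst
  have h2 : sphereArea n * (4 / (1 - s) + 2 / s) * ε * Γ + 2 * (F - P) + κ * Γ < 0 := by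
    have e : 2 * (2 ^ (n + 1) * (4 * ε * (sphereArea n / s) * Γ + 4 ^ Lam * (κ * Γ))) =
        2 ^ (n + 4) * (sphereArea n / s) * ε * Γ + 2 ^ (n + 2) * 4 ^ Lam * κ * Γ := by
      ring
    linarith
  have h3 := mul_neg_of_neg_of_pos h2 hI
  have h4 : K * I ≤ κ * Γ * I := mul_le_mul_of_nonneg_right hK hI0
  rw [add_mul] at h3
  linarith

/-- The growth lemma, with the supersolution property used only for the excess of the barrier. -/
lemma exists_growth_of_excess (n : ℕ) (hn : 1 ≤ n) (Lam : ℝ) {s : ℝ} (hs : 0 < s) (hs1 : s < 1) :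
    ∃ ε κ : ℝ, 0 < ε ∧ ε ≤ 1 / 4 ∧ 0 < κ ∧
      ∀ {lam : ℝ} {g : ℝ → ℝ} (_ : IsAdmissible lam Lam g) {ρ H N K : ℝ} {w : Rn n → ℝ}
        (_ : 0 < ρ) (_ : 0 < H) (_ : Measurable w)
        (_ : ∀ x ∈ Metric.ball (0 : Rn n) ρ, 0 ≤ w x)
        (_ : ∀ x ∈ Metric.ball (0 : Rn n) ρ, w x ≤ N)
        (_ : IntegrableOn (energyDensity g s w w) (Metric.ball 0 ρ ×ˢ Metric.ball 0 ρ)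
          (pairVolume n))
        (_ : IntegrableOn (fun y => g (|w y| / ‖y‖ ^ s) * ‖y‖ ^ (-s - n)) (Metric.ball 0 ρ)ᶜ)
        (_ : ρ ^ n * volume.real (Metric.ball (0 : Rn n) 1) / 4 ≤ volume.real (largeSet w ρ H))
        (_ : ∫ y in (Metric.ball 0 ρ)ᶜ, g (max (-w y) 0 / ‖y‖ ^ s) * ‖y‖ ^ (-s - n) ≤
          κ * (g (H / ρ ^ s) * ρ ^ (-s)))
        (_ : K ≤ κ * (g (H / ρ ^ s) * ρ ^ (-s)))
        (_ : -(K * ∫ x, excess (ε * H) ρ w x) ≤ energyForm g s w (excess (ε * H) ρ w)),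
        ∀ᵐ x, x ∈ Metric.ball (0 : Rn n) (ρ / 4) → 3 / 16 * (ε * H) ≤ w x := by
  have hω0 : 0 < sphereArea n := sphereArea_pos hn
  have hv0 := ballVolume_pos n
  have h1s : 0 < 1 - s := by linarith
  obtain ⟨c, hc⟩ : ∃ c, c = volume.real (Metric.ball (0 : Rn n) 1) / (4 ^ Lam * 2 ^ (n + 2)) :=
    ⟨_, rfl⟩
  obtain ⟨a, ha⟩ : ∃ a, a = sphereArea n * (4 / (1 - s) + 2 / s) +
    2 ^ (n + 4) * (sphereArea n / s) := ⟨_, rfl⟩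
  obtain ⟨b, hb⟩ : ∃ b, b = 2 ^ (n + 2) * (4 : ℝ) ^ Lam + 1 := ⟨_, rfl⟩
  have hc0 : 0 < c := by
    rw [hc]
    positivity
  have ha0 : 0 < a := by
    rw [ha]
    positivity
  have hb0 : 0 < b := by
    rw [hb]
    positivity
  have hεa : a * min (1 / 4) (c / 4 / a) ≤ c / 4 := by
    have : min (1 / 4) (c / 4 / a) ≤ c / 4 / a := min_le_right _ _
    rwa [le_div_iff₀ ha0, mul_comm] at this
  have hκb : b * (c / 4 / b) = c / 4 := by
    field_simp
  have hε0 : 0 < min (1 / 4) (c / 4 / a) := by positivity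
  have hε4 : min (1 / 4) (c / 4 / a) ≤ 1 / 4 := min_le_left _ _
  generalize min (1 / 4) (c / 4 / a) = ε at *
  refine ⟨ε, c / 4 / b, hε0, hε4, by positivity, ?_⟩
  intro lam g hg ρ H N K w hρ hH hwm hw0 hwN hEw hT hP htail hK hsuper
  have hφ := excess_ae_eq_zero hg hn hs hs1 hε0 hε4
    (by rw [← ha, ← hb, ← hc]; linarith) hρ hH hwm hw0 hwN hEw hT hP htail hK hsuper
  filter_upwards [hφ] with x hx hxb
  have hxρ : x ∈ Metric.ball (0 : Rn n) ρ := Metric.ball_subset_ball (by linarith) hxb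
  rw [excess, indicator_of_mem hxρ, Pi.zero_apply] at hx
  have h10 := le_max_left (ε * H * bump ρ x - w x) 0
  have h11 := le_bump_of_mem hρ hxb
  have h12 := mul_pos hε0 hH
  nlinarith

/-- The growth property with the constants `θ` and `κ`: if a function is nonnegative in `B_ρ`,
satisfies `(-Δ_g)^s w ≥ -K` weakly in `B_R ⊇ B_ρ` with `K` small, has a negative part with a small
tail, and is at least `H` on a substantial part of `B_ρ \ B_{ρ/2}`, then it is at least `θ * H` in
`B_{ρ/4}`. -/
def HasGrowth (n : ℕ) (s Lam θ κ : ℝ) : Prop :=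
  ∀ {lam : ℝ} {g : ℝ → ℝ} (_ : IsAdmissible lam Lam g) {ρ R H N K : ℝ} {w : Rn n → ℝ}
    (_ : 0 < ρ) (_ : ρ ≤ R) (_ : 0 < H) (_ : AEMeasurable w)
    (_ : ∀ᵐ x, x ∈ Metric.ball (0 : Rn n) ρ → 0 ≤ w x)
    (_ : ∀ᵐ x, x ∈ Metric.ball (0 : Rn n) ρ → w x ≤ N)
    (_ : IntegrableOn (energyDensity g s w w) (Metric.ball 0 R ×ˢ Metric.ball 0 R)
      (pairVolume n))
    (_ : IntegrableOn (fun y => g (|w y| / ‖y‖ ^ s) * ‖y‖ ^ (-s - n)) (Metric.ball 0 ρ)ᶜ)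
    (_ : ρ ^ n * volume.real (Metric.ball (0 : Rn n) 1) / 4 ≤ volume.real (largeSet w ρ H))
    (_ : ∫ y in (Metric.ball 0 ρ)ᶜ, g (max (-w y) 0 / ‖y‖ ^ s) * ‖y‖ ^ (-s - n) ≤
      κ * (g (H / ρ ^ s) * ρ ^ (-s)))
    (_ : K ≤ κ * (g (H / ρ ^ s) * ρ ^ (-s)))
    (_ : ∀ φ : Rn n → ℝ, MemW0 g s (Metric.ball 0 R) φ → (∀ x, 0 ≤ φ x) →
      -(K * ∫ x in Metric.ball 0 R, φ x) ≤ energyForm g s w φ),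
    ∀ᵐ x, x ∈ Metric.ball (0 : Rn n) (ρ / 4) → θ * H ≤ w x

/-- The growth lemma. It follows from the case of bounds that hold everywhere in `B_ρ`, by a change
of representative. -/
lemma exists_hasGrowth (n : ℕ) (hn : 1 ≤ n) (Lam : ℝ) {s : ℝ} (hs : 0 < s) (hs1 : s < 1) :
    ∃ θ κ : ℝ, 0 < θ ∧ 0 < κ ∧ HasGrowth n s Lam θ κ := by
  obtain ⟨ε, κ, hε, hε4, hκ, h⟩ := exists_growth_of_excess n hn Lam hs hs1
  refine ⟨3 / 16 * ε, κ, by positivity, hκ, ?_⟩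
  intro lam g hg ρ R H N K w hρ hρR hH hwm hw0 hwN hEw hT hP htail hK hsuper
  -- A measurable representative of `w` that satisfies the bounds in `B_ρ` everywhere.
  set N' := max N 0 with hN'
  set w' : Rn n → ℝ := fun x =>
    (Metric.ball 0 ρ).indicator (fun x => min (max (hwm.mk w x) 0) N') x +
      (Metric.ball 0 ρ)ᶜ.indicator (hwm.mk w) x with hw'
  have hm' : Measurable w' :=
    (Measurable.indicator ((hwm.measurable_mk.max measurable_const).min measurable_const)
      measurableSet_ball).add (hwm.measurable_mk.indicator measurableSet_ball.compl)
  have hin : ∀ x ∈ Metric.ball (0 : Rn n) ρ, w' x = min (max (hwm.mk w x) 0) N' := by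
    intro x hx
    simp only [hw', indicator_of_mem hx, indicator_of_notMem (notMem_compl_iff.mpr hx), add_zero]
  have hae : w' =ᵐ[volume] w := by
    filter_upwards [hwm.ae_eq_mk, hw0, hwN] with x h1 h2 h3
    by_cases hx : x ∈ Metric.ball (0 : Rn n) ρ
    · rw [hin x hx, ← h1, max_eq_left (h2 hx), min_eq_left ((h3 hx).trans (le_max_left _ _))]
    · simp only [hw', indicator_of_notMem hx, indicator_of_mem (mem_compl hx), zero_add, h1]
  have hE' : IntegrableOn (energyDensity g s w' w') (Metric.ball 0 ρ ×ˢ Metric.ball 0 ρ)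
      (pairVolume n) := by
    refine IntegrableOn.congr_fun_ae (hEw.mono_set ?_)
      (ae_restrict_of_ae (energyDensity_congr_ae hae.symm))
    exact prod_mono (Metric.ball_subset_ball hρR) (Metric.ball_subset_ball hρR)
  have hw0' : ∀ x ∈ Metric.ball (0 : Rn n) ρ, 0 ≤ w' x := fun x hx => by
    rw [hin x hx]
    exact le_min (le_max_right _ _) (le_max_right _ _)
  have hA : 0 < ε * H := by positivity
  have hφz : ∀ x ∉ Metric.ball (0 : Rn n) R, excess (ε * H) ρ w' x = 0 := fun x hx =>
    excess_eq_zero hρ hw0' fun hx' => hx (Metric.ball_subset_ball (by linarith) hx')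
  have := h hg (K := K) (N := N') hρ hH hm' hw0'
    (fun x hx => by
      rw [hin x hx]
      exact min_le_right _ _) hE' ?_ ?_ ?_ hK ?_
  · filter_upwards [this, hae] with x h1 h2 hx
    rw [← h2]
    linarith [h1 hx]
  · refine hT.congr_fun_ae (ae_restrict_of_ae ?_)
    filter_upwards [hae] with x hx
    rw [hx]
  · refine hP.trans_eq (measureReal_congr ?_)
    filter_upwards [hae] with x hx
    exact propext (and_congr_left fun _ => by
      change H ≤ w x ↔ H ≤ w' x
      rw [hx])
  · refine le_of_eq_of_le (integral_congr_ae (ae_restrict_of_ae ?_)) htail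
    filter_upwards [hae] with x hx
    rw [hx]
  · have hmem : MemW0 g s (Metric.ball 0 R) (excess (ε * H) ρ w') :=
      memW0_of_integrable hg measurableSet_ball measure_ball_lt_top (measurable_excess hm')
        excess_nonneg (excess_le hA hw0') hφz
        (integrable_energyDensity_self hg hn hs hs1 hρ (measurable_excess hm') excess_nonneg
          (excess_le hA hw0') (fun x hx => excess_eq_zero hρ hw0' hx)
          (integrable_excess hA hm' hw0')
          (integrableOn_energyDensity_excess hg hn hs1 hρ hA hm' hE'))
    have h1 := hsuper _ hmem excess_nonneg
    rwa [setIntegral_eq_integral_of_forall_compl_eq_zero hφz, ← energyForm_congr_ae hae] at h1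

end GrowthLemma

/-! ### Control of the data at all scales -/

section Iteration

variable {n : ℕ} {lam Lam s : ℝ} {g : ℝ → ℝ}

/-- The function `u` has finite energy in `B_R`, and the number `L` controls its size in `B_R`, its
tail, and its fractional `g`-Laplacian at the scale of `B_R`. -/
structure IsControlled (g : ℝ → ℝ) (s R L : ℝ) (u : Rn n → ℝ) : Prop where
  aemeasurable : AEMeasurable u
  bound : ∀ᵐ x, x ∈ Metric.ball (0 : Rn n) R → |u x| ≤ L
  energy : IntegrableOn (energyDensity g s u u) (Metric.ball 0 R ×ˢ Metric.ball 0 R)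
    (pairVolume n)
  tail_integrable :
    IntegrableOn (fun y => g (|u y| / ‖y‖ ^ s) * ‖y‖ ^ (-s - n)) (Metric.ball 0 R)ᶜ
  tail_le : ∫ y in (Metric.ball 0 R)ᶜ, g (|u y| / ‖y‖ ^ s) * ‖y‖ ^ (-s - n) ≤
    (sphereArea n / s + 1) * (g (L / R ^ s) * R ^ (-s))
  abs_energyForm_le : ∀ φ : Rn n → ℝ, MemW0 g s (Metric.ball 0 R) φ → (∀ x, 0 ≤ φ x) →
    |energyForm g s u φ| ≤ g (L / R ^ s) * ∫ x in Metric.ball 0 R, φ x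

lemma energyForm_sub_const (u : Rn n → ℝ) (m : ℝ) (φ : Rn n → ℝ) :
    energyForm g s (fun x => u x - m) φ = energyForm g s u φ := by
  simp only [energyForm, holderQuot, sub_sub_sub_cancel_right]

lemma energyForm_const_sub (hg : IsAdmissible lam Lam g) (u : Rn n → ℝ) (m : ℝ) (φ : Rn n → ℝ) :
    energyForm g s (fun x => m - u x) φ = -energyForm g s u φ := by
  rw [energyForm, energyForm, ← integral_neg]
  congr 1
  ext p
  have : holderQuot s (fun x => m - u x) p = -holderQuot s u p := by
    simp only [holderQuot, sub_sub_sub_cancel_left]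
    rw [← neg_div, neg_sub]
  rw [this, hg.odd, neg_mul]

lemma energyDensity_sub_const (u : Rn n → ℝ) (m : ℝ) :
    energyDensity g s (fun x => u x - m) (fun x => u x - m) = energyDensity g s u u := by
  ext p
  simp only [energyDensity, holderQuot, sub_sub_sub_cancel_right]

lemma energyDensity_const_sub (hg : IsAdmissible lam Lam g) (u : Rn n → ℝ) (m : ℝ) :
    energyDensity g s (fun x => m - u x) (fun x => m - u x) = energyDensity g s u u := by
  ext p
  have : holderQuot s (fun x => m - u x) p = -holderQuot s u p := by
    simp only [holderQuot, sub_sub_sub_cancel_left]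
    rw [← neg_div, neg_sub]
  rw [energyDensity, this, hg.odd, neg_mul_neg, energyDensity]

lemma aestronglyMeasurable_tail (hg : IsAdmissible lam Lam g) {f : Rn n → ℝ}
    (hf : AEMeasurable f) (A : Set (Rn n)) :
    AEStronglyMeasurable (fun y => g (f y / ‖y‖ ^ s) * ‖y‖ ^ (-s - n)) (volume.restrict A) := by
  have h1 : AEMeasurable fun y => g (f y / ‖y‖ ^ s) :=
    hg.continuous.measurable.comp_aemeasurable (hf.div (by fun_prop))
  exact ((h1.mul (by fun_prop)).restrict).aestronglyMeasurable

lemma IsControlled.integrableOn_tail (hg : IsAdmissible lam Lam g) (hn : 1 ≤ n) (hs : 0 < s)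
    {R L ρ c : ℝ} {u w : Rn n → ℝ} (hu : IsControlled g s R L u) (hL : 0 ≤ L) (hρ : 0 < ρ)
    (hw : AEMeasurable w) (hc : 0 ≤ c) (hwu : ∀ x, |w x| ≤ c + |u x|) :
    IntegrableOn (fun y => g (|w y| / ‖y‖ ^ s) * ‖y‖ ^ (-s - n)) (Metric.ball 0 ρ)ᶜ := by
  have hum := hu.aemeasurable
  have h1 : IntegrableOn (fun y => g (|u y| / ‖y‖ ^ s) * ‖y‖ ^ (-s - n))
      (Metric.ball 0 R \ Metric.ball 0 ρ) := by
    refine ((integrableOn_apply_const hg hn hs hρ hL).mono_set (sdiff_subset_compl _ _)).mono'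
      (aestronglyMeasurable_tail hg (by fun_prop) _) ?_
    filter_upwards [ae_restrict_of_ae hu.bound,
      ae_restrict_mem (measurableSet_ball.diff measurableSet_ball)] with y hy hy2
    have h0 := hg.nonneg (t := |u y| / ‖y‖ ^ s) (by positivity)
    rw [Real.norm_eq_abs, abs_of_nonneg (by positivity)]
    gcongr
    refine hg.monotone ?_
    gcongr
    exact hy hy2.1
  have h2 : IntegrableOn (fun y => g (|u y| / ‖y‖ ^ s) * ‖y‖ ^ (-s - n)) (Metric.ball 0 ρ)ᶜ := by
    refine (h1.union hu.tail_integrable).mono_set fun y hy => ?_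
    by_cases h : y ∈ Metric.ball (0 : Rn n) R
    · exact Or.inl ⟨h, hy⟩
    · exact Or.inr h
  refine ((integrableOn_apply_const hg hn hs hρ (N := 4 * c) (by positivity)).add
    (h2.const_mul (4 ^ Lam))).mono' (aestronglyMeasurable_tail hg (by fun_prop) _)
    (Eventually.of_forall fun y => ?_)
  have h0 := hg.nonneg (t := |w y| / ‖y‖ ^ s) (by positivity)
  rw [Real.norm_eq_abs, abs_of_nonneg (by positivity)]
  have h3 := apply_far_le hg hc (abs_nonneg (u y)) (by positivity : 0 ≤ ‖y‖ ^ s)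
  have h4 : g (|w y| / ‖y‖ ^ s) ≤ g (2 * (c + |u y|) / ‖y‖ ^ s) := by
    refine hg.monotone ?_
    gcongr
    linarith [hwu y, abs_nonneg (w y)]
  calc g (|w y| / ‖y‖ ^ s) * ‖y‖ ^ (-s - n)
      ≤ (g (4 * c / ‖y‖ ^ s) + 4 ^ Lam * g (|u y| / ‖y‖ ^ s)) * ‖y‖ ^ (-s - n) := by
        gcongr
        exact h4.trans h3
    _ = _ := by
      simp only [Pi.add_apply]
      ring

lemma rpow_sub_one_le {a x : ℝ} (hs : 0 < s) (ha : 0 < a) (has : a ≤ s) (hx : 1 ≤ x) :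
    x ^ a - 1 ≤ a / s * x ^ s := by
  have hx0 : 0 < x := by linarith
  have h1 : x ^ a = (1 + (x ^ s - 1)) ^ (a / s) := by
    rw [add_sub_cancel, ← Real.rpow_mul hx0.le, mul_div_cancel₀ _ hs.ne']
  have h2 : 1 ≤ x ^ s := Real.one_le_rpow hx hs.le
  have h3 := rpow_one_add_le_one_add_mul_self (s := x ^ s - 1) (p := a / s) (by linarith)
    (by positivity) ((div_le_one hs).mpr has)
  rw [← h1] at h3
  have : 0 < a / s := by positivity
  linarith

/-- The part of the tail inside `B_R` is small if the exponent `α` is. -/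
lemma tail_inner_le (hg : IsAdmissible lam Lam g) (hn : 1 ≤ n) (hs : 0 < s) (hs1 : s < 1)
    {α ρ R h : ℝ} (hα : 0 < α) (hα4 : 4 * α / s ≤ 1) (hρ : 0 < ρ) (hh : 0 < h) {w : Rn n → ℝ}
    (hw : ∀ᵐ x, x ∈ Metric.ball (0 : Rn n) R → x ∉ Metric.ball (0 : Rn n) ρ →
      -w x ≤ h * ((4 * ‖x‖ / ρ) ^ α - 1))
    (hi : IntegrableOn (fun y => g (max (-w y) 0 / ‖y‖ ^ s) * ‖y‖ ^ (-s - n))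
      (Metric.ball 0 ρ)ᶜ) :
    ∫ y in Metric.ball 0 R \ Metric.ball 0 ρ, g (max (-w y) 0 / ‖y‖ ^ s) * ‖y‖ ^ (-s - n) ≤
      4 * α / s * (sphereArea n / s) * (g (h / ρ ^ s) * ρ ^ (-s)) := by
  have hc := (integrableOn_compl_ball (n := n) hn hs hρ).const_mul (4 * α / s * g (h / ρ ^ s))
  have hG : 0 ≤ g (h / ρ ^ s) := hg.nonneg (by positivity)
  have has : α ≤ s := by
    rw [div_le_one hs] at hα4
    linarith
  calc ∫ y in Metric.ball 0 R \ Metric.ball 0 ρ, g (max (-w y) 0 / ‖y‖ ^ s) * ‖y‖ ^ (-s - n)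
      ≤ ∫ y in Metric.ball (0 : Rn n) R \ Metric.ball 0 ρ,
          4 * α / s * g (h / ρ ^ s) * ‖y‖ ^ (-s - n) := by
        refine setIntegral_mono_on_ae (hi.mono_set (sdiff_subset_compl _ _))
          (IntegrableOn.mono_set hc (sdiff_subset_compl _ _))
          (measurableSet_ball.diff measurableSet_ball) ?_
        filter_upwards [hw] with y hy hyA
        have hρy : ρ ≤ ‖y‖ := by simpa using hyA.2
        have hy0 : 0 < ‖y‖ := hρ.trans_le hρy
        have h1 := hy hyA.1 hyA.2
        have ht : 1 ≤ 4 * ‖y‖ / ρ := by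
          rw [le_div_iff₀ hρ]
          linarith
        have h2 := rpow_sub_one_le hs hα has ht
        have h3 : (4 * ‖y‖ / ρ) ^ s ≤ 4 * (‖y‖ ^ s / ρ ^ s) := by
          rw [mul_div_assoc, Real.mul_rpow (by norm_num) (by positivity),
            Real.div_rpow hy0.le hρ.le]
          gcongr
          calc (4 : ℝ) ^ s ≤ 4 ^ (1 : ℝ) := by gcongr; norm_num
            _ = 4 := Real.rpow_one 4
        have h4 : max (-w y) 0 ≤ h * (α / s * (4 * (‖y‖ ^ s / ρ ^ s))) := by
          refine max_le (h1.trans ?_) (by positivity)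
          gcongr
          exact h2.trans (by gcongr)
        have h5 : g (max (-w y) 0 / ‖y‖ ^ s) ≤ 4 * α / s * g (h / ρ ^ s) := by
          refine le_trans (hg.monotone ?_)
            (hg.apply_mul_le (z := 4 * α / s) (t := h / ρ ^ s) (by positivity) hα4 (by positivity))
          rw [div_le_iff₀ (by positivity)]
          refine h4.trans_eq ?_
          field_simp
        gcongr
    _ ≤ ∫ y in (Metric.ball (0 : Rn n) ρ)ᶜ, 4 * α / s * g (h / ρ ^ s) * ‖y‖ ^ (-s - n) := by
        refine setIntegral_mono_set hc (Eventually.of_forall fun y => ?_)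
          (sdiff_subset_compl _ _).eventuallyLE
        simp only [Pi.zero_apply]
        positivity
    _ = _ := by
        rw [integral_const_mul, setIntegral_compl_ball hn hs hρ]
        ring

/-- The part of the tail outside `B_R`. -/
lemma tail_outer_le (hg : IsAdmissible lam Lam g) (hn : 1 ≤ n) (hs : 0 < s)
    {R L : ℝ} (hR : 0 < R) (hL : 0 < L) {u w : Rn n → ℝ} (hu : IsControlled g s R L u)
    (hw : ∀ x, -w x ≤ L + |u x|)
    (hi : IntegrableOn (fun y => g (max (-w y) 0 / ‖y‖ ^ s) * ‖y‖ ^ (-s - n))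
      (Metric.ball 0 R)ᶜ) :
    ∫ y in (Metric.ball 0 R)ᶜ, g (max (-w y) 0 / ‖y‖ ^ s) * ‖y‖ ^ (-s - n) ≤
      4 ^ Lam * (2 * (sphereArea n / s) + 1) * (g (L / R ^ s) * R ^ (-s)) := by
  have hc := integrableOn_apply_const (n := n) hg hn hs hR (N := L) hL.le
  have hc2 := integral_apply_const_le (n := n) hg hn hs hR (N := L) hL.le
  have hG : 0 ≤ g (L / R ^ s) := hg.nonneg (by positivity)
  calc ∫ y in (Metric.ball 0 R)ᶜ, g (max (-w y) 0 / ‖y‖ ^ s) * ‖y‖ ^ (-s - n)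
      ≤ ∫ y in (Metric.ball (0 : Rn n) R)ᶜ, 4 ^ Lam * (g (L / ‖y‖ ^ s) * ‖y‖ ^ (-s - n) +
          g (|u y| / ‖y‖ ^ s) * ‖y‖ ^ (-s - n)) := by
        refine setIntegral_mono_on hi ((hc.add hu.tail_integrable).const_mul _)
          measurableSet_ball.compl fun y hy => ?_
        have h0 := abs_nonneg (u y)
        have hd : 0 ≤ ‖y‖ ^ s := by positivity
        have h1 := hg.apply_add_le (a := L / ‖y‖ ^ s) (b := |u y| / ‖y‖ ^ s) (by positivity)
          (by positivity)
        have h2 : g (max (-w y) 0 / ‖y‖ ^ s) ≤ g (L / ‖y‖ ^ s + |u y| / ‖y‖ ^ s) := by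
          refine hg.monotone ?_
          rw [← add_div]
          gcongr
          exact max_le (hw y) (by positivity)
        have h3 : ∀ t : ℝ, 0 ≤ t → g (2 * t) ≤ 4 ^ Lam * g t := fun t ht => by
          refine (hg.monotone (by linarith)).trans
            (hg.apply_mul_le_rpow (b := 4) (by norm_num) ht)
        have h4 := h3 (L / ‖y‖ ^ s) (by positivity)
        have h5 := h3 (|u y| / ‖y‖ ^ s) (by positivity)
        rw [← add_mul, ← mul_assoc]
        gcongr
        linarith
    _ = 4 ^ Lam * ((∫ y in (Metric.ball (0 : Rn n) R)ᶜ, g (L / ‖y‖ ^ s) * ‖y‖ ^ (-s - n)) +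
          ∫ y in (Metric.ball (0 : Rn n) R)ᶜ, g (|u y| / ‖y‖ ^ s) * ‖y‖ ^ (-s - n)) := by
        rw [integral_const_mul, integral_add hc hu.tail_integrable]
    _ ≤ 4 ^ Lam * (g (L / R ^ s) * (sphereArea n / s * R ^ (-s)) +
          (sphereArea n / s + 1) * (g (L / R ^ s) * R ^ (-s))) := by
        gcongr
        exact hu.tail_le
    _ = _ := by ring

/-- The constants of the iteration: `θ` and `κ` come from the growth lemma, the exponent `α` makes
the inner tail small, and the factor `C` between the initial oscillation and the size of the data
makes the outer tail and the right-hand side small. -/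
structure IsIterationConst (n : ℕ) (s Lam θ κ α C : ℝ) : Prop where
  α_pos : 0 < α
  α_le : 4 * α / s ≤ 1
  inner : 2 ^ Lam * (4 * α / s * (sphereArea n / s)) ≤ κ / 2
  decay : 1 - θ / 2 ≤ 4 ^ (-α)
  two_le : 2 ≤ C
  outer : 2 ^ Lam * (4 ^ Lam * (2 * (sphereArea n / s) + 1)) ≤ κ / 2 * C

lemma exists_isIterationConst {θ κ : ℝ} (hθ : 0 < θ) (hκ : 0 < κ) :
    ∃ α C : ℝ, IsIterationConst n s Lam θ κ α C := by
  have h1 : Tendsto (fun α : ℝ => 4 * α / s) (𝓝[>] 0) (𝓝 0) := by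
    have : Continuous fun α : ℝ => 4 * α / s := by fun_prop
    simpa using (this.tendsto 0).mono_left nhdsWithin_le_nhds
  have h2 : Tendsto (fun α : ℝ => 2 ^ Lam * (4 * α / s * (sphereArea n / s))) (𝓝[>] 0) (𝓝 0) := by
    have : Continuous fun α : ℝ => 2 ^ Lam * (4 * α / s * (sphereArea n / s)) := by fun_prop
    simpa using (this.tendsto 0).mono_left nhdsWithin_le_nhds
  have h3 : Tendsto (fun α : ℝ => (4 : ℝ) ^ (-α)) (𝓝[>] 0) (𝓝 1) := by
    have : Continuous fun α : ℝ => (4 : ℝ) ^ (-α) :=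
      Real.continuous_const_rpow (by norm_num) |>.comp continuous_neg
    simpa using (this.tendsto 0).mono_left nhdsWithin_le_nhds
  obtain ⟨α, ⟨⟨ha1, ha2⟩, ha3⟩, ha0⟩ := (((h1.eventually_le_const one_pos).and
    (h2.eventually_le_const (half_pos hκ))).and
    (h3.eventually_const_le (show 1 - θ / 2 < 1 by linarith))).and self_mem_nhdsWithin |>.exists
  refine ⟨α, max 2 (2 ^ Lam * (4 ^ Lam * (2 * (sphereArea n / s) + 1)) / (κ / 2)), ha0, ha1, ha2,
    ha3, le_max_left _ _, ?_⟩
  have := le_max_right 2 (2 ^ Lam * (4 ^ Lam * (2 * (sphereArea n / s) + 1)) / (κ / 2))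
  rwa [div_le_iff₀ (by positivity), mul_comm _ (κ / 2)] at this

/-- The smallness of the tail and of the right-hand side that the growth lemma asks for. -/
lemma tail_total_le (hg : IsAdmissible lam Lam g) (hn : 1 ≤ n) (hs : 0 < s) (hs1 : s < 1)
    {θ κ α C : ℝ} (hcst : IsIterationConst n s Lam θ κ α C) {R L ρ h c : ℝ} (hR1 : R < 1)
    (hL : 0 < L) (hρ : 0 < ρ) (hρR : ρ ≤ R) (hh : 0 < h) (hhL : C * L / R ^ s ≤ h / ρ ^ s)
    {u w : Rn n → ℝ} (hu : IsControlled g s R L u) (hwm : AEMeasurable w) (hc : 0 ≤ c)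
    (hwu : ∀ x, |w x| ≤ c + |u x|) (hwL : ∀ x, -w x ≤ L + |u x|)
    (hw : ∀ᵐ x, x ∈ Metric.ball (0 : Rn n) R → x ∉ Metric.ball (0 : Rn n) ρ →
      -w x ≤ h * ((4 * ‖x‖ / ρ) ^ α - 1)) :
    ∫ y in (Metric.ball 0 ρ)ᶜ, g (max (-w y) 0 / ‖y‖ ^ s) * ‖y‖ ^ (-s - n) ≤
        κ * (g (h / 2 / ρ ^ s) * ρ ^ (-s)) ∧
      g (L / R ^ s) ≤ κ * (g (h / 2 / ρ ^ s) * ρ ^ (-s)) := by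
  have hR : 0 < R := hρ.trans_le hρR
  have hω := sphereArea_pos hn
  have hC := hcst.two_le
  have hα := hcst.α_pos
  have hwm' : AEMeasurable fun y => max (-w y) 0 := by fun_prop
  have hT := hu.integrableOn_tail hg hn hs hL.le hρ hwm'
    (c := c) hc fun x => by
      rw [abs_of_nonneg (le_max_right _ _)]
      exact (negPart_le_abs _).trans (hwu x)
  have hi : IntegrableOn (fun y => g (max (-w y) 0 / ‖y‖ ^ s) * ‖y‖ ^ (-s - n))
      (Metric.ball 0 ρ)ᶜ := by
    refine hT.congr_fun (fun y _ => ?_) measurableSet_ball.compl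
    simp only [abs_of_nonneg (le_max_right (-w y) 0)]
  have hsub : (Metric.ball (0 : Rn n) R)ᶜ ⊆ (Metric.ball 0 ρ)ᶜ :=
    compl_subset_compl.mpr (Metric.ball_subset_ball hρR)
  have hunion : (Metric.ball (0 : Rn n) ρ)ᶜ =
      (Metric.ball 0 R \ Metric.ball 0 ρ) ∪ (Metric.ball 0 R)ᶜ := by
    ext y
    constructor
    · intro hy
      by_cases hyR : y ∈ Metric.ball (0 : Rn n) R
      · exact Or.inl ⟨hyR, hy⟩
      · exact Or.inr hyR
    · rintro (hy | hy)
      · exact hy.2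
      · exact hsub hy
  have h1 := tail_inner_le (R := R) hg hn hs hs1 hα hcst.α_le hρ hh hw hi
  have h2 := tail_outer_le hg hn hs hR hL hu hwL (hi.mono_set hsub)
  rw [hunion, setIntegral_union (disjoint_compl_right.mono_left sdiff_subset)
    measurableSet_ball.compl (hi.mono_set (sdiff_subset_compl _ _)) (hi.mono_set hsub)]
  have hG0 : 0 ≤ g (h / 2 / ρ ^ s) := hg.nonneg (by positivity)
  have hG1 : g (h / ρ ^ s) ≤ 2 ^ Lam * g (h / 2 / ρ ^ s) := by
    rw [show h / ρ ^ s = 2 * (h / 2 / ρ ^ s) by ring]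
    exact hg.apply_mul_le_rpow one_le_two (by positivity)
  have hGL0 : 0 ≤ g (L / R ^ s) := hg.nonneg (by positivity)
  have hG2 : C * g (L / R ^ s) ≤ 2 ^ Lam * g (h / 2 / ρ ^ s) := by
    refine (hg.le_apply_mul (by linarith) (by positivity)).trans (le_trans (hg.monotone ?_) hG1)
    rwa [← mul_div_assoc]
  have hρs1 : 1 ≤ ρ ^ (-s) :=
    Real.one_le_rpow_of_pos_of_le_one_of_nonpos hρ (by linarith) (by linarith)
  have hRρ : R ^ (-s) ≤ ρ ^ (-s) := Real.rpow_le_rpow_of_nonpos hρ hρR (by linarith)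
  have hρs0 : 0 < ρ ^ (-s) := by linarith
  set D := 4 ^ Lam * (2 * (sphereArea n / s) + 1) with hD
  have hD1 : 1 ≤ D := by
    have h5 : (1 : ℝ) ≤ 4 ^ Lam := Real.one_le_rpow (by norm_num) hg.Lam_pos.le
    have h6 : 0 < sphereArea n / s := by positivity
    nlinarith
  have h3 : D * (g (L / R ^ s) * ρ ^ (-s)) ≤ κ / 2 * (g (h / 2 / ρ ^ s) * ρ ^ (-s)) := by
    rw [← mul_assoc, ← mul_assoc]
    refine mul_le_mul_of_nonneg_right ?_ hρs0.le
    refine le_of_mul_le_mul_left (a := C) ?_ (by linarith)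
    have h7 := mul_le_mul_of_nonneg_right hcst.outer hG0
    have h8 := mul_le_mul_of_nonneg_left hG2 (by linarith : 0 ≤ D)
    linarith
  have hκ : 0 ≤ κ := by
    have := hcst.inner
    have : 0 ≤ 2 ^ Lam * (4 * α / s * (sphereArea n / s)) := by positivity
    linarith
  refine ⟨?_, ?_⟩
  · have h4 : 4 * α / s * (sphereArea n / s) * (g (h / ρ ^ s) * ρ ^ (-s)) ≤
        κ / 2 * (g (h / 2 / ρ ^ s) * ρ ^ (-s)) := by
      calc 4 * α / s * (sphereArea n / s) * (g (h / ρ ^ s) * ρ ^ (-s))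
          ≤ 4 * α / s * (sphereArea n / s) * (2 ^ Lam * g (h / 2 / ρ ^ s) * ρ ^ (-s)) := by gcongr
        _ = 2 ^ Lam * (4 * α / s * (sphereArea n / s)) * (g (h / 2 / ρ ^ s) * ρ ^ (-s)) := by ring
        _ ≤ _ := by
            have := hcst.inner
            gcongr
    have h5 : D * (g (L / R ^ s) * R ^ (-s)) ≤ D * (g (L / R ^ s) * ρ ^ (-s)) := by gcongr
    linarith
  · have h6 : 0 ≤ κ / 2 * (g (h / 2 / ρ ^ s) * ρ ^ (-s)) := by positivity
    have h7 : 0 ≤ g (L / R ^ s) * ρ ^ (-s) := by positivity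
    nlinarith

/-- Bounds for `u` at the scale `ρ`: in `B_ρ` the values lie in `[m, m + h]`, and in the rest of
`B_R` their distance from this interval grows at most as a power of exponent `α`. -/
structure IsTrapped (u : Rn n → ℝ) (R α ρ m h : ℝ) : Prop where
  inside : ∀ᵐ x, x ∈ Metric.ball (0 : Rn n) ρ → m ≤ u x ∧ u x ≤ m + h
  outside : ∀ᵐ x, x ∈ Metric.ball (0 : Rn n) R → x ∉ Metric.ball (0 : Rn n) ρ →
    m - u x ≤ h * ((4 * ‖x‖ / ρ) ^ α - 1) ∧ u x - (m + h) ≤ h * ((4 * ‖x‖ / ρ) ^ α - 1)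

/-- The bounds pass to the next scale `ρ / 4`: the power of `4` that `h` loses is the one that the
growth `(4 * |x| / ρ) ^ α` gains. -/
lemma IsTrapped.next {u : Rn n → ℝ} {R α ρ m h m' : ℝ} (hu : IsTrapped u R α ρ m h) (hα : 0 < α)
    (hρ : 0 < ρ) (hh : 0 < h) (hm : m ≤ m') (hm' : m' + 4 ^ (-α) * h ≤ m + h)
    (hin : ∀ᵐ x, x ∈ Metric.ball (0 : Rn n) (ρ / 4) →
      m' ≤ u x ∧ u x ≤ m' + 4 ^ (-α) * h) :
    IsTrapped u R α (ρ / 4) m' (4 ^ (-α) * h) := by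
  refine ⟨hin, ?_⟩
  filter_upwards [hu.inside, hu.outside] with x h1 h2 hxR hx
  have hρx : ρ / 4 ≤ ‖x‖ := by simpa using hx
  have hq : (4 : ℝ) ^ (-α) * 4 ^ α = 1 := by
    rw [← Real.rpow_add (by norm_num), neg_add_cancel, Real.rpow_zero]
  have e1 : (4 * ‖x‖ / (ρ / 4)) ^ α = 4 ^ α * (4 * ‖x‖ / ρ) ^ α := by
    rw [← Real.mul_rpow (by norm_num) (by positivity)]
    congr 1
    field_simp
  have e2 : 4 ^ (-α) * h * ((4 * ‖x‖ / (ρ / 4)) ^ α - 1) =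
      h * (4 * ‖x‖ / ρ) ^ α - 4 ^ (-α) * h := by
    rw [e1]
    linear_combination (h * (4 * ‖x‖ / ρ) ^ α) * hq
  have e3 : 1 ≤ (4 * ‖x‖ / ρ) ^ α := by
    refine Real.one_le_rpow ?_ hα.le
    rw [le_div_iff₀ hρ]
    linarith
  rw [e2]
  by_cases hxρ : x ∈ Metric.ball (0 : Rn n) ρ
  · have h3 := h1 hxρ
    constructor <;> nlinarith
  · have h3 := h2 hxR hxρ
    constructor <;> nlinarith

end Iteration

/-! ### Decay of the oscillation -/

section Decay

variable {n : ℕ} {lam Lam s : ℝ} {g : ℝ → ℝ}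

lemma exists_mem_ball_of_ae {p : Rn n → Prop} {ρ : ℝ} (hρ : 0 < ρ)
    (h : ∀ᵐ x, x ∈ Metric.ball (0 : Rn n) ρ → p x) : ∃ x ∈ Metric.ball (0 : Rn n) ρ, p x := by
  by_contra! hcon
  have h1 : volume (Metric.ball (0 : Rn n) ρ) = 0 := by
    refine measure_mono_null (fun x hx => ?_) h
    exact fun h2 => hcon x hx (h2 hx)
  exact (Metric.measure_ball_pos volume (0 : Rn n) hρ).ne' h1

/-- The growth property applied to `w = u - m` or `w = M - u`. -/
lemma IsControlled.growth (hg : IsAdmissible lam Lam g) (hn : 1 ≤ n) (hs : 0 < s) (hs1 : s < 1)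
    {θ κ α C : ℝ} (hgr : HasGrowth n s Lam θ κ) (hcst : IsIterationConst n s Lam θ κ α C)
    {R L ρ h c : ℝ} (hR1 : R < 1) (hL : 0 < L) (hρ : 0 < ρ) (hρR : ρ ≤ R) (hh : 0 < h)
    (hhL : C * L / R ^ s ≤ h / ρ ^ s) {u w : Rn n → ℝ} (hu : IsControlled g s R L u)
    (hwm : AEMeasurable w) (hc : 0 ≤ c) (hwu : ∀ x, |w x| ≤ c + |u x|)
    (hwL : ∀ x, -w x ≤ L + |u x|)
    (hin : ∀ᵐ x, x ∈ Metric.ball (0 : Rn n) ρ → 0 ≤ w x ∧ w x ≤ h)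
    (hout : ∀ᵐ x, x ∈ Metric.ball (0 : Rn n) R → x ∉ Metric.ball (0 : Rn n) ρ →
      -w x ≤ h * ((4 * ‖x‖ / ρ) ^ α - 1))
    (hE : energyDensity g s w w = energyDensity g s u u)
    (hEF : ∀ φ, |energyForm g s w φ| = |energyForm g s u φ|)
    (hP : ρ ^ n * volume.real (Metric.ball (0 : Rn n) 1) / 4 ≤
      volume.real (largeSet w ρ (h / 2))) :
    ∀ᵐ x, x ∈ Metric.ball (0 : Rn n) (ρ / 4) → θ * (h / 2) ≤ w x := by
  obtain ⟨h1, h2⟩ := tail_total_le hg hn hs hs1 hcst hR1 hL hρ hρR hh hhL hu hwm hc hwu hwL hout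
  refine hgr hg (N := h) (K := g (L / R ^ s)) hρ hρR (half_pos hh) hwm ?_ ?_ ?_ ?_ hP h1 h2 ?_
  · filter_upwards [hin] with x hx hxρ using (hx hxρ).1
  · filter_upwards [hin] with x hx hxρ using (hx hxρ).2
  · rw [hE]
    exact hu.energy
  · exact hu.integrableOn_tail hg hn hs hL.le hρ hwm hc hwu
  · intro φ hφ hφ0
    have h3 := hu.abs_energyForm_le φ hφ hφ0
    rw [← hEF] at h3
    exact (abs_le.mp h3).1

/-- One of `{u ≥ m + h/2}` and `{u ≤ m + h/2}` fills half of the annulus. -/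
lemma largeSet_or (hn : 1 ≤ n) {ρ : ℝ} (hρ : 0 < ρ) (u : Rn n → ℝ) (m h : ℝ) :
    ρ ^ n * volume.real (Metric.ball (0 : Rn n) 1) / 4 ≤
        volume.real (largeSet (fun x => u x - m) ρ (h / 2)) ∨
      ρ ^ n * volume.real (Metric.ball (0 : Rn n) 1) / 4 ≤
        volume.real (largeSet (fun x => m + h - u x) ρ (h / 2)) := by
  by_contra! hcon
  have h1 := annulus_volume_ge hn hρ
  have h2 : Metric.ball (0 : Rn n) ρ \ Metric.ball 0 (ρ / 2) ⊆
      largeSet (fun x => u x - m) ρ (h / 2) ∪ largeSet (fun x => m + h - u x) ρ (h / 2) := by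
    intro y hy
    rcases le_total (h / 2) (u y - m) with h3 | h3
    · exact Or.inl ⟨h3, hy⟩
    · refine Or.inr ⟨?_, hy⟩
      change h / 2 ≤ m + h - u y
      linarith
  have hfin : volume (largeSet (fun x => u x - m) ρ (h / 2) ∪
      largeSet (fun x => m + h - u x) ρ (h / 2)) ≠ ∞ :=
    ((measure_mono (union_subset largeSet_subset largeSet_subset)).trans_lt
      measure_ball_lt_top).ne
  have h3 := measureReal_mono h2 hfin
  have h4 := measureReal_union_le (μ := volume) (largeSet (fun x => u x - m) ρ (h / 2))
    (largeSet (fun x => m + h - u x) ρ (h / 2))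
  linarith [hcon.1, hcon.2]

lemma IsControlled.trapped_step (hg : IsAdmissible lam Lam g) (hn : 1 ≤ n) (hs : 0 < s)
    (hs1 : s < 1) {θ κ α C : ℝ} (hgr : HasGrowth n s Lam θ κ)
    (hcst : IsIterationConst n s Lam θ κ α C)
    {R L ρ m h : ℝ} (hR1 : R < 1) (hL : 0 < L) (hρ : 0 < ρ) (hρR : ρ ≤ R) (hh : 0 < h)
    (hhL : C * L / R ^ s ≤ h / ρ ^ s) {u : Rn n → ℝ} (hu : IsControlled g s R L u)
    (ht : IsTrapped u R α ρ m h) :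
    ∃ m', IsTrapped u R α (ρ / 4) m' (4 ^ (-α) * h) := by
  have hum := hu.aemeasurable
  have hpt : ∀ᵐ x, x ∈ Metric.ball (0 : Rn n) ρ → (m ≤ u x ∧ u x ≤ m + h) ∧ |u x| ≤ L := by
    filter_upwards [ht.inside, hu.bound] with x h1 h2 hx
    exact ⟨h1 hx, h2 (Metric.ball_subset_ball hρR hx)⟩
  obtain ⟨x₀, -, ⟨hx1, hx2⟩, hx3⟩ := exists_mem_ball_of_ae hρ hpt
  have hx4 := abs_le.mp hx3
  have hq : (4 : ℝ) ^ (-α) ≤ 1 :=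
    Real.rpow_le_one_of_one_le_of_nonpos (by norm_num) (by linarith [hcst.α_pos])
  have hqh : 4 ^ (-α) * h ≤ h := by nlinarith
  have hdec : h - θ * (h / 2) ≤ 4 ^ (-α) * h := by nlinarith [hcst.decay]
  have hinner : ∀ᵐ x, x ∈ Metric.ball (0 : Rn n) (ρ / 4) → m ≤ u x ∧ u x ≤ m + h := by
    filter_upwards [ht.inside] with x hx hxb
    exact hx (Metric.ball_subset_ball (by linarith) hxb)
  rcases largeSet_or hn hρ u m h with hP | hP
  · refine ⟨m + h - 4 ^ (-α) * h, ht.next hcst.α_pos hρ hh (by linarith) (by linarith) ?_⟩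
    have h1 := hu.growth hg hn hs hs1 hgr hcst hR1 hL hρ hρR hh hhL (w := fun x => u x - m)
      (by fun_prop) (abs_nonneg m) (fun x => by linarith [abs_sub (u x) m])
      (fun x => by linarith [neg_abs_le (u x)]) ?_ ?_ (energyDensity_sub_const u m)
      (fun φ => by rw [energyForm_sub_const]) hP
    · filter_upwards [h1, hinner] with x h2 h3 hx
      have h4 := h2 hx
      have h5 := h3 hx
      constructor <;> linarith
    · filter_upwards [ht.inside] with x hx hxb
      have := hx hxb
      constructor <;> linarith
    · filter_upwards [ht.outside] with x hx hxR hxb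
      have := (hx hxR hxb).1
      linarith
  · refine ⟨m, ht.next hcst.α_pos hρ hh le_rfl (by linarith) ?_⟩
    have h1 := hu.growth hg hn hs hs1 hgr hcst hR1 hL hρ hρR hh hhL (w := fun x => m + h - u x)
      (by fun_prop) (abs_nonneg (m + h)) (fun x => abs_sub (m + h) (u x))
      (fun x => by linarith [le_abs_self (u x)]) ?_ ?_ (energyDensity_const_sub hg u (m + h))
      (fun φ => by rw [energyForm_const_sub hg, abs_neg]) hP
    · filter_upwards [h1, hinner] with x h2 h3 hx
      have h4 := h2 hx
      have h5 := h3 hx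
      constructor <;> linarith
    · filter_upwards [ht.inside] with x hx hxb
      have := hx hxb
      constructor <;> linarith
    · filter_upwards [ht.outside] with x hx hxR hxb
      have := (hx hxR hxb).2
      linarith

lemma IsControlled.exists_trapped (hg : IsAdmissible lam Lam g) (hn : 1 ≤ n) (hs : 0 < s)
    (hs1 : s < 1) {θ κ α C : ℝ} (hgr : HasGrowth n s Lam θ κ)
    (hcst : IsIterationConst n s Lam θ κ α C)
    {R L : ℝ} (hR : 0 < R) (hR1 : R < 1) (hL : 0 < L) {u : Rn n → ℝ}
    (hu : IsControlled g s R L u) (k : ℕ) :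
    ∃ m, IsTrapped u R α ((1 / 4) ^ k * R) m ((4 ^ (-α)) ^ k * (C * L)) := by
  have hC := hcst.two_le
  induction k with
  | zero =>
    refine ⟨-L, ?_, ?_⟩
    · filter_upwards [hu.bound] with x hx hxb
      rw [pow_zero, one_mul] at hxb
      have := abs_le.mp (hx hxb)
      rw [pow_zero, one_mul]
      constructor <;> nlinarith
    · refine Eventually.of_forall fun x hx hx' => absurd ?_ hx'
      rwa [pow_zero, one_mul]
  | succ k ih =>
    obtain ⟨m, hm⟩ := ih
    have hρR : (1 / 4) ^ k * R ≤ R :=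
      mul_le_of_le_one_left hR.le (pow_le_one₀ (by norm_num) (by norm_num))
    have hα4 : α ≤ s := by
      have := hcst.α_le
      rw [div_le_one hs] at this
      linarith [hcst.α_pos]
    have hhL : C * L / R ^ s ≤ (4 ^ (-α)) ^ k * (C * L) / ((1 / 4) ^ k * R) ^ s := by
      have h1 : (((1 : ℝ) / 4) ^ k) ^ s ≤ (4 ^ (-α)) ^ k := by
        rw [← Real.rpow_natCast, ← Real.rpow_natCast, ← Real.rpow_mul (by norm_num), mul_comm,
          Real.rpow_mul (by norm_num)]
        refine Real.rpow_le_rpow (by positivity) ?_ (Nat.cast_nonneg k)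
        rw [one_div, Real.inv_rpow (by norm_num), ← Real.rpow_neg (by norm_num)]
        exact Real.rpow_le_rpow_of_exponent_le (by norm_num) (by linarith)
      rw [Real.mul_rpow (by positivity) hR.le, div_le_div_iff₀ (by positivity) (by positivity)]
      have h2 : 0 ≤ C * L * R ^ s := by positivity
      nlinarith [mul_le_mul_of_nonneg_left h1 h2]
    obtain ⟨m', hm'⟩ := hu.trapped_step hg hn hs hs1 hgr hcst hR1 hL
      (by positivity : 0 < (1 / 4) ^ k * R) hρR (by positivity) hhL hm
    refine ⟨m', ?_⟩
    have e1 : (1 / 4) ^ (k + 1) * R = (1 / 4) ^ k * R / 4 := by ring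
    have e2 : (4 ^ (-α)) ^ (k + 1) * (C * L) = 4 ^ (-α) * ((4 ^ (-α)) ^ k * (C * L)) := by ring
    rw [e1, e2]
    exact hm'

lemma osc_le_of_ae {u : Rn n → ℝ} {r m h : ℝ} (hr : 0 < r)
    (hu : ∀ᵐ x, x ∈ Metric.ball (0 : Rn n) r → m ≤ u x ∧ u x ≤ m + h) : osc u r ≤ h := by
  set μ := (volume : Measure (Rn n)).restrict (Metric.ball 0 r) with hμ
  have hμ0 : μ ≠ 0 := by
    rw [hμ, Ne, Measure.restrict_eq_zero]
    exact (Metric.measure_ball_pos volume (0 : Rn n) hr).ne'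
  have : (ae μ).NeBot := ae_neBot.mpr hμ0
  have h1 : ∀ᵐ x ∂μ, m ≤ u x ∧ u x ≤ m + h := (ae_restrict_iff' measurableSet_ball).mpr hu
  have hlo : ∀ᵐ x ∂μ, m ≤ u x := h1.mono fun _ h => h.1
  have hup : ∀ᵐ x ∂μ, u x ≤ m + h := h1.mono fun _ h => h.2
  have hbl : IsBoundedUnder (· ≥ ·) (ae μ) u := isBoundedUnder_of_eventually_ge hlo
  have hbu : IsBoundedUnder (· ≤ ·) (ae μ) u := isBoundedUnder_of_eventually_le hup
  have h2 : essSup u μ ≤ m + h := limsup_le_of_le hbl.isCoboundedUnder_le hup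
  have h3 : m ≤ essInf u μ := le_liminf_of_le hbu.isCoboundedUnder_ge hlo
  rw [osc, ← hμ]
  linarith

lemma IsControlled.osc_le (hg : IsAdmissible lam Lam g) (hn : 1 ≤ n) (hs : 0 < s)
    (hs1 : s < 1) {θ κ α C : ℝ} (hgr : HasGrowth n s Lam θ κ)
    (hcst : IsIterationConst n s Lam θ κ α C)
    {R L : ℝ} (hR : 0 < R) (hR1 : R < 1) (hL : 0 < L) {u : Rn n → ℝ}
    (hu : IsControlled g s R L u) {r : ℝ} (hr : 0 < r) (hrR : r < R) :
    osc u r ≤ 4 ^ α * C * R ^ (-α) * r ^ α * L := by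
  obtain ⟨k, hk1, hk2⟩ := exists_nat_pow_near_of_lt_one (show 0 < r / R by positivity)
    (by rw [div_le_one hR]; exact hrR.le) (show (0 : ℝ) < 1 / 4 by norm_num) (by norm_num)
  have hC := hcst.two_le
  have hα := hcst.α_pos
  obtain ⟨m, hm⟩ := hu.exists_trapped hg hn hs hs1 hgr hcst hR hR1 hL k
  rw [div_le_iff₀ hR] at hk2
  have h1 : osc u r ≤ (4 ^ (-α)) ^ k * (C * L) := by
    refine osc_le_of_ae (m := m) hr ?_
    filter_upwards [hm.inside] with x hx hxr
    exact hx (Metric.ball_subset_ball hk2 hxr)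
  refine h1.trans ?_
  have h2 : ((4 : ℝ) ^ (-α)) ^ k ≤ 4 ^ α * (R ^ (-α) * r ^ α) := by
    have e1 : ((4 : ℝ) ^ (-α)) ^ k = ((1 / 4) ^ k) ^ α := by
      rw [← Real.rpow_natCast, ← Real.rpow_natCast, ← Real.rpow_mul (by norm_num),
        ← Real.rpow_mul (by norm_num), one_div, Real.inv_rpow (by norm_num),
        ← Real.rpow_neg (by norm_num)]
      congr 1
      ring
    have e2 : 4 ^ α * (R ^ (-α) * r ^ α) = (4 * (r / R)) ^ α := by
      rw [Real.mul_rpow (by norm_num) (by positivity), Real.div_rpow hr.le hR.le,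
        Real.rpow_neg hR.le]
      ring
    rw [e1, e2]
    refine Real.rpow_le_rpow (by positivity) ?_ hα.le
    rw [pow_succ] at hk1
    linarith
  calc (4 ^ (-α)) ^ k * (C * L) ≤ 4 ^ α * (R ^ (-α) * r ^ α) * (C * L) := by gcongr
    _ = _ := by ring

end Decay

/-! ### From the hypotheses to the controlled data -/

section Data

variable {n : ℕ} {lam Lam s : ℝ} {g : ℝ → ℝ}

lemma integrableOn_energyDensity_of_luxemburg (hg : IsAdmissible lam Lam g) {u : Rn n → ℝ}
    (hum : AEMeasurable u) {S : Set (Rn n × Rn n)} (hS : MeasurableSet S)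
    (h : luxemburg g (holderQuot s u) ((muMeasure n).restrict S) < ∞) :
    IntegrableOn (energyDensity g s u u) S (pairVolume n) := by
  simp only [luxemburg, iInf_lt_iff] at h
  obtain ⟨k, hk, hmod, -⟩ := h
  set c := 2 ^ (Lam + 1) * (max k 1) ^ (Lam + 1) with hc
  have hle : ∀ t : ℝ, g t * t ≤ c * young g (t / k) := by
    intro t
    have hy := hg.young_nonneg (t / k)
    have h1 := hg.apply_mul_self_mul_le (le_max_right k 1) (t / k)
    have h2 : g t * t ≤ g (max k 1 * (t / k)) * (max k 1 * (t / k)) := by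
      refine hg.apply_mul_self_mono ?_
      have h3 : |t| = k * |t / k| := by
        rw [abs_div, abs_of_pos hk]
        field_simp
      rw [h3, abs_mul, abs_of_pos (by positivity : 0 < max k 1)]
      gcongr
      exact le_max_left k 1
    have h4 := hg.le_young (t / k)
    refine (h2.trans h1).trans ?_
    rw [hc]
    calc max k 1 ^ (Lam + 1) * (g (t / k) * (t / k))
        ≤ max k 1 ^ (Lam + 1) * (2 ^ (Lam + 1) * young g (t / k)) := by gcongr
      _ = _ := by ring
  have hc0 : 0 ≤ c := by positivity
  have hm : AEMeasurable (fun p => g (holderQuot s u p) * holderQuot s u p) (pairVolume n) :=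
    (hg.continuous.measurable.comp_aemeasurable (aemeasurable_holderQuot hum)).mul
      (aemeasurable_holderQuot hum)
  have hi : Integrable (fun p => g (holderQuot s u p) * holderQuot s u p)
      ((muMeasure n).restrict S) := by
    refine ⟨(hm.mono_ac (Measure.absolutelyContinuous_of_le Measure.restrict_le_self |>.trans
      muMeasure_absolutelyContinuous)).aestronglyMeasurable, ?_⟩
    rw [hasFiniteIntegral_iff_ofReal (Eventually.of_forall fun p => hg.apply_mul_self_nonneg _)]
    calc ∫⁻ p in S, ENNReal.ofReal (g (holderQuot s u p) * holderQuot s u p) ∂muMeasure n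
        ≤ ∫⁻ p in S, ENNReal.ofReal c * ENNReal.ofReal (young g (holderQuot s u p / k))
            ∂muMeasure n := by
          refine lintegral_mono fun p => ?_
          rw [← ENNReal.ofReal_mul hc0]
          exact ENNReal.ofReal_le_ofReal (hle _)
      _ = ENNReal.ofReal c * modular g (fun p => holderQuot s u p / k)
            ((muMeasure n).restrict S) := lintegral_const_mul' _ _ ENNReal.ofReal_ne_top
      _ < ∞ := ENNReal.mul_lt_top ENNReal.ofReal_lt_top (hmod.trans_lt ENNReal.one_lt_top)
  rw [muMeasure, restrict_withDensity hS, integrable_withDensity_iff measurable_muDensity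
    (by simp)] at hi
  refine hi.congr (Eventually.of_forall fun p => ?_)
  simp only
  rw [ENNReal.toReal_ofReal (by positivity), energyDensity]

/-- The tail of exponent `Lam + 1` controls the nonlinear tail: where `|u| / |y|^s` is large,
`g` is bounded by the power `Lam`. -/
lemma tail_controls (hg : IsAdmissible lam Lam g) (hn : 1 ≤ n) (hs : 0 < s) {R L : ℝ}
    (hR : 0 < R) (hL : 0 < L) {u : Rn n → ℝ} (hum : AEMeasurable u)
    (ht : tail s (Lam + 1) u R ≤ ENNReal.ofReal L) :
    IntegrableOn (fun y => g (|u y| / ‖y‖ ^ s) * ‖y‖ ^ (-s - n)) (Metric.ball 0 R)ᶜ ∧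
      ∫ y in (Metric.ball 0 R)ᶜ, g (|u y| / ‖y‖ ^ s) * ‖y‖ ^ (-s - n) ≤
        (sphereArea n / s + 1) * (g (L / R ^ s) * R ^ (-s)) := by
  have hΛ := hg.Lam_pos
  set F : Rn n → ℝ := fun y => |u y| ^ Lam / ‖y‖ ^ (n + s * (Lam + 1)) with hF
  have hF0 : ∀ y, 0 ≤ F y := fun y => by positivity
  set M := L ^ Lam * R ^ (-(s * (Lam + 1))) with hM
  have hFle : ∫⁻ y in (Metric.ball (0 : Rn n) R)ᶜ, ENNReal.ofReal (F y) ≤ ENNReal.ofReal M := by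
    rw [tail, add_sub_cancel_right, one_div, ENNReal.rpow_inv_le_iff hΛ,
      ENNReal.ofReal_rpow_of_pos hL] at ht
    have hRp : 0 < R ^ (s * (Lam + 1)) := by positivity
    have h1 : ENNReal.ofReal (R ^ (s * (Lam + 1))) * ENNReal.ofReal M =
        ENNReal.ofReal (L ^ Lam) := by
      rw [← ENNReal.ofReal_mul hRp.le, hM, Real.rpow_neg hR.le]
      congr 1
      field_simp
    rw [← h1] at ht
    exact (ENNReal.mul_le_mul_iff_right (by simpa using hRp) ENNReal.ofReal_ne_top).mp ht
  have hFm : AEMeasurable F (volume.restrict (Metric.ball (0 : Rn n) R)ᶜ) := by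
    have h1 : AEMeasurable F := by fun_prop
    exact h1.restrict
  have hFi : IntegrableOn F (Metric.ball 0 R)ᶜ := by
    refine ⟨hFm.aestronglyMeasurable, ?_⟩
    rw [hasFiniteIntegral_iff_ofReal (Eventually.of_forall hF0)]
    exact hFle.trans_lt ENNReal.ofReal_lt_top
  have hFint : ∫ y in (Metric.ball (0 : Rn n) R)ᶜ, F y ≤ M := by
    rw [integral_eq_lintegral_of_nonneg_ae (Eventually.of_forall hF0) hFm.aestronglyMeasurable]
    exact ENNReal.toReal_le_of_le_ofReal (by positivity) hFle
  set a := L / R ^ s with ha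
  have ha0 : 0 < a := by positivity
  have hga : 0 ≤ g a := hg.nonneg ha0.le
  have hpt : ∀ y ∈ (Metric.ball (0 : Rn n) R)ᶜ, g (|u y| / ‖y‖ ^ s) * ‖y‖ ^ (-s - n) ≤
      g a * ‖y‖ ^ (-s - n) + g a * a ^ (-Lam) * F y := by
    intro y hy
    have hRy : R ≤ ‖y‖ := by simpa using hy
    have hy0 : 0 < ‖y‖ := hR.trans_le hRy
    set t := |u y| / ‖y‖ ^ s with ht
    have ht0 : 0 ≤ t := by positivity
    have hFy : F y = t ^ Lam * ‖y‖ ^ (-s - n) := by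
      rw [hF, ht, Real.div_rpow (abs_nonneg _) (by positivity), ← Real.rpow_mul hy0.le,
        show -s - (n : ℝ) = s * Lam - (n + s * (Lam + 1)) by ring, Real.rpow_sub hy0]
      field_simp
    have h1 : g t ≤ g a + g a * (a ^ (-Lam) * t ^ Lam) := by
      rcases le_total t a with hta | hta
      · have : 0 ≤ g a * (a ^ (-Lam) * t ^ Lam) := by positivity
        linarith [hg.monotone hta]
      · have h2 := hg.apply_mul_le_rpow (b := t / a) (t := a) (by rwa [le_div_iff₀ ha0, one_mul])
          ha0.le
        rw [div_mul_cancel₀ _ ha0.ne', Real.div_rpow ht0 ha0.le] at h2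
        rw [Real.rpow_neg ha0.le]
        have : t ^ Lam / a ^ Lam * g a = g a * ((a ^ Lam)⁻¹ * t ^ Lam) := by ring
        linarith
    rw [hFy]
    calc g t * ‖y‖ ^ (-s - n) ≤ (g a + g a * (a ^ (-Lam) * t ^ Lam)) * ‖y‖ ^ (-s - n) := by gcongr
      _ = _ := by ring
  have hi1 := (integrableOn_compl_ball (n := n) hn hs hR).const_mul (g a)
  have hi2 := hFi.const_mul (g a * a ^ (-Lam))
  have hi : IntegrableOn (fun y => g (|u y| / ‖y‖ ^ s) * ‖y‖ ^ (-s - n)) (Metric.ball 0 R)ᶜ := by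
    refine (hi1.add hi2).mono' (aestronglyMeasurable_tail hg (by fun_prop) _) ?_
    filter_upwards [ae_restrict_mem measurableSet_ball.compl] with y hy
    have h0 := hg.nonneg (t := |u y| / ‖y‖ ^ s) (by positivity)
    rw [Real.norm_eq_abs, abs_of_nonneg (by positivity)]
    exact hpt y hy
  refine ⟨hi, ?_⟩
  have h1 := setIntegral_mono_on hi (hi1.add hi2) measurableSet_ball.compl hpt
  rw [integral_add' hi1 hi2, integral_const_mul, integral_const_mul,
    setIntegral_compl_ball hn hs hR] at h1
  refine h1.trans ?_
  have h2 : g a * a ^ (-Lam) * M = g a * R ^ (-s) := by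
    have e : a ^ (-Lam) * M = R ^ (-s) := by
      rw [ha, hM, Real.div_rpow hL.le (by positivity), ← Real.rpow_mul hR.le, Real.rpow_neg hL.le,
        show -(s * (Lam + 1)) = s * -Lam + -s by ring, Real.rpow_add hR]
      field_simp
    rw [mul_assoc, e]
  have h3 : g a * a ^ (-Lam) * ∫ y in (Metric.ball (0 : Rn n) R)ᶜ, F y ≤ g a * a ^ (-Lam) * M := by
    gcongr
  linarith

/-- The hypotheses of the oscillation estimate, in the form in which the iteration uses them. -/
lemma isControlled_of_weaklyBounded (hg : IsAdmissible lam Lam g) (hn : 1 ≤ n) (hs : 0 < s)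
    {R K L : ℝ} (hR : 0 < R) (hK : 0 ≤ K) {u : Rn n → ℝ}
    (hu : MemWtilde g s (Metric.ball 0 R) u)
    (hub : MemLp u ⊤ (volume.restrict (Metric.ball 0 R)))
    (hw : WeaklyBounded g s (Metric.ball 0 R) u K) (ht : tail s (Lam + 1) u R < ⊤) (hL : 0 < L)
    (hLK : R ^ s * gInv g K ≤ L)
    (hLu : (eLpNorm u ∞ (volume.restrict (Metric.ball 0 R))).toReal ≤ L)
    (hLt : (tail s (Lam + 1) u R).toReal ≤ L) : IsControlled g s R L u := by
  obtain ⟨⟨hum, -⟩, U, -, -, hU, hnorm⟩ := hu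
  obtain ⟨hti, htl⟩ := tail_controls hg hn hs hR hL hum
    ((ENNReal.le_ofReal_iff_toReal_le ht.ne hL.le).mpr hLt)
  refine ⟨hum, ?_, ?_, hti, htl, ?_⟩
  · rw [← ae_restrict_iff' measurableSet_ball]
    have h1 := ae_le_eLpNormEssSup (f := u) (μ := volume.restrict (Metric.ball 0 R))
    filter_upwards [h1] with x hx
    rw [← eLpNorm_exponent_top] at hx
    have h2 := (ENNReal.toReal_le_toReal (by simp) hub.2.ne).mpr hx
    rw [toReal_enorm, Real.norm_eq_abs] at h2
    exact h2.trans hLu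
  · have h1 : luxemburg g (holderQuot s u) ((muMeasure n).restrict (U ×ˢ U)) < ∞ :=
      (le_add_left le_rfl).trans_lt ((le_add_right le_rfl).trans_lt hnorm)
    have hsub : Metric.ball (0 : Rn n) R ×ˢ Metric.ball (0 : Rn n) R ⊆ U ×ˢ U :=
      prod_mono (subset_closure.trans hU) (subset_closure.trans hU)
    refine integrableOn_energyDensity_of_luxemburg hg hum
      (measurableSet_ball.prod measurableSet_ball) (lt_of_le_of_lt ?_ h1)
    refine iInf_mono fun k => iInf_mono fun _ => iInf_mono' fun h2 => ⟨?_, le_rfl⟩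
    exact (lintegral_mono' (Measure.restrict_mono hsub le_rfl) le_rfl).trans h2
  · intro φ hφ hφ0
    obtain ⟨hI0, hgI⟩ := hg.gInv_mem hK
    have hKL : K ≤ g (L / R ^ s) := by
      rw [← hgI]
      refine hg.monotone ?_
      rw [le_div_iff₀ (by positivity)]
      linarith
    have h0 : 0 ≤ ∫ x in Metric.ball 0 R, φ x := integral_nonneg hφ0
    have h1 := hw.1 φ hφ (Eventually.of_forall hφ0)
    have h2 := hw.2 φ hφ (Eventually.of_forall hφ0)
    have h3 := energyForm_const_sub (s := s) hg u 0 φ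
    simp only [zero_sub] at h3
    rw [h3] at h2
    simp only [neg_neg] at h2
    rw [integral_const_mul] at h1 h2
    have h4 : K * ∫ x in Metric.ball 0 R, φ x ≤ g (L / R ^ s) * ∫ x in Metric.ball 0 R, φ x := by
      gcongr
    rw [abs_le]
    constructor <;> linarith

end Data

end OrliczOsc

theorem theorem3p4 (lam Lam : ℝ) (hlam : 1 < lam) (hLam : lam ≤ Lam) :
    ∃ β : ℝ, 0 < β ∧
      ∀ (n : ℕ) (_ : 1 ≤ n) (s : ℝ) (_ : 0 < s) (_ : s < 1),
        ∃ α C : ℝ, 0 < α ∧ α < 1 ∧ 0 < C ∧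
          ∀ (g : ℝ → ℝ) (_ : OrliczOsc.IsAdmissible lam Lam g)
            (R₀ : ℝ) (_ : 0 < R₀) (_ : R₀ < 1)
            (K : ℝ) (_ : 0 ≤ K)
            (u : OrliczOsc.Rn n → ℝ)
            (_ : OrliczOsc.MemWtilde g s (Metric.ball 0 R₀) u)
            (_ : MeasureTheory.MemLp u ⊤
              (MeasureTheory.volume.restrict (Metric.ball 0 R₀)))
            (_ : OrliczOsc.WeaklyBounded g s (Metric.ball 0 R₀) u K)
            (_ : OrliczOsc.tail s (Lam + 1) u R₀ < ⊤)
            (r : ℝ) (_ : 0 < r) (_ : r < R₀),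
            OrliczOsc.osc u r ≤
              C * (R₀ ^ (s - α) * OrliczOsc.gInv g K +
                R₀ ^ (-s) * OrliczOsc.Q s lam Lam β u R₀) * r ^ α := by
  open OrliczOsc in
  -- The estimate is homogeneous if `u` and the argument of `g` are rescaled together: only the
  -- exponent `1` is possible.
  refine ⟨1, one_pos, fun n hn s hs hs1 => ?_⟩
  obtain ⟨θ, κ, hθ, hκ, hgr⟩ := exists_hasGrowth n hn Lam hs hs1
  obtain ⟨α, C, hcst⟩ := exists_isIterationConst (n := n) (s := s) (Lam := Lam) hθ hκ
  have hα := hcst.α_pos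
  have hαs : α ≤ s := by
    have := hcst.α_le
    rw [div_le_one hs] at this
    linarith
  have hC := hcst.two_le
  refine ⟨α, 4 ^ α * C, hα, by linarith, by positivity, ?_⟩
  intro g hg R hR hR1 K hK u hu hub hw ht r hr hrR
  obtain ⟨hI0, -⟩ := hg.gInv_mem hK
  set N := (eLpNorm u ∞ (volume.restrict (Metric.ball 0 R))).toReal with hN
  set T := (tail s (Lam + 1) u R).toReal with hT
  have hN0 : 0 ≤ N := ENNReal.toReal_nonneg
  have hT0 : 0 ≤ T := ENNReal.toReal_nonneg
  have hT0' : 0 ≤ (tail s (lam + 1) u R).toReal := ENNReal.toReal_nonneg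
  have hRI : 0 ≤ R ^ s * gInv g K := by positivity
  have key : osc u r ≤ 4 ^ α * C * R ^ (-α) * r ^ α * (R ^ s * gInv g K + (N + T)) := by
    have hc : 0 < 4 ^ α * C * R ^ (-α) * r ^ α := by positivity
    -- The sum may vanish, so that it is first increased by a positive number.
    refine le_of_forall_pos_le_add fun δ hδ => ?_
    have hδ' : 0 < δ / (4 ^ α * C * R ^ (-α) * r ^ α) := by positivity
    have h1 := (isControlled_of_weaklyBounded hg hn hs hR hK hu hub hw ht
      (L := R ^ s * gInv g K + (N + T) + δ / (4 ^ α * C * R ^ (-α) * r ^ α)) (by positivity)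
      (by linarith) (by linarith) (by linarith)).osc_le hg hn hs hs1 hgr hcst hR hR1
      (by positivity) hr hrR
    rwa [mul_add, mul_div_cancel₀ _ hc.ne'] at h1
  refine key.trans ?_
  have h2 : R ^ (-α) * R ^ s = R ^ (s - α) := by
    rw [← Real.rpow_add hR]
    congr 1
    ring
  have h3 : R ^ (-α) ≤ R ^ (-s) :=
    Real.rpow_le_rpow_of_exponent_ge hR hR1.le (by linarith)
  have h4 : R ^ (-α) * (N + T) ≤ R ^ (-s) * Q s lam Lam 1 u R := by
    rw [Q, Real.rpow_one]
    refine mul_le_mul h3 (by linarith) (by positivity) (by positivity)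
  calc 4 ^ α * C * R ^ (-α) * r ^ α * (R ^ s * gInv g K + (N + T))
      = 4 ^ α * C * (R ^ (-α) * R ^ s * gInv g K + R ^ (-α) * (N + T)) * r ^ α := by ring
    _ ≤ _ := by
        rw [h2]
        gcongr
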